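/- **Setting.** Let $\mathcal V$ be a set of program variables. Each $v\in\mathcal V$ is classical or quantum, has a type (a set $\mathrm{Type}_v$) and a default value in $\mathrm{Type}_v$; for every $v$ there are infinitely many variables of the same kind and type, and some quantum variable has a type of cardinality $\aleph_0$. For $V\subseteq\mathcal V$ let $V^{\mathrm{cl}},V^{\mathrm{qu}}$ be its classical and quantum variables. Expressions $e$ depend on a finite set $\mathrm{fv}(e)$ of classical variables. For lists $X$ ($Q$) of distinct classical (quantum) variables, contexts are $$C,C' ::= \square_i \mid \mathbf{skip}\mid X\leftarrow e\mid X\stackrel{\$}{\leftarrow}e\mid \mathbf{if}\ e\ C\ C'\mid\mathbf{while}\ e\ C\mid C;C'\mid Q\stackrel{q}{\leftarrow}e\mid \mathbf{apply}\ e\ \mathbf{to}\ Q\mid X\leftarrow\mathbf{measure}\ Q\ \mathbf{with}\ e\mid\mathbf{local}\ v;\,C,$$ well-typed: $e$ evaluates, respectively, to a value, a subprobability distribution, a Boolean (if, while), a unit vector, an isometry, a projective measurement (with total possibly less than the identity). Programs are contexts without holes; $C[s_1,\dots,s_n]$ replaces each hole $\square_i$ by $s_i$ (with capture). The semantics $[\![c]\!]$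 of a program is the usual map on cq-operators $\sum_m|m\rangle\langle m|\otimes\rho_m$ ($m$ ranges over the assignments to the classical variables, $\rho_m$ is positive trace-class on the quantum variables, $\sum_m\operatorname{tr}\rho_m<\infty$); $\mathbf{local}\ v;c$ saves $v$, initializes $v$ with its default value, runs $c$, discards $v$ and restores the saved $v$ (for quantum $v$: swaps $v$ with a fresh register in the default state, applies $[\![c]\!]\otimes\mathrm{id}$, swaps back and traces out the register). **Variable sets.** * $\mathrm{fv}(C)$: all variables occurring in $C$, except that $\mathrm{fv}(\mathbf{local}\ v;C)=\mathrm{fv}(C)\setminus\{v\}$. * $\mathrm{inner}(C)$: all $v$ such that some hole of $C$ lies under a $\mathbf{local}\ v$. $\mathrm{covered}(C)$: all $v$ such that every hole of $C$ lies under a $\mathbf{local}\ v$. * $\mathrm{written}(C)$: all classical variables on the left-hand side of an assignment, sampling or measurement and all quantum variables in initializations, applications and measurements, with $\mathrm{written}(\mathbf{local}\ v;C)=\mathrm{written}(C)\setminus\{v\}$. * $\mathrm{overwr}(C)$: equals $X\setminus\mathrm{fv}(e)$ for assignment, sampling and measurement; $Q$ for initialization; $\varnothing$ for holes, $\mathbf{skip}$,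 applications and loops; $(\mathrm{overwr}(C)\cap\mathrm{overwr}(C'))\setminus\mathrm{fv}(e)$ for $\mathbf{if}\ e\ C\ C'$; $\mathrm{overwr}(C)\setminus\{v\}$ for $\mathbf{local}\ v;C$; and $\mathrm{overwr}(C)\cup\bigl((\mathrm{overwr}(C')\setminus\mathrm{fv}(C))\cap\mathrm{covered}(C)\bigr)$ for $C;C'$. **Judgments.** A quantum predicate $A$ on two memories assigns to each pair $(m_1,m_2)$ of classical assignments a closed subspace of the joint space of two copies (indexed $1$ and $2$) of all quantum variables. A two-memory cq-operator satisfies $A$ if for all $m_1,m_2$ the support of its $(m_1,m_2)$-component lies in $A(m_1,m_2)$; it is separable if it is a countable sum of products of a cq-operator on memory 1 and one on memory 2. $\{A\}\,c\sim d\,\{B\}$ means: for every separable $\rho$ satisfying $A$ there is a separable $\rho'$ satisfying $B$ with $\operatorname{tr}_2\rho'=[\![c]\!](\operatorname{tr}_2\rho)$ and $\operatorname{tr}_1\rho'=[\![d]\!](\operatorname{tr}_1\rho)$. The predicate $\equiv V$ is, at $(m_1,m_2)$, the space of all vectors invariant under swapping $V^{\mathrm{qu}}_1$ with $V^{\mathrm{qu}}_2$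 if $m_1=m_2$ on $V^{\mathrm{cl}}$, and the zero space otherwise. **Theorem (Adversary rule).** Let $C$ be a context with holes $\square_1,\dots,\square_n$, let $s_1,\dots,s_n,s'_1,\dots,s'_n$ be programs, $R$ a quantum predicate on two memories that depends on finitely many variables, $V_R$ the set of all $v$ such that $v_1$ or $v_2$ is a free variable of $R$, $V_{in},V_{mid},V_{out}$ finite sets of variables, and $q_{aux}$ a quantum variable of infinite type. Suppose that * $q_{aux}\notin V_R$, $q_{aux}\in V_{mid}$, and $q_{aux}\notin\mathrm{fv}(s_i)\cup\mathrm{fv}(s'_i)$ for all $i$; * $\mathrm{inner}(C)\subseteq V_{mid}$ and $V_{out}\subseteq V_{mid}$; * $V_{out}\setminus\mathrm{overwr}(C)\subseteq V_{in}$ and $(V_{out}\setminus V_{in})\cap V_R=\varnothing$; * $V_{in}^{\mathrm{qu}}\subseteq V_{out}\cup\mathrm{overwr}(C)$ and $(V_{in}\setminus V_{out})^{\mathrm{qu}}\cap V_R=\varnothing$; * $V_{mid}\cap V_R\subseteq V_{in}\cup\mathrm{covered}(C)$ and $(V_{mid}\cap V_R)^{\mathrm{qu}}\subseteq V_{out}\cup\mathrm{covered}(C)$;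 * for all $i$: $V_{mid}\cap(\mathrm{fv}(s_i)\cup\mathrm{fv}(s'_i))\subseteq V_{in}\cup\mathrm{covered}(C)\cup(\mathrm{overwr}(s_i)\cap\mathrm{overwr}(s'_i))^{\mathrm{cl}}$; * for all $i$: $V_{mid}^{\mathrm{qu}}\cap(\mathrm{fv}(s_i)\cup\mathrm{fv}(s'_i))\subseteq V_{out}\cup\mathrm{covered}(C)$; * $\mathrm{fv}(C)\subseteq V_{mid}$, $\mathrm{fv}(C)\subseteq V_{in}\cup\mathrm{overwr}(C)$, $\mathrm{fv}(C)\cap V_R\subseteq V_{in}$, and $\mathrm{fv}(C)^{\mathrm{qu}}\subseteq V_{out}$; * $V_R\cap\mathrm{inner}(C)=\varnothing$ and $V_R\cap\mathrm{written}(C)=\varnothing$; * for all $i$: $\{R\cap{\equiv}V_{mid}\}\,s_i\sim s'_i\,\{R\cap{\equiv}V_{mid}\}$. Then $\{R\cap{\equiv}V_{in}\}\;C[s_1,\dots,s_n]\sim C[s'_1,\dots,s'_n]\;\{R\cap{\equiv}V_{out}\}$. -/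

import Mathlib

universe u

open scoped Classical

namespace QRHL

noncomputable section

/-! ### Hilbert spaces with a canonical basis, and operators on them -/

/-- The Hilbert space with orthonormal basis indexed by `X`. -/
abbrev L2 (X : Type u) : Type u := lp (fun _ : X => ℂ) 2

/-- Bounded operators. -/
abbrev Op (X : Type u) : Type u := L2 X →L[ℂ] L2 X

/-- The basis vector `|x⟩`. -/
def ket {X : Type u} (x : X) : L2 X := lp.single 2 x (1 : ℂ)

theorem L2.summable_sq {X : Type u} (ψ : L2 X) : Summable fun x => ‖ψ x‖ ^ 2 := by
  have h := (memℓp_gen_iff (p := 2) (by norm_num)).1 (lp.memℓp ψ)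
  simpa using h

theorem L2.norm_sq {X : Type u} (ψ : L2 X) : ‖ψ‖ ^ 2 = ∑' x, ‖ψ x‖ ^ 2 := by
  have h := lp.norm_rpow_eq_tsum (p := 2) (by norm_num) ψ
  simpa using h

theorem L2.mem_of_summable {X : Type u} {f : X → ℂ} (h : Summable fun x => ‖f x‖ ^ 2) :
    Memℓp f 2 :=
  memℓp_gen (by simpa using h)

/-- Restriction along an injection of the bases: `(pull f ψ) x = ψ (f x)`.
Its adjoint is the isometry `|x⟩ ↦ |f x⟩`. -/
def pull {X Y : Type u} (f : X ↪ Y) : L2 Y →L[ℂ] L2 X :=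
  LinearMap.mkContinuous
    { toFun := fun ψ => ⟨fun x => ψ (f x),
        L2.mem_of_summable ((L2.summable_sq ψ).comp_injective f.injective)⟩
      map_add' := fun _ _ => rfl
      map_smul' := fun _ _ => rfl } 1 (by
    intro ψ
    rw [one_mul]
    refine le_of_sq_le_sq ?_ (norm_nonneg _)
    rw [L2.norm_sq, L2.norm_sq]
    exact tsum_comp_le_tsum_of_inj (L2.summable_sq ψ) (fun _ => sq_nonneg _) f.injective)

@[simp] theorem pull_apply {X Y : Type u} (f : X ↪ Y) (ψ : L2 Y) (x : X) :
    pull f ψ x = ψ (f x) := rfl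

/-- Transport of an operator along a bijection of the bases (conjugation with the unitary
`|x⟩ ↦ |σ x⟩`). -/
def reindex {X Y : Type u} (σ : X ≃ Y) (A : Op X) : Op Y :=
  pull σ.symm.toEmbedding ∘L A ∘L pull σ.toEmbedding

/-- The operator `1 ⊗ ⟨y|` from `L2 X ⊗ L2 Y = L2 (X × Y)` to `L2 X`. -/
def sliceFst {X Y : Type u} (y : Y) : L2 (X × Y) →L[ℂ] L2 X :=
  pull ⟨fun x => (x, y), fun _ _ h => (Prod.mk.inj h).1⟩

/-- The operator `⟨x| ⊗ 1`. -/
def sliceSnd {X Y : Type u} (x : X) : L2 (X × Y) →L[ℂ] L2 Y :=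
  pull ⟨fun y => (x, y), fun _ _ h => (Prod.mk.inj h).2⟩

theorem L2.summable_slices {X Y : Type u} (ψ : L2 (X × Y)) :
    Summable fun y => ‖sliceFst y ψ‖ ^ 2 := by
  have h := ((Equiv.prodComm Y X).summable_iff (f := fun p => ‖ψ p‖ ^ 2)).2 (L2.summable_sq ψ)
  have h' := ((summable_prod_of_nonneg (fun _ => sq_nonneg _)).1 h).2
  refine h'.congr fun y => ?_
  rw [L2.norm_sq]
  rfl

theorem L2.tsum_slices {X Y : Type u} (ψ : L2 (X × Y)) :
    ∑' y, ‖sliceFst y ψ‖ ^ 2 = ‖ψ‖ ^ 2 := by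
  have h := ((Equiv.prodComm Y X).summable_iff (f := fun p => ‖ψ p‖ ^ 2)).2 (L2.summable_sq ψ)
  rw [L2.norm_sq ψ, ← (Equiv.prodComm Y X).tsum_eq (fun p => ‖ψ p‖ ^ 2)]
  refine Eq.trans (tsum_congr fun y => ?_) h.tsum_prod.symm
  rw [L2.norm_sq]
  rfl

theorem L2.summable_ampl {X Y : Type u} (A : Op X) (ψ : L2 (X × Y)) :
    Summable fun p : X × Y => ‖A (sliceFst p.2 ψ) p.1‖ ^ 2 := by
  rw [← (Equiv.prodComm Y X).summable_iff]
  refine (summable_prod_of_nonneg (fun _ => sq_nonneg _)).2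
    ⟨fun y => L2.summable_sq (A (sliceFst y ψ)), ?_⟩
  refine Summable.of_nonneg_of_le (fun y => tsum_nonneg fun _ => sq_nonneg _) (fun y => ?_)
    ((L2.summable_slices ψ).mul_left (‖A‖ ^ 2))
  calc _ = ‖A (sliceFst y ψ)‖ ^ 2 := (L2.norm_sq _).symm
    _ ≤ (‖A‖ * ‖sliceFst y ψ‖) ^ 2 := by gcongr; exact A.le_opNorm _
    _ = _ := by ring

/-- The operator `A ⊗ 1` on `L2 (X × Y)`: `A` acts on every slice. -/
def ampl {X : Type u} (Y : Type u) (A : Op X) : Op (X × Y) :=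
  LinearMap.mkContinuous
    { toFun := fun ψ => ⟨fun p => A (sliceFst p.2 ψ) p.1,
        L2.mem_of_summable (L2.summable_ampl A ψ)⟩
      map_add' := fun ψ φ => by ext p; simp; rfl
      map_smul' := fun c ψ => by ext p; simp } ‖A‖ (by
    intro ψ
    refine le_of_sq_le_sq ?_ (by positivity)
    rw [mul_pow, ← L2.tsum_slices ψ, ← tsum_mul_left, L2.norm_sq]
    have h := ((Equiv.prodComm Y X).summable_iff
      (f := fun p : X × Y => ‖A (sliceFst p.2 ψ) p.1‖ ^ 2)).2 (L2.summable_ampl A ψ)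
    have e := (Equiv.prodComm Y X).tsum_eq (fun p : X × Y => ‖A (sliceFst p.2 ψ) p.1‖ ^ 2)
    refine (e.symm.trans h.tsum_prod).trans_le ?_
    refine Summable.tsum_le_tsum (fun y => ?_)
      ((summable_prod_of_nonneg (fun _ => sq_nonneg _)).1 h).2
      ((L2.summable_slices ψ).mul_left _)
    calc _ = ‖A (sliceFst y ψ)‖ ^ 2 := (L2.norm_sq _).symm
      _ ≤ (‖A‖ * ‖sliceFst y ψ‖) ^ 2 := by gcongr; exact A.le_opNorm _
      _ = _ := by ring)

@[simp] theorem ampl_apply {X Y : Type u} (A : Op X) (ψ : L2 (X × Y)) (p : X × Y) :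
    ampl Y A ψ p = A (sliceFst p.2 ψ) p.1 := rfl

/-- The tensor product `A ⊗ B = (A ⊗ 1)(1 ⊗ B)`. -/
def tensor {X Y : Type u} (A : Op X) (B : Op Y) : Op (X × Y) :=
  ampl Y A ∘L reindex (Equiv.prodComm Y X) (ampl X B)

/-- `|ψ⟩⟨ψ|` -/
def proj {X : Type u} (ψ : L2 X) : Op X := InnerProductSpace.rankOne ℂ ψ ψ

/-- The partial trace over the second factor, `∑_y (1 ⊗ ⟨y|) ρ (1 ⊗ |y⟩)`.
(For trace-class `ρ` the sum converges absolutely in operator norm.) -/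
def ptraceSnd {X Y : Type u} (ρ : Op (X × Y)) : Op X :=
  ∑' y, sliceFst y ∘L ρ ∘L (sliceFst y).adjoint

/-- The partial trace over the first factor. -/
def ptraceFst {X Y : Type u} (ρ : Op (X × Y)) : Op Y :=
  ∑' x, sliceSnd x ∘L ρ ∘L (sliceSnd x).adjoint

/-- The diagonal entry `⟨x|A|x⟩` (real part). -/
def diag {X : Type u} (A : Op X) (x : X) : ℝ := (inner ℂ (ket x) (A (ket x))).re

/-- Positive trace-class operators: positive with summable diagonal. -/
def IsPosTraceClass {X : Type u} (A : Op X) : Prop := A.IsPositive ∧ Summable (diag A)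

/-- The trace (of a positive trace-class operator). -/
def trace {X : Type u} (A : Op X) : ℝ := ∑' x, diag A x

/-- The support of a (self-adjoint) operator: the closure of its range. -/
def supp {X : Type u} (A : Op X) : ClosedSubmodule ℂ (L2 X) := (LinearMap.range A.toLinearMap).closure

/-- cq-operators: the family `ρ` stands for `∑_m |m⟩⟨m| ⊗ ρ m`, where `m` ranges over the
classical memories and all `ρ m` are positive and trace-class; the total trace is finite. -/
def IsCQ {M : Type*} {X : Type u} (ρ : M → Op X) : Prop :=
  (∀ m, IsPosTraceClass (ρ m)) ∧ Summable fun m => trace (ρ m)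

/-! ### Variables and memories -/

/-- The set of all program variables: classical and quantum variables, each with a type and a
default value in that type. For every variable there are infinitely many variables that are
compatible with it (same kind, same type), and some quantum variable has a type of
cardinality `ℵ₀`. -/
structure VarSystem where
  CVar : Type u
  QVar : Type u
  ctyp : CVar → Type u
  qtyp : QVar → Type u
  cinit : ∀ x, ctyp x
  qinit : ∀ q, qtyp q
  infinite_compatible_cvar : ∀ x, {y | ctyp y = ctyp x}.Infinite
  infinite_compatible_qvar : ∀ q, {r | qtyp r = qtyp q}.Infinite
  exists_aleph0_qvar : ∃ q, Cardinal.mk (qtyp q) = Cardinal.aleph0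

variable {S : VarSystem.{u}} {n : ℕ}

/-- All variables: `Sum.inl x` is a classical variable, `Sum.inr q` a quantum variable. -/
abbrev VarSystem.Var (S : VarSystem.{u}) : Type u := S.CVar ⊕ S.QVar

/-- Assignments of values to all classical variables. -/
abbrev VarSystem.CMem (S : VarSystem.{u}) : Type u := ∀ x : S.CVar, S.ctyp x

/-- Assignments of values to all quantum variables; `L2 S.QMem` is the space of the states of all
quantum variables. -/
abbrev VarSystem.QMem (S : VarSystem.{u}) : Type u := ∀ q : S.QVar, S.qtyp q

/-- The classical variables in `V`. -/
def clPart (V : Set S.Var) : Set S.Var := V ∩ Set.range Sum.inl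

/-- The quantum variables in `V`. -/
def quPart (V : Set S.Var) : Set S.Var := V ∩ Set.range Sum.inr

/-- Splitting an assignment into its values on a list `Q` of distinct variables (as a tuple) and
its values on the remaining variables. -/
def splitList {V : Type u} {τ : V → Type u} {k : ℕ} (Q : Fin k ↪ V) :
    (∀ v, τ v) ≃ (∀ i, τ (Q i)) × (∀ v : {v // ¬ v ∈ Set.range Q}, τ v) :=
  (Equiv.piEquivPiSubtypeProd (fun v => v ∈ Set.range Q) τ).trans
    (Equiv.prodCongr
      (Equiv.piCongrLeft (fun v : {v // v ∈ Set.range Q} => τ v)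
        (Equiv.ofInjective Q Q.injective)).symm
      (Equiv.refl _))

theorem splitList_fst {V : Type u} {τ : V → Type u} {k : ℕ} (Q : Fin k ↪ V) (m : ∀ v, τ v)
    (i : Fin k) : (splitList Q m).1 i = m (Q i) := rfl

theorem splitList_snd {V : Type u} {τ : V → Type u} {k : ℕ} (Q : Fin k ↪ V) (m : ∀ v, τ v)
    (v : {v // ¬ v ∈ Set.range Q}) : (splitList Q m).2 v = m v := rfl

/-- `m(X := t)`: simultaneous update of a list of distinct variables. -/
def updList {V : Type u} {τ : V → Type u} {k : ℕ} (X : Fin k ↪ V) (m : ∀ v, τ v)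
    (t : ∀ i, τ (X i)) : ∀ v, τ v :=
  (splitList X).symm (t, (splitList X m).2)

/-! ### Expressions, programs and contexts -/

/-- Expressions with values in `α`: formulas over a finite set `vars` of classical variables. -/
structure Expr (S : VarSystem.{u}) (α : Type u) where
  vars : Finset S.CVar
  eval : S.CMem → α
  dependsOn : DependsOn eval (vars : Set S.CVar)

/-- The free variables of an expression. -/
def Expr.fv {α : Type u} (e : Expr S α) : Set S.Var := Sum.inl '' (e.vars : Set S.CVar)

/-- (Discrete) subprobability distributions on `T`. -/
def SubDistr (T : Type u) : Type u := {p : T → NNReal // ∑' t, (p t : ENNReal) ≤ 1}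

/-- Projective measurements on `L2 T` with outcomes in `D`: families of mutually orthogonal
projectors (equivalently, of projectors whose sum is at most the identity). -/
structure ProjMeas (T D : Type u) : Type u where
  op : D → Op T
  isProj : ∀ z, IsStarProjection (op z)
  orthogonal : ∀ z z', z ≠ z' → op z ∘L op z' = 0

/-- Contexts with holes `0, …, n - 1`. A list of distinct variables is an injective map from
`Fin k`; well-typedness is built into the types of the expressions. -/
inductive Ctx (S : VarSystem.{u}) (n : ℕ) : Type u
  | hole (i : Fin n) : Ctx S n
  | skip : Ctx S n
  | assign {k : ℕ} (X : Fin k ↪ S.CVar) (e : Expr S (∀ i, S.ctyp (X i))) : Ctx S n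
  | sample {k : ℕ} (X : Fin k ↪ S.CVar) (e : Expr S (SubDistr (∀ i, S.ctyp (X i)))) : Ctx S n
  | ite (e : Expr S (ULift.{u} Bool)) (C D : Ctx S n) : Ctx S n
  | whileLoop (e : Expr S (ULift.{u} Bool)) (C : Ctx S n) : Ctx S n
  | seq (C D : Ctx S n) : Ctx S n
  | qinit {k : ℕ} (Q : Fin k ↪ S.QVar)
      (e : Expr S {ψ : L2 (∀ i, S.qtyp (Q i)) // ‖ψ‖ = 1}) : Ctx S n
  | qapply {k : ℕ} (Q : Fin k ↪ S.QVar)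
      (e : Expr S (L2 (∀ i, S.qtyp (Q i)) →ₗᵢ[ℂ] L2 (∀ i, S.qtyp (Q i)))) : Ctx S n
  | measure {k l : ℕ} (X : Fin k ↪ S.CVar) (Q : Fin l ↪ S.QVar)
      (e : Expr S (ProjMeas (∀ i, S.qtyp (Q i)) (∀ i, S.ctyp (X i)))) : Ctx S n
  | loc (v : S.Var) (C : Ctx S n) : Ctx S n

/-- Programs are contexts without holes. -/
abbrev Prog (S : VarSystem.{u}) : Type u := Ctx S 0

namespace Ctx

/-- `C[s₁, …, sₙ]`: every hole `i` is replaced by `s i` (variables may be captured). -/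
def fill (s : Fin n → Prog S) : Ctx S n → Prog S
  | hole i => s i
  | skip => skip
  | assign X e => assign X e
  | sample X e => sample X e
  | ite e C D => ite e (fill s C) (fill s D)
  | whileLoop e C => whileLoop e (fill s C)
  | seq C D => seq (fill s C) (fill s D)
  | qinit Q e => qinit Q e
  | qapply Q e => qapply Q e
  | measure X Q e => measure X Q e
  | loc v C => loc v (fill s C)

/-- The context contains no hole. -/
def IsProgram : Ctx S n → Prop
  | hole _ => False
  | ite _ C D => IsProgram C ∧ IsProgram D
  | whileLoop _ C => IsProgram C
  | seq C D => IsProgram C ∧ IsProgram D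
  | loc _ C => IsProgram C
  | _ => True

/-- A list of classical variables, as a set of variables. -/
def cset {k : ℕ} (X : Fin k ↪ S.CVar) : Set S.Var := Set.range fun i => Sum.inl (X i)

/-- A list of quantum variables, as a set of variables. -/
def qset {k : ℕ} (Q : Fin k ↪ S.QVar) : Set S.Var := Set.range fun i => Sum.inr (Q i)

/-- Free variables. -/
def fv : Ctx S n → Set S.Var
  | hole _ => ∅
  | skip => ∅
  | assign X e => cset X ∪ e.fv
  | sample X e => cset X ∪ e.fv
  | ite e C D => e.fv ∪ fv C ∪ fv D
  | whileLoop e C => e.fv ∪ fv C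
  | seq C D => fv C ∪ fv D
  | qinit Q e => qset Q ∪ e.fv
  | qapply Q e => qset Q ∪ e.fv
  | measure X Q e => qset Q ∪ cset X ∪ e.fv
  | loc v C => fv C \ {v}

/-- Inner variables: variables `v` such that some hole is under a declaration `local v`. -/
def inner : Ctx S n → Set S.Var
  | ite _ C D => inner C ∪ inner D
  | whileLoop _ C => inner C
  | seq C D => inner C ∪ inner D
  | loc v C => if IsProgram C then ∅ else inner C ∪ {v}
  | _ => ∅

/-- Covered variables: variables `v` such that every hole is under a declaration `local v`. -/
def covered : Ctx S n → Set S.Var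
  | hole _ => ∅
  | ite _ C D => covered C ∩ covered D
  | whileLoop _ C => covered C
  | seq C D => covered C ∩ covered D
  | loc v C => covered C ∪ {v}
  | _ => Set.univ

theorem inner_of_isProgram : ∀ C : Ctx S n, C.IsProgram → C.inner = ∅
  | hole _, _ => rfl
  | skip, _ => rfl
  | assign _ _, _ => rfl
  | sample _ _, _ => rfl
  | qinit _ _, _ => rfl
  | qapply _ _, _ => rfl
  | measure _ _ _, _ => rfl
  | ite _ C D, h => by simp [inner, inner_of_isProgram C h.1, inner_of_isProgram D h.2]
  | whileLoop _ C, h => by simp [inner, inner_of_isProgram C h]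
  | seq C D, h => by simp [inner, inner_of_isProgram C h.1, inner_of_isProgram D h.2]
  | loc _ C, h => if_pos (show C.IsProgram from h)

theorem covered_of_isProgram : ∀ C : Ctx S n, C.IsProgram → C.covered = Set.univ
  | hole _, h => h.elim
  | skip, _ => rfl
  | assign _ _, _ => rfl
  | sample _ _, _ => rfl
  | qinit _ _, _ => rfl
  | qapply _ _, _ => rfl
  | measure _ _ _, _ => rfl
  | ite _ C D, h => by simp [covered, covered_of_isProgram C h.1, covered_of_isProgram D h.2]
  | whileLoop _ C, h => by simp [covered, covered_of_isProgram C h]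
  | seq C D, h => by simp [covered, covered_of_isProgram C h.1, covered_of_isProgram D h.2]
  | loc _ C, h => by simp [covered, covered_of_isProgram C h]

/-- Overwritten variables: variables that are written before they are used for the first time. -/
def overwr : Ctx S n → Set S.Var
  | hole _ => ∅
  | skip => ∅
  | assign X e => cset X \ e.fv
  | sample X e => cset X \ e.fv
  | ite e C D => (overwr C ∩ overwr D) \ e.fv
  | whileLoop _ _ => ∅
  | seq C D => overwr C ∪ ((overwr D \ fv C) ∩ covered C)
  | qinit Q _ => qset Q
  | qapply _ _ => ∅
  | measure X _ e => cset X \ e.fv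
  | loc v C => overwr C \ {v}

/-- Written variables: classical variables that are assigned to, and all free quantum
variables. -/
def written : Ctx S n → Set S.Var
  | hole _ => ∅
  | skip => ∅
  | assign X _ => cset X
  | sample X _ => cset X
  | ite _ C D => written C ∪ written D
  | whileLoop _ C => written C
  | seq C D => written C ∪ written D
  | qinit Q _ => qset Q
  | qapply Q _ => qset Q
  | measure X Q _ => cset X ∪ qset Q
  | loc v C => written C \ {v}

end Ctx

/-! ### Semantics of programs

A program acts on cq-operators over the classical memory and `L2 (S.QMem × E)`, where `E` is an
arbitrary register that the program does not touch; that is, `denE c E` is `⟦c⟧ ⊗ id_E`. The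
register is what makes it possible to apply `⟦c⟧ ⊗ id` in the semantics of local variables. All
operators are given on trace-class cq-operators, on which every sum below converges absolutely in
operator norm. -/

/-- A family of operators, one for each classical memory (see `IsCQ`), over the quantum variables
and the register `E`. -/
abbrev Fam (S : VarSystem.{u}) (E : Type u) : Type u := S.CMem → Op (S.QMem × E)

/-- Singling out the quantum variables in the list `Q`. -/
def splitReg (E : Type u) {k : ℕ} (Q : Fin k ↪ S.QVar) :
    S.QMem × E ≃
      (∀ i, S.qtyp (Q i)) × ((∀ q : {q // ¬ q ∈ Set.range Q}, S.qtyp q) × E) :=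
  (Equiv.prodCongr (splitList (τ := S.qtyp) Q) (Equiv.refl E)).trans (Equiv.prodAssoc _ _ _)

/-- An operator on the quantum variables in the list `Q`, extended by the identity. -/
def liftOp (E : Type u) {k : ℕ} (Q : Fin k ↪ S.QVar) (A : Op (∀ i, S.qtyp (Q i))) :
    Op (S.QMem × E) :=
  reindex (splitReg E Q).symm (ampl _ A)

/-- Restriction of a cq-operator to the part where `b` holds. -/
def restrictFam {E : Type u} (b : S.CMem → Prop) (ρ : Fam S E) : Fam S E :=
  fun m => if b m then ρ m else 0

/-- Swapping the content of the quantum variable `q` with a fresh register of the same type. -/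
def swapLocal (S : VarSystem.{u}) (E : Type u) (q : S.QVar) :
    (S.QMem × E) × S.qtyp q ≃ S.QMem × (E × S.qtyp q) where
  toFun p := (Function.update p.1.1 q p.2, (p.1.2, p.1.1 q))
  invFun p := ((Function.update p.1 q p.2.2, p.2.1), p.1 q)
  left_inv p := by simp
  right_inv p := by simp

/-- The semantics `⟦c⟧ ⊗ id_E` of a program `c`. -/
def denE : Prog S → (E : Type u) → Fam S E → Fam S E
  | .hole i, _ => i.elim0
  | .skip, _ => fun ρ => ρ
  | .assign X e, _ => fun ρ m' => ∑' m, if updList X m (e.eval m) = m' then ρ m else 0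
  | .sample X e, _ => fun ρ m' => ∑' m, ∑' z,
      if updList X m z = m' then (((e.eval m).1 z : ℝ) : ℂ) • ρ m else 0
  | .ite e c d, E => fun ρ =>
      denE c E (restrictFam (fun m => (e.eval m).down = true) ρ) +
      denE d E (restrictFam (fun m => ¬ (e.eval m).down = true) ρ)
  | .whileLoop e c, E => fun ρ m => ∑' i : ℕ,
      restrictFam (fun m => ¬ (e.eval m).down = true)
        ((fun σ => denE c E (restrictFam (fun m => (e.eval m).down = true) σ))^[i] ρ) m
  | .seq c d, E => fun ρ => denE d E (denE c E ρ)
  | .qinit Q e, E => fun ρ m =>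
      reindex (splitReg E Q).symm
        (tensor (proj (e.eval m).1) (ptraceFst (reindex (splitReg E Q) (ρ m))))
  | .qapply Q e, E => fun ρ m =>
      let U := liftOp E Q (e.eval m).toContinuousLinearMap
      U ∘L ρ m ∘L U.adjoint
  | .measure X Q e, E => fun ρ m' => ∑' m, ∑' z,
      if updList X m z = m' then
        liftOp E Q ((e.eval m).op z) ∘L ρ m ∘L liftOp E Q ((e.eval m).op z)
      else 0
  -- A classical local variable `x`: for each original value `a = m x` of `x`, the program is run
  -- with `x` initialized to its default value, then `x` is traced out and `a` is restored.
  | .loc (.inl x) c, E => fun ρ m => ∑' a : S.ctyp x,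
      denE c E
        (fun m' => if m' x = S.cinit x then ρ (Function.update m' x (m x)) else 0)
        (Function.update m x a)
  -- A quantum local variable `q`: a fresh register in the default state is added and swapped
  -- with `q`, the program is run, the register is swapped back and traced out.
  | .loc (.inr q) c, E => fun ρ m =>
      ptraceSnd (reindex (swapLocal S E q).symm
        (denE c (E × S.qtyp q)
          (fun m' => reindex (swapLocal S E q) (tensor (ρ m') (proj (ket (S.qinit q))))) m))

/-- The semantics `⟦c⟧` of a program `c`, acting on cq-operators over all variables. -/
def den (c : Prog S) (ρ : S.CMem → Op S.QMem) : S.CMem → Op S.QMem := fun m =>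
  reindex (Equiv.prodPUnit S.QMem)
    (denE c PUnit (fun m' => reindex (Equiv.prodPUnit S.QMem).symm (ρ m')) m)

/-! ### Quantum predicates on two memories -/

/-- Quantum predicates over two copies (index 1 and index 2) of all variables: a closed subspace
for every assignment to the classical variables of both memories. -/
abbrev QPred (S : VarSystem.{u}) : Type u :=
  S.CMem → S.CMem → ClosedSubmodule ℂ (L2 (S.QMem × S.QMem))

/-- Swapping the quantum variables in `V` between the two memories. -/
def swapVars (V : Set S.Var) : S.QMem × S.QMem ≃ S.QMem × S.QMem where
  toFun p := (fun q => if Sum.inr q ∈ V then p.2 q else p.1 q,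
    fun q => if Sum.inr q ∈ V then p.1 q else p.2 q)
  invFun p := (fun q => if Sum.inr q ∈ V then p.2 q else p.1 q,
    fun q => if Sum.inr q ∈ V then p.1 q else p.2 q)
  left_inv p := by ext q <;> by_cases h : Sum.inr q ∈ V <;> simp [h]
  right_inv p := by ext q <;> by_cases h : Sum.inr q ∈ V <;> simp [h]

/-- The quantum equality: the space of all vectors that are invariant under the swap of the
quantum variables in `V` of the first memory with those of the second memory. -/
def qEq (V : Set S.Var) : ClosedSubmodule ℂ (L2 (S.QMem × S.QMem)) :=
  (⊥ : ClosedSubmodule ℂ (L2 (S.QMem × S.QMem))).comap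
    (pull (swapVars V).toEmbedding - ContinuousLinearMap.id ℂ _)

theorem mem_qEq {V : Set S.Var} {ψ : L2 (S.QMem × S.QMem)} :
    ψ ∈ qEq V ↔ pull (swapVars V).toEmbedding ψ = ψ := by
  simp [qEq, ClosedSubmodule.mem_comap, sub_eq_zero]

/-- `CL[P]` -/
def CL (P : Prop) : ClosedSubmodule ℂ (L2 (S.QMem × S.QMem)) := if P then ⊤ else ⊥

/-- The predicate `≡V`: quantum equality of the quantum variables in `V`, and equality of the
classical variables in `V`. -/
def eqv (V : Set S.Var) : QPred S := fun m₁ m₂ =>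
  qEq V ⊓ CL (∀ x, Sum.inl x ∈ V → m₁ x = m₂ x)

/-- Combining values of the quantum variables in `F` with values of those outside `F`. -/
def glue (F : Set S.Var) (a : ∀ q : {q // Sum.inr q ∈ F}, S.qtyp q)
    (b : ∀ q : {q // ¬ Sum.inr q ∈ F}, S.qtyp q) : S.QMem :=
  (Equiv.piEquivPiSubtypeProd (fun q => Sum.inr q ∈ F) S.qtyp).symm (a, b)

theorem glue_injective (F : Set S.Var) (b : ∀ q : {q // ¬ Sum.inr q ∈ F}, S.qtyp q) :
    Function.Injective fun a => glue F a b := fun _ _ h =>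
  congrArg Prod.fst ((Equiv.piEquivPiSubtypeProd (fun q => Sum.inr q ∈ F) S.qtyp).symm.injective h)

/-- The operator `1 ⊗ ⟨b₁, b₂|` which projects the quantum variables outside `F₁` (in the first
memory) and outside `F₂` (in the second memory) onto the given basis state. -/
def slice (F₁ F₂ : Set S.Var) (b₁ : ∀ q : {q // ¬ Sum.inr q ∈ F₁}, S.qtyp q)
    (b₂ : ∀ q : {q // ¬ Sum.inr q ∈ F₂}, S.qtyp q) :
    L2 (S.QMem × S.QMem) →L[ℂ]
      L2 ((∀ q : {q // Sum.inr q ∈ F₁}, S.qtyp q) × (∀ q : {q // Sum.inr q ∈ F₂}, S.qtyp q)) :=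
  pull ⟨fun a => (glue F₁ a.1 b₁, glue F₂ a.2 b₂), fun _ _ h =>
    Prod.ext (glue_injective F₁ b₁ (Prod.mk.inj h).1) (glue_injective F₂ b₂ (Prod.mk.inj h).2)⟩

/-- `A` is a predicate over the variables `F₁` of the first and `F₂` of the second memory: the
subspace is determined by the classical variables in these sets, and it is of the form
`T ⊗ (whole space of the remaining quantum variables)`, where `T` is a subspace of the space of
the quantum variables in these sets. -/
def QPred.IsOver (A : QPred S) (F₁ F₂ : Set S.Var) : Prop :=
  (∀ m₁ m₂ m₁' m₂' : S.CMem, (∀ x, Sum.inl x ∈ F₁ → m₁ x = m₁' x) →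
    (∀ x, Sum.inl x ∈ F₂ → m₂ x = m₂' x) → A m₁ m₂ = A m₁' m₂') ∧
  ∀ m₁ m₂ : S.CMem, ∃ T : ClosedSubmodule ℂ
      (L2 ((∀ q : {q // Sum.inr q ∈ F₁}, S.qtyp q) × (∀ q : {q // Sum.inr q ∈ F₂}, S.qtyp q))),
    ∀ ψ, ψ ∈ A m₁ m₂ ↔ ∀ b₁ b₂, slice F₁ F₂ b₁ b₂ ψ ∈ T

/-- `A` depends on finitely many variables. -/
def QPred.FinitelySupported (A : QPred S) : Prop :=
  ∃ F₁ F₂ : Set S.Var, F₁.Finite ∧ F₂.Finite ∧ A.IsOver F₁ F₂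

/-- The set of all variables `v` such that `v₁` is a free variable of `A`. The free variables of
`A` are those in the smallest set that `A` is a predicate over. -/
def QPred.fv₁ (A : QPred S) : Set S.Var := {v | ∀ F₁ F₂, A.IsOver F₁ F₂ → v ∈ F₁}

/-- The set of all variables `v` such that `v₂` is a free variable of `A`. -/
def QPred.fv₂ (A : QPred S) : Set S.Var := {v | ∀ F₁ F₂, A.IsOver F₁ F₂ → v ∈ F₂}

/-! ### qRHL judgments -/

/-- cq-operators on two memories. -/
abbrev Fam2 (S : VarSystem.{u}) : Type u := S.CMem × S.CMem → Op (S.QMem × S.QMem)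

/-- Separable: a (countable) sum of products of cq-operators on the first and on the second
memory. -/
def IsSeparable (ρ : Fam2 S) : Prop :=
  ∃ σ τ : ℕ → S.CMem → Op S.QMem, (∀ i, IsCQ (σ i)) ∧ (∀ i, IsCQ (τ i)) ∧
    ∀ m₁ m₂, HasSum (fun i => tensor (σ i m₁) (τ i m₂)) (ρ (m₁, m₂))

/-- The cq-operator `ρ` satisfies the predicate `A`. -/
def Satisfies (ρ : Fam2 S) (A : QPred S) : Prop :=
  ∀ m₁ m₂, supp (ρ (m₁, m₂)) ≤ A m₁ m₂

/-- The partial trace over the second memory. -/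
def marg₁ (ρ : Fam2 S) : S.CMem → Op S.QMem := fun m₁ => ∑' m₂, ptraceSnd (ρ (m₁, m₂))

/-- The partial trace over the first memory. -/
def marg₂ (ρ : Fam2 S) : S.CMem → Op S.QMem := fun m₂ => ∑' m₁, ptraceFst (ρ (m₁, m₂))

/-- The judgment `{A} c ~ d {B}`. -/
def Judgment (A : QPred S) (c d : Prog S) (B : QPred S) : Prop :=
  ∀ ρ : Fam2 S, IsCQ ρ → IsSeparable ρ → Satisfies ρ A →
    ∃ ρ' : Fam2 S, IsCQ ρ' ∧ IsSeparable ρ' ∧ Satisfies ρ' B ∧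
      marg₁ ρ' = den c (marg₁ ρ) ∧ marg₂ ρ' = den d (marg₂ ρ)

end

end QRHL

open QRHL

namespace QRHL

noncomputable section

open scoped ENNReal

section

/-! ### Vectors in `L2 X` -/

variable {X Y Z : Type u}

/-! The proof is an induction over the context, but the judgment itself is too weak to be the
induction hypothesis. Under `local q` the saved value of `q` sits in an extra register, possibly
entangled with everything else, and on the two sides this register may or may not be in the same
state. The induction therefore runs over `XJ`: it speaks of pure inputs with an arbitrary register
`E`, together with a rectangular band `μ` on `E`, that is, a splitting of `E` into a part that is
not compared and a part that is equal on both sides.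

Pure inputs suffice. Every cq-operator is a sum of pure states (`IsCQ.exists_pure`), and programs
are additive over such sums and do not increase the trace (`denE_good`). A separable state that
satisfies a predicate is a sum of products of pure states that all satisfy it (`mem_of_supp`). So a
judgment amounts to a coupling `Cpl`: the two outputs are decomposed into pure states over a common
index set, and corresponding terms have equal norm and satisfy the postcondition (`judgment_of_xj`,
`cpl_of_judgment`). For product vectors, invariance under the swap becomes the equation `Rel`
between coordinates, and operators on the compared part preserve it (`Loc.rel`, `Loc.norm`).

Three facts about programs carry the induction. A program commutes with every operation on variables
and registers that it does not touch (`denE_theta`). Its result does not depend on the initial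
values of the classical variables that it overwrites (`denE_overwr`). It preserves a predicate over
variables that it does not write (`XJ.frame`), because the projection onto the subspace commutes
with the program. By the last fact, elementary statements need only preserve equality. A quantum
initialization even creates equality: its variables may be reset to default values beforehand
without changing the result (`denE_qinit_reset`), and equal default states can be swapped.

At a hole, the hypothesis on `s i` and `s' i` knows no register and asks for equality on all of
`Vmid`, while equality is available only on the current `Vin`. An encoding closes this gap
(`exists_encoding`, `xj_of_judgment`). A vector has countable support, so the compared part of the
register fits into the auxiliary variable, which lies in `Vmid`. The part that is not compared, and
the quantum variables in `Vmid` outside `Vin`, fit into a fresh variable outside `Vmid`; the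
variables emptied in this way take their default values, hence are equal, unless they now hold the
compared part. Classical variables in `Vmid` outside `Vin` are simply made equal, since the program
in the hole overwrites them or does not use them. Running the program and decoding gives the result
for the original state.

What remains is to distribute the side conditions over the subcontexts (`Side`, `xj_fill`). -/

theorem ket_apply (x y : X) : ket x y = if y = x then (1 : ℂ) else 0 := by
  unfold ket
  by_cases h : y = x
  · subst h; simp
  · simp [h]

theorem inner_ket_left (x : X) (ψ : L2 X) : inner ℂ (ket x) ψ = ψ x := by
  unfold ket
  rw [lp.inner_single_left]
  simp

theorem inner_ket_right (x : X) (ψ : L2 X) : inner ℂ ψ (ket x) = (starRingEnd ℂ) (ψ x) := by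
  rw [← inner_conj_symm, inner_ket_left]

theorem diag_eq (A : Op X) (x : X) : diag A x = (A (ket x) x).re := by
  rw [diag, inner_ket_left]

theorem L2.enorm_sq (ψ : L2 X) : ‖ψ‖ₑ ^ 2 = ∑' x, ‖ψ x‖ₑ ^ 2 := by
  have h1 : ∀ a : ℂ, ‖a‖ₑ ^ 2 = ENNReal.ofReal (‖a‖ ^ 2) := fun a => by
    rw [ENNReal.ofReal_pow (norm_nonneg _), ofReal_norm]
  have h2 : ‖ψ‖ₑ ^ 2 = ENNReal.ofReal (‖ψ‖ ^ 2) := by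
    rw [ENNReal.ofReal_pow (norm_nonneg _), ofReal_norm]
  simp_rw [h1]
  rw [h2, L2.norm_sq, ENNReal.ofReal_tsum_of_nonneg (fun _ => sq_nonneg _) (L2.summable_sq ψ)]

theorem L2.hasSum_ket (ψ : L2 X) : HasSum (fun x => ψ x • ket x) ψ := by
  have h := lp.hasSum_single (p := 2) (by norm_num) ψ
  refine h.congr_fun fun x => ?_
  ext y
  simp only [ket, lp.coeFn_smul, Pi.smul_apply, smul_eq_mul]
  by_cases hy : y = x
  · subst hy; simp
  · simp [hy]

theorem ext_ket {A B : L2 X →L[ℂ] L2 Y} (h : ∀ x, A (ket x) = B (ket x)) : A = B := by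
  ext1 ψ
  have hA := (L2.hasSum_ket ψ).mapL A
  have hB := (L2.hasSum_ket ψ).mapL B
  refine hA.unique (hB.congr_fun fun x => ?_)
  simp [h]

/-- Evaluation of a coordinate is continuous. -/
theorem hasSum_apply {ι : Type*} {f : ι → L2 X} {ψ : L2 X} (h : HasSum f ψ) (x : X) :
    HasSum (fun i => f i x) (ψ x) := by
  have := h.mapL (innerSL ℂ (ket x))
  simpa [inner_ket_left] using this

theorem hasSum_op_apply {ι : Type*} {f : ι → L2 X →L[ℂ] L2 Y} {A : L2 X →L[ℂ] L2 Y}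
    (h : HasSum f A) (ψ : L2 X) : HasSum (fun i => f i ψ) (A ψ) :=
  h.mapL (ContinuousLinearMap.apply ℂ (L2 Y) ψ)

theorem norm_eq_of_enorm_sq {ψ : L2 X} {φ : L2 Y} (h : ‖ψ‖ₑ ^ 2 = ‖φ‖ₑ ^ 2) : ‖ψ‖ = ‖φ‖ := by
  have h' : ‖ψ‖ₑ = ‖φ‖ₑ := (ENNReal.pow_right_strictMono two_ne_zero).injective h
  rw [← toReal_enorm, h', toReal_enorm]

theorem opNorm_le_one_of_enorm {K : L2 X →L[ℂ] L2 Y} (h : ∀ ψ, ‖K ψ‖ₑ ^ 2 ≤ ‖ψ‖ₑ ^ 2) :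
    ‖K‖ ≤ 1 := by
  refine K.opNorm_le_bound zero_le_one fun ψ => ?_
  have h' : ‖K ψ‖ₑ ≤ ‖ψ‖ₑ := (ENNReal.pow_right_strictMono two_ne_zero).le_iff_le.1 (h ψ)
  rw [one_mul, ← toReal_enorm, ← toReal_enorm]
  exact ENNReal.toReal_mono enorm_ne_top h'

theorem enorm_sq_le_of_opNorm {K : L2 X →L[ℂ] L2 Y} (h : ‖K‖ ≤ 1) (ψ : L2 X) :
    ‖K ψ‖ₑ ^ 2 ≤ ‖ψ‖ₑ ^ 2 := by
  have : ‖K ψ‖ ≤ ‖ψ‖ := (K.le_opNorm ψ).trans (mul_le_of_le_one_left (norm_nonneg _) h)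
  have h' : ‖K ψ‖ₑ ≤ ‖ψ‖ₑ := by
    rw [← ofReal_norm, ← ofReal_norm]
    exact ENNReal.ofReal_le_ofReal this
  gcongr

/-! ### Partial relabellings of the basis -/

/-- `(prel D g ψ) y = ψ (g y)` for `y ∈ D`, and `0` elsewhere (`g` is injective on `D`). -/
def prel (D : Set Y) (g : Y → X) (hg : Set.InjOn g D) : L2 X →L[ℂ] L2 Y :=
  LinearMap.mkContinuous
    { toFun := fun ψ => ⟨fun y => if y ∈ D then ψ (g y) else 0,
        L2.mem_of_summable (by
          have h := (L2.summable_sq ψ).comp_injective (Set.injOn_iff_injective.1 hg)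
          have h2 := (summable_subtype_iff_indicator (f := fun y => ‖ψ (g y)‖ ^ 2) (s := D)).1 h
          refine h2.congr fun y => ?_
          by_cases hy : y ∈ D <;> simp [hy])⟩
      map_add' := fun ψ φ => by
        ext y
        change (if y ∈ D then ψ (g y) + φ (g y) else 0) =
          (if y ∈ D then ψ (g y) else 0) + (if y ∈ D then φ (g y) else 0)
        split_ifs <;> simp
      map_smul' := fun c ψ => by ext y; by_cases hy : y ∈ D <;> simp [hy] } 1 (by
    intro ψ
    rw [one_mul]
    refine le_of_sq_le_sq ?_ (norm_nonneg _)
    rw [L2.norm_sq, L2.norm_sq]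
    have h := (L2.summable_sq ψ).comp_injective (Set.injOn_iff_injective.1 hg)
    refine le_trans (le_of_eq ?_) (tsum_comp_le_tsum_of_inj (L2.summable_sq ψ)
      (fun _ => sq_nonneg _) (Set.injOn_iff_injective.1 hg))
    refine Eq.trans ?_ (tsum_subtype D (fun y => ‖ψ (g y)‖ ^ 2)).symm
    refine tsum_congr fun y => ?_
    change ‖if y ∈ D then ψ (g y) else 0‖ ^ 2 = _
    by_cases hy : y ∈ D <;> simp [hy])

theorem prel_apply (D : Set Y) (g : Y → X) (hg : Set.InjOn g D) (ψ : L2 X) (y : Y) :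
    prel D g hg ψ y = if y ∈ D then ψ (g y) else 0 := rfl

/-- By `hinj` the relabellings for different `j` read disjoint sets of coordinates of `ψ`, so their
squared norms add up to a partial sum of `‖ψ‖²`. -/
theorem tsum_enorm_prel_le {J : Type*} (D : J → Set Y) (g : J → Y → X)
    (hg : ∀ j, Set.InjOn (g j) (D j))
    (hinj : ∀ j j' y y', y ∈ D j → y' ∈ D j' → g j y = g j' y' → j = j' ∧ y = y') (ψ : L2 X) :
    ∑' j, ‖prel (D j) (g j) (hg j) ψ‖ₑ ^ 2 ≤ ‖ψ‖ₑ ^ 2 := by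
  simp_rw [L2.enorm_sq]
  rw [← ENNReal.tsum_prod]
  let s : Set (J × Y) := {p | p.2 ∈ D p.1}
  have h1 : ∀ p : J × Y, ‖prel (D p.1) (g p.1) (hg p.1) ψ p.2‖ₑ ^ 2 =
      s.indicator (fun p => ‖ψ (g p.1 p.2)‖ₑ ^ 2) p := by
    rintro ⟨j, y⟩
    by_cases hy : y ∈ D j <;> simp [prel_apply, s, hy, Set.indicator]
  simp_rw [h1]
  rw [← tsum_subtype s]
  refine ENNReal.tsum_comp_le_tsum_of_injective (f := fun p : s => g p.1.1 p.1.2) ?_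
    (fun x => ‖ψ x‖ₑ ^ 2)
  rintro ⟨⟨j, y⟩, hy⟩ ⟨⟨j', y'⟩, hy'⟩ h
  obtain ⟨rfl, rfl⟩ := hinj j j' y y' hy hy' h
  rfl

/-- Equality holds as soon as the coordinates that are read cover the support of `ψ`. -/
theorem tsum_enorm_prel_eq {J : Type*} (D : J → Set Y) (g : J → Y → X)
    (hg : ∀ j, Set.InjOn (g j) (D j))
    (hinj : ∀ j j' y y', y ∈ D j → y' ∈ D j' → g j y = g j' y' → j = j' ∧ y = y') (ψ : L2 X)
    (hsurj : ∀ x, ψ x ≠ 0 → ∃ j, ∃ y ∈ D j, g j y = x) :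
    ∑' j, ‖prel (D j) (g j) (hg j) ψ‖ₑ ^ 2 = ‖ψ‖ₑ ^ 2 := by
  simp_rw [L2.enorm_sq]
  rw [← ENNReal.tsum_prod]
  let s : Set (J × Y) := {p | p.2 ∈ D p.1}
  have h1 : ∀ p : J × Y, ‖prel (D p.1) (g p.1) (hg p.1) ψ p.2‖ₑ ^ 2 =
      s.indicator (fun p => ‖ψ (g p.1 p.2)‖ₑ ^ 2) p := by
    rintro ⟨j, y⟩
    by_cases hy : y ∈ D j <;> simp [prel_apply, s, hy, Set.indicator]
  simp_rw [h1]
  rw [← tsum_subtype s]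
  have hi : Function.Injective (fun p : s => g p.1.1 p.1.2) := by
    rintro ⟨⟨j, y⟩, hy⟩ ⟨⟨j', y'⟩, hy'⟩ h
    obtain ⟨rfl, rfl⟩ := hinj j j' y y' hy hy' h
    rfl
  refine hi.tsum_eq (f := fun x => ‖ψ x‖ₑ ^ 2) ?_
  intro x hx
  obtain ⟨j, y, hy, rfl⟩ := hsurj x (by intro h; simp [h] at hx)
  exact ⟨⟨⟨j, y⟩, hy⟩, rfl⟩

theorem enorm_prel_le (D : Set Y) (g : Y → X) (hg : Set.InjOn g D) (ψ : L2 X) :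
    ‖prel D g hg ψ‖ₑ ^ 2 ≤ ‖ψ‖ₑ ^ 2 := by
  have := tsum_enorm_prel_le (J := Unit) (fun _ => D) (fun _ => g) (fun _ => hg)
    (fun _ _ y y' hy hy' h => ⟨rfl, hg hy hy' h⟩) ψ
  simpa using this

theorem norm_prel_le (D : Set Y) (g : Y → X) (hg : Set.InjOn g D) : ‖prel D g hg‖ ≤ 1 :=
  opNorm_le_one_of_enorm (enorm_prel_le D g hg)

theorem enorm_prel_eq (D : Set Y) (g : Y → X) (hg : Set.InjOn g D) (ψ : L2 X)
    (h : ∀ x, ψ x ≠ 0 → ∃ y ∈ D, g y = x) : ‖prel D g hg ψ‖ₑ ^ 2 = ‖ψ‖ₑ ^ 2 := by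
  have := tsum_enorm_prel_eq (J := Unit) (fun _ => D) (fun _ => g) (fun _ => hg)
    (fun _ _ y y' hy hy' h => ⟨rfl, hg hy hy' h⟩) ψ (fun x hx => ⟨(), h x hx⟩)
  simpa using this

theorem norm_prel_eq (D : Set Y) (g : Y → X) (hg : Set.InjOn g D) (ψ : L2 X)
    (h : ∀ x, ψ x ≠ 0 → ∃ y ∈ D, g y = x) : ‖prel D g hg ψ‖ = ‖ψ‖ :=
  norm_eq_of_enorm_sq (enorm_prel_eq D g hg ψ h)

theorem adjoint_pull_equiv (σ : X ≃ Y) :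
    (pull σ.toEmbedding).adjoint = pull σ.symm.toEmbedding := by
  symm
  rw [ContinuousLinearMap.eq_adjoint_iff]
  intro ψ φ
  rw [lp.inner_eq_tsum, lp.inner_eq_tsum, ← σ.tsum_eq]
  refine tsum_congr fun x => ?_
  simp

/-! ### Tensor products of vectors -/

/-- The vector `ψ ⊗ φ`. -/
def tens (ψ : L2 X) (φ : L2 Y) : L2 (X × Y) :=
  ⟨fun p => ψ p.1 * φ p.2, L2.mem_of_summable (by
    simp_rw [norm_mul, mul_pow]
    exact (L2.summable_sq ψ).mul_of_nonneg (L2.summable_sq φ) (fun _ => sq_nonneg _)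
      (fun _ => sq_nonneg _))⟩

@[simp] theorem tens_apply (ψ : L2 X) (φ : L2 Y) (p : X × Y) : tens ψ φ p = ψ p.1 * φ p.2 := rfl

theorem enorm_tens (ψ : L2 X) (φ : L2 Y) : ‖tens ψ φ‖ₑ ^ 2 = ‖ψ‖ₑ ^ 2 * ‖φ‖ₑ ^ 2 := by
  rw [L2.enorm_sq, L2.enorm_sq, L2.enorm_sq, ENNReal.tsum_prod']
  simp_rw [tens_apply, enorm_mul, mul_pow, ENNReal.tsum_mul_left, ENNReal.tsum_mul_right]

theorem norm_tens (ψ : L2 X) (φ : L2 Y) : ‖tens ψ φ‖ = ‖ψ‖ * ‖φ‖ := by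
  have h := enorm_tens ψ φ
  rw [← mul_pow] at h
  have h' := (ENNReal.pow_right_strictMono two_ne_zero).injective h
  rw [← toReal_enorm, h', ENNReal.toReal_mul, toReal_enorm, toReal_enorm]

theorem tens_smul_smul (a b : ℂ) (ψ : L2 X) (φ : L2 Y) :
    tens (a • ψ) (b • φ) = (a * b) • tens ψ φ := by
  ext p
  simp only [tens_apply, lp.coeFn_smul, Pi.smul_apply, smul_eq_mul]
  ring

theorem tens_zero_left (φ : L2 Y) : tens (0 : L2 X) φ = 0 := by ext p; simp
theorem tens_zero_right (ψ : L2 X) : tens ψ (0 : L2 Y) = 0 := by ext p; simp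

/-- `ψ ↦ ψ ⊗ φ` -/
def tensRight (φ : L2 Y) : L2 X →L[ℂ] L2 (X × Y) :=
  LinearMap.mkContinuous
    { toFun := fun ψ => tens ψ φ
      map_add' := fun ψ ψ' => by ext p; simp [add_mul]
      map_smul' := fun c ψ => by ext p; simp [mul_assoc] } ‖φ‖ (by
    intro ψ
    simp [norm_tens, mul_comm])

@[simp] theorem tensRight_apply (φ : L2 Y) (ψ : L2 X) : tensRight φ ψ = tens ψ φ := rfl

/-- `φ ↦ ψ ⊗ φ` -/
def tensLeft (ψ : L2 X) : L2 Y →L[ℂ] L2 (X × Y) :=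
  LinearMap.mkContinuous
    { toFun := fun φ => tens ψ φ
      map_add' := fun φ φ' => by ext p; simp [mul_add]
      map_smul' := fun c φ => by ext p; simp [mul_left_comm] } ‖ψ‖ (by
    intro φ
    simp [norm_tens])

@[simp] theorem tensLeft_apply (ψ : L2 X) (φ : L2 Y) : tensLeft ψ φ = tens ψ φ := rfl

theorem ket_prod (x : X) (y : Y) : ket (x, y) = tens (ket x) (ket y) := by
  ext p
  rcases p with ⟨a, b⟩
  simp only [ket_apply, tens_apply, Prod.mk.injEq]
  by_cases h1 : a = x <;> by_cases h2 : b = y <;> simp [h1, h2]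

end

section

/-! ### Traces of positive operators -/

variable {X Y Z M N P : Type u}

theorem proj_apply (ψ φ : L2 X) : proj ψ φ = inner ℂ ψ φ • ψ := by
  simp [proj]

theorem proj_isPositive (ψ : L2 X) : (proj ψ).IsPositive :=
  InnerProductSpace.isPositive_rankOne_self ψ

theorem proj_zero : proj (0 : L2 X) = 0 := by simp [proj]

theorem proj_smul (c : ℂ) (ψ : L2 X) : proj (c • ψ) = ((‖c‖ : ℂ) ^ 2) • proj ψ := by
  ext1 φ
  simp only [proj_apply, inner_smul_left, smul_apply, smul_smul]
  congr 1
  rw [← Complex.conj_mul']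
  ring

theorem diag_proj (ψ : L2 X) (x : X) : diag (proj ψ) x = ‖ψ x‖ ^ 2 := by
  rw [diag_eq, proj_apply, inner_ket_right]
  simp only [lp.coeFn_smul, Pi.smul_apply, smul_eq_mul, Complex.conj_mul']
  norm_cast

/-- The trace of a positive operator as an extended nonnegative number. -/
def etr (A : Op X) : ℝ≥0∞ := ∑' x, ENNReal.ofReal (diag A x)

theorem diag_nonneg {A : Op X} (h : A.IsPositive) (x : X) : 0 ≤ diag A x :=
  h.re_inner_nonneg_right _

/-- With the trace in `ℝ≥0∞`, sums can be exchanged without summability conditions; finiteness is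
checked once at the end. -/
theorem isPosTraceClass_iff {A : Op X} : IsPosTraceClass A ↔ A.IsPositive ∧ etr A ≠ ∞ := by
  constructor
  · rintro ⟨h, hs⟩
    refine ⟨h, ?_⟩
    rw [etr, ← ENNReal.ofReal_tsum_of_nonneg (diag_nonneg h) hs]
    exact ENNReal.ofReal_ne_top
  · rintro ⟨h, hs⟩
    refine ⟨h, ?_⟩
    have := ENNReal.summable_toReal hs
    refine this.congr fun x => ?_
    rw [ENNReal.toReal_ofReal (diag_nonneg h x)]

theorem trace_nonneg {A : Op X} (h : A.IsPositive) : 0 ≤ trace A := tsum_nonneg (diag_nonneg h)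

theorem ofReal_trace {A : Op X} (h : IsPosTraceClass A) : ENNReal.ofReal (trace A) = etr A := by
  rw [trace, etr, ENNReal.ofReal_tsum_of_nonneg (diag_nonneg h.1) h.2]

theorem etr_zero : etr (0 : Op X) = 0 := by simp [etr, diag]

theorem etr_proj (ψ : L2 X) : etr (proj ψ) = ‖ψ‖ₑ ^ 2 := by
  rw [etr, L2.enorm_sq]
  refine tsum_congr fun x => ?_
  rw [diag_proj, ENNReal.ofReal_pow (norm_nonneg _), ofReal_norm]

theorem hasSum_diag {ι : Type*} {f : ι → Op X} {A : Op X} (h : HasSum f A) (x : X) :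
    HasSum (fun i => diag (f i) x) (diag A x) := by
  have h1 := hasSum_apply (hasSum_op_apply h (ket x)) x
  simpa [diag_eq] using h1.mapL Complex.reCLM

theorem isPositive_of_hasSum {ι : Type*} {f : ι → Op X} {A : Op X} (h : HasSum f A)
    (hf : ∀ i, (f i).IsPositive) : A.IsPositive := by
  rw [ContinuousLinearMap.isPositive_iff_complex]
  intro ψ
  have h1 : HasSum (fun i => inner ℂ (f i ψ) ψ) (inner ℂ (A ψ) ψ) := by
    have h2 := (hasSum_op_apply h ψ).mapL (innerSL ℂ ψ)
    have h3 := h2.mapL (Complex.conjCLE : ℂ →L[ℝ] ℂ)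
    simpa [inner_conj_symm] using h3
  have hp := fun i => (ContinuousLinearMap.isPositive_iff_complex (f i)).1 (hf i) ψ
  have hre := h1.mapL Complex.reCLM
  have him := h1.mapL Complex.imCLM
  constructor
  · have h0 : (inner ℂ (A ψ) ψ).im = 0 := by
      refine him.unique ?_
      have : ∀ i, Complex.imCLM (inner ℂ (f i ψ) ψ) = 0 := fun i => by
        rw [← (hp i).1]; simp
      simp [this]
    apply Complex.ext <;> simp [h0]
  · exact hre.nonneg fun i => (hp i).2

theorem etr_hasSum {ι : Type*} {f : ι → Op X} {A : Op X} (h : HasSum f A)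
    (hf : ∀ i, (f i).IsPositive) : etr A = ∑' i, etr (f i) := by
  unfold etr
  rw [ENNReal.tsum_comm]
  refine tsum_congr fun x => ?_
  rw [← (hasSum_diag h x).tsum_eq,
    ENNReal.ofReal_tsum_of_nonneg (fun i => diag_nonneg (hf i) x) (hasSum_diag h x).summable]

theorem exists_sqrt_of_isPositive {E : Type*} [NormedAddCommGroup E] [InnerProductSpace ℂ E]
    [CompleteSpace E] {A : E →L[ℂ] E} (h : A.IsPositive) :
    ∃ B : E →L[ℂ] E, B.IsPositive ∧ B ∘L B = A :=
  ⟨CFC.sqrt A, (ContinuousLinearMap.nonneg_iff_isPositive _).1 (CFC.sqrt_nonneg A),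
    CFC.sqrt_mul_sqrt_self A ((ContinuousLinearMap.nonneg_iff_isPositive _).2 h)⟩

theorem exists_sqrt {A : Op X} (h : A.IsPositive) : ∃ B : Op X, B.IsPositive ∧ B ∘L B = A :=
  exists_sqrt_of_isPositive h

theorem diag_sqrt {B : Op X} (hB : B.IsPositive) (x : X) :
    diag (B ∘L B) x = ‖B (ket x)‖ ^ 2 := by
  rw [diag, ContinuousLinearMap.comp_apply, ← hB.inner_left_eq_inner_right]
  exact (norm_sq_eq_re_inner (𝕜 := ℂ) _).symm

theorem etr_sqrt {B : Op X} (hB : B.IsPositive) :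
    etr (B ∘L B) = ∑' x, ‖B (ket x)‖ₑ ^ 2 := by
  refine tsum_congr fun x => ?_
  rw [diag_sqrt hB, ENNReal.ofReal_pow (norm_nonneg _), ofReal_norm]

/-- The operator norm is at most the Hilbert–Schmidt norm: for a positive square root `B` of `A`,
the bound `‖B ψ‖² ≤ ∑ ‖B (ket x)‖² ‖ψ‖²` follows from Cauchy–Schwarz in each coordinate, and the sum
is the trace of `A`. -/
theorem enorm_le_etr {A : Op X} (h : A.IsPositive) : ‖A‖ₑ ≤ etr A := by
  by_cases hA : etr A = ∞
  · simp [hA]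
  obtain ⟨B, hB, rfl⟩ := exists_sqrt h
  have key : ∀ ψ, ‖B ψ‖ₑ ^ 2 ≤ etr (B ∘L B) * ‖ψ‖ₑ ^ 2 := by
    intro ψ
    rw [L2.enorm_sq (B ψ), etr_sqrt hB, ← ENNReal.tsum_mul_right]
    refine ENNReal.tsum_le_tsum fun x => ?_
    rw [← inner_ket_left, ← hB.inner_left_eq_inner_right, ← mul_pow]
    gcongr
    rw [← ofReal_norm, ← ofReal_norm, ← ofReal_norm, ← ENNReal.ofReal_mul (norm_nonneg _)]
    exact ENNReal.ofReal_le_ofReal (norm_inner_le_norm _ _)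
  set T := (etr (B ∘L B)).toReal with hT
  have hT' : etr (B ∘L B) = ENNReal.ofReal T := (ENNReal.ofReal_toReal hA).symm
  have hT0 : 0 ≤ T := ENNReal.toReal_nonneg
  have key' : ∀ ψ, ‖B ψ‖ ≤ √T * ‖ψ‖ := by
    intro ψ
    have := key ψ
    rw [hT', ← ofReal_norm, ← ofReal_norm, ← ENNReal.ofReal_pow (norm_nonneg _),
      ← ENNReal.ofReal_pow (norm_nonneg _), ← ENNReal.ofReal_mul hT0,
      ENNReal.ofReal_le_ofReal_iff (by positivity)] at this
    refine le_of_sq_le_sq ?_ (by positivity)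
    rw [mul_pow, Real.sq_sqrt hT0]
    exact this
  have hBn : ‖B‖ ≤ √T := B.opNorm_le_bound (Real.sqrt_nonneg _) key'
  rw [hT', ← ofReal_norm]
  refine ENNReal.ofReal_le_ofReal ?_
  calc _ ≤ ‖B‖ * ‖B‖ := B.opNorm_comp_le B
    _ ≤ √T * √T := by gcongr
    _ = T := Real.mul_self_sqrt hT0

/-- The source of norm summability for families of positive operators: a finite total trace
dominates the sum of the operator norms. -/
theorem summable_of_etr {ι : Type*} {f : ι → Op X} (hf : ∀ i, (f i).IsPositive)
    (h : ∑' i, etr (f i) ≠ ∞) : Summable f := by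
  have h1 : ∑' i, ‖f i‖ₑ ≠ ∞ :=
    ne_top_of_le_ne_top h (ENNReal.tsum_le_tsum fun i => enorm_le_etr (hf i))
  refine Summable.of_norm ?_
  have := ENNReal.summable_toReal h1
  simpa using this

/-- A positive trace-class operator is a sum of rank one operators. -/
theorem exists_hasSum_proj {A : Op X} (h : A.IsPositive) (hA : etr A ≠ ∞) :
    ∃ ψ : X → L2 X, HasSum (fun x => proj (ψ x)) A := by
  obtain ⟨B, hB, rfl⟩ := exists_sqrt h
  -- Inserting `1 = ∑ |x⟩⟨x|` between the two factors of `B ∘L B` shows the decomposition.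
  refine ⟨fun x => B (ket x), ?_⟩
  have hs : Summable fun x => proj (B (ket x)) := by
    refine summable_of_etr (fun x => proj_isPositive _) ?_
    simp_rw [etr_proj]
    rwa [← etr_sqrt hB]
  have hsum := hs.hasSum
  suffices ∑' x, proj (B (ket x)) = B ∘L B by rwa [this] at hsum
  ext1 ψ
  refine (hasSum_op_apply hsum ψ).unique ?_
  have := (L2.hasSum_ket (B ψ)).mapL B
  refine this.congr_fun fun x => ?_
  rw [proj_apply, map_smul, hB.inner_left_eq_inner_right, inner_ket_left]

/-! ### Conjugation -/

/-- `A ↦ K A K†` -/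
def conj (K : L2 X →L[ℂ] L2 Y) (A : Op X) : Op Y := K ∘L A ∘L K.adjoint

theorem conj_proj (K : L2 X →L[ℂ] L2 Y) (ψ : L2 X) : conj K (proj ψ) = proj (K ψ) := by
  ext1 φ
  simp [conj, proj_apply, ContinuousLinearMap.adjoint_inner_right]

theorem conj_isPositive (K : L2 X →L[ℂ] L2 Y) {A : Op X} (h : A.IsPositive) :
    (conj K A).IsPositive := h.conj_adjoint K

theorem conj_zero (K : L2 X →L[ℂ] L2 Y) : conj K (0 : Op X) = 0 := by simp [conj]

theorem conj_zero_left (A : Op X) : conj (0 : L2 X →L[ℂ] L2 Y) A = 0 := by simp [conj]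

theorem conj_id (A : Op X) : conj (ContinuousLinearMap.id ℂ (L2 X)) A = A := by
  have : (ContinuousLinearMap.id ℂ (L2 X)).adjoint = ContinuousLinearMap.id ℂ (L2 X) :=
    ((ContinuousLinearMap.eq_adjoint_iff _ _).2 fun _ _ => rfl).symm
  rw [conj, this]
  rfl

theorem conj_conj (K : L2 Y →L[ℂ] L2 Z) (L : L2 X →L[ℂ] L2 Y) (A : Op X) :
    conj K (conj L A) = conj (K ∘L L) A := by
  simp only [conj, ContinuousLinearMap.adjoint_comp]
  rfl

theorem conj_hasSum (K : L2 X →L[ℂ] L2 Y) {ι : Type*} {f : ι → Op X} {A : Op X}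
    (h : HasSum f A) : HasSum (fun i => conj K (f i)) (conj K A) := by
  have h1 := h.mapL ((ContinuousLinearMap.compL ℂ (L2 Y) (L2 X) (L2 X)).flip K.adjoint)
  exact h1.mapL (ContinuousLinearMap.compL ℂ (L2 Y) (L2 X) (L2 Y) K)

/-- On a rank one operator the claim is `hK` itself; the general case follows by decomposing `A`
into such operators and exchanging the two sums. -/
theorem tsum_etr_conj_le {J : Type*} (K : J → L2 X →L[ℂ] L2 Y)
    (hK : ∀ ψ, ∑' j, ‖K j ψ‖ₑ ^ 2 ≤ ‖ψ‖ₑ ^ 2) {A : Op X} (h : A.IsPositive) :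
    ∑' j, etr (conj (K j) A) ≤ etr A := by
  by_cases hA : etr A = ∞
  · simp [hA]
  obtain ⟨ψ, hψ⟩ := exists_hasSum_proj h hA
  rw [etr_hasSum hψ fun _ => proj_isPositive _]
  have h1 : ∀ j, etr (conj (K j) A) = ∑' x, ‖K j (ψ x)‖ₑ ^ 2 := fun j => by
    rw [etr_hasSum (conj_hasSum (K j) hψ) fun _ => conj_isPositive _ (proj_isPositive _)]
    simp_rw [conj_proj, etr_proj]
  simp_rw [h1]
  rw [ENNReal.tsum_comm]
  simp_rw [etr_proj]
  exact ENNReal.tsum_le_tsum fun x => hK _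

theorem reindex_eq_conj (σ : X ≃ Y) (A : Op X) :
    reindex σ A = conj (pull σ.symm.toEmbedding) A := by
  rw [reindex, conj, adjoint_pull_equiv]
  rfl

/-! ### cq-operators -/

/-- The total trace. -/
def etrF (ρ : M → Op X) : ℝ≥0∞ := ∑' m, etr (ρ m)

theorem isCQ_iff {ρ : M → Op X} : IsCQ ρ ↔ (∀ m, (ρ m).IsPositive) ∧ etrF ρ ≠ ∞ := by
  constructor
  · rintro ⟨h, hs⟩
    refine ⟨fun m => (h m).1, ?_⟩
    have h2 : ∀ m, etr (ρ m) = ENNReal.ofReal (trace (ρ m)) := fun m => (ofReal_trace (h m)).symm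
    simp_rw [etrF, h2]
    rw [← ENNReal.ofReal_tsum_of_nonneg (fun m => trace_nonneg (h m).1) hs]
    exact ENNReal.ofReal_ne_top
  · rintro ⟨h, hs⟩
    have h1 : ∀ m, IsPosTraceClass (ρ m) := fun m =>
      isPosTraceClass_iff.2 ⟨h m, ENNReal.ne_top_of_tsum_ne_top hs m⟩
    refine ⟨h1, ?_⟩
    refine (ENNReal.summable_toReal hs).congr fun m => ?_
    rw [← ofReal_trace (h1 m), ENNReal.toReal_ofReal (trace_nonneg (h m))]

theorem IsCQ.pos {ρ : M → Op X} (h : IsCQ ρ) (m : M) : (ρ m).IsPositive := (h.1 m).1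

theorem IsCQ.ne_top {ρ : M → Op X} (h : IsCQ ρ) : etrF ρ ≠ ∞ := (isCQ_iff.1 h).2

/-- The cq-operator `|m⟩⟨m| ⊗ A`. -/
def single (m : M) (A : Op X) : M → Op X := fun m' => if m = m' then A else 0

theorem single_zero (m : M) : single m (0 : Op X) = 0 := by
  funext m'; simp [single]

theorem etrF_single (m : M) (A : Op X) : etrF (single m A) = etr A := by
  rw [etrF, tsum_eq_single m]
  · simp [single]
  · intro m' h
    simp [single, Ne.symm h, etr_zero]

theorem etrF_zero : etrF (0 : M → Op X) = 0 := by simp [etrF, etr_zero]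

theorem isCQ_single (m : M) {A : Op X} (h : A.IsPositive) (hA : etr A ≠ ∞) :
    IsCQ (single m A) := by
  refine isCQ_iff.2 ⟨fun m' => ?_, by rwa [etrF_single]⟩
  unfold single
  split_ifs
  exacts [h, ContinuousLinearMap.isPositive_zero]

theorem isCQ_zero : IsCQ (0 : M → Op X) :=
  isCQ_iff.2 ⟨fun _ => ContinuousLinearMap.isPositive_zero, by simp [etrF_zero]⟩

/-- The pure cq-state `|m⟩⟨m| ⊗ |ψ⟩⟨ψ|`. -/
def pure (m : M) (ψ : L2 X) : M → Op X := single m (proj ψ)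

theorem isCQ_pure (m : M) (ψ : L2 X) : IsCQ (pure m ψ) :=
  isCQ_single m (proj_isPositive ψ) (by rw [etr_proj]; exact ENNReal.pow_ne_top enorm_ne_top)

theorem etrF_pure (m : M) (ψ : L2 X) : etrF (pure m ψ) = ‖ψ‖ₑ ^ 2 := by
  rw [pure, etrF_single, etr_proj]

theorem pure_zero (m : M) : pure m (0 : L2 X) = 0 := by
  rw [pure, proj_zero, single_zero]

/-- `ρ` is the sum of the cq-operators `f i`, with finite total trace. -/
structure CQSum {ι : Type*} (f : ι → M → Op X) (ρ : M → Op X) : Prop where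
  cq : ∀ i, IsCQ (f i)
  fin : ∑' i, etrF (f i) ≠ ∞
  sum : ∀ m, HasSum (fun i => f i m) (ρ m)

/-! ### Summation and regrouping of cq-operators -/

namespace CQSum

variable {ι κ : Type*} {f : ι → M → Op X} {ρ σ : M → Op X}

theorem etrF_eq (h : CQSum f ρ) : etrF ρ = ∑' i, etrF (f i) := by
  unfold etrF
  rw [ENNReal.tsum_comm]
  exact tsum_congr fun m => etr_hasSum (h.sum m) fun i => (h.cq i).pos m

theorem isCQ (h : CQSum f ρ) : IsCQ ρ :=
  isCQ_iff.2 ⟨fun m => isPositive_of_hasSum (h.sum m) fun i => (h.cq i).pos m,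
    by rw [h.etrF_eq]; exact h.fin⟩

theorem unique (h : CQSum f ρ) (h' : CQSum f σ) : ρ = σ :=
  funext fun m => (h.sum m).unique (h'.sum m)

theorem mk' (cq : ∀ i, IsCQ (f i)) (fin : ∑' i, etrF (f i) ≠ ∞) :
    CQSum f fun m => ∑' i, f i m :=
  ⟨cq, fin, fun m => (summable_of_etr (fun i => (cq i).pos m)
    (ne_top_of_le_ne_top fin
      (ENNReal.tsum_le_tsum fun _ => ENNReal.le_tsum (f := fun _ => etr _) m))).hasSum⟩

theorem sigma {κ : ι → Type*} {g : (i : ι) → κ i → M → Op X} (h : CQSum f ρ)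
    (hg : ∀ i, CQSum (g i) (f i)) : CQSum (fun p : Σ i, κ i => g p.1 p.2) ρ := by
  have fin : ∑' p : Σ i, κ i, etrF (g p.1 p.2) ≠ ∞ := by
    rw [ENNReal.tsum_sigma' (fun p : Σ i, κ i => etrF (g p.1 p.2))]
    have : ∀ i, ∑' k, etrF (g i k) = etrF (f i) := fun i => (hg i).etrF_eq.symm
    simp_rw [this]
    exact h.fin
  have h' := mk' (f := fun p : Σ i, κ i => g p.1 p.2) (fun p => (hg p.1).cq p.2) fin
  refine ⟨h'.cq, fin, fun m => ?_⟩
  exact HasSum.sigma_of_hasSum (h.sum m) (fun i => (hg i).sum m) (h'.sum m).summable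

theorem of_sigma {κ : ι → Type*} {g : (i : ι) → κ i → M → Op X}
    (h : CQSum (fun p : Σ i, κ i => g p.1 p.2) ρ) (hg : ∀ i, CQSum (g i) (f i)) : CQSum f ρ := by
  have fin : ∑' i, etrF (f i) ≠ ∞ := by
    simp_rw [fun i => (hg i).etrF_eq]
    have := h.fin
    rwa [ENNReal.tsum_sigma' (fun p : Σ i, κ i => etrF (g p.1 p.2))] at this
  exact ⟨fun i => (hg i).isCQ, fin, fun m => (h.sum m).sigma fun i => (hg i).sum m⟩

theorem prod {g : ι → κ → M → Op X} (h : CQSum f ρ)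
    (hg : ∀ i, CQSum (g i) (f i)) : CQSum (fun p : ι × κ => g p.1 p.2) ρ := by
  have h1 := h.sigma hg
  exact ⟨fun p => h1.cq ⟨p.1, p.2⟩,
    by rw [← (Equiv.sigmaEquivProd ι κ).tsum_eq]; exact h1.fin,
    fun m => by rw [← (Equiv.sigmaEquivProd ι κ).hasSum_iff]; exact h1.sum m⟩

theorem comp_equiv (h : CQSum f ρ) (e : κ ≃ ι) : CQSum (fun k => f (e k)) ρ :=
  ⟨fun k => h.cq (e k), by rw [e.tsum_eq (fun i => etrF (f i))]; exact h.fin,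
    fun m => (e.hasSum_iff (f := fun i => f i m)).2 (h.sum m)⟩

theorem of_prod {g : ι → κ → M → Op X} (h : CQSum (fun p : ι × κ => g p.1 p.2) ρ)
    (hg : ∀ i, CQSum (g i) (f i)) : CQSum f ρ :=
  of_sigma (g := g) (h.comp_equiv (Equiv.sigmaEquivProd ι κ)) hg

/-- Terms outside the range of an injection that vanish can be dropped. -/
theorem comp_injective (h : CQSum f ρ) {e : κ → ι} (he : Function.Injective e)
    (h0 : ∀ i, i ∉ Set.range e → f i = 0) : CQSum (fun k => f (e k)) ρ :=
  ⟨fun k => h.cq (e k),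
    ne_top_of_le_ne_top h.fin
      (ENNReal.tsum_comp_le_tsum_of_injective he (fun i => etrF (f i))),
    fun m => (he.hasSum_iff (f := fun i => f i m)
      (fun i hi => by simp [h0 i hi])).2 (h.sum m)⟩

theorem of_comp_injective {e : κ → ι} (h : CQSum (fun k => f (e k)) ρ)
    (he : Function.Injective e) (h0 : ∀ i, i ∉ Set.range e → f i = 0) : CQSum f ρ :=
  ⟨fun i => by
      by_cases hi : i ∈ Set.range e
      · obtain ⟨k, rfl⟩ := hi; exact h.cq k
      · rw [h0 i hi]; exact isCQ_zero,
    by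
      have := h.fin
      rwa [he.tsum_eq (f := fun i => etrF (f i))] at this
      intro i hi
      by_contra h'
      exact hi (by simp [h0 i h', etrF_zero]),
    fun m => (he.hasSum_iff (f := fun i => f i m)
      (fun i hi => by simp [h0 i hi])).1 (h.sum m)⟩

theorem congr {f' : ι → M → Op X} (h : CQSum f ρ) (e : ∀ i, f i = f' i) : CQSum f' ρ := by
  rwa [← funext e]

theorem const {ι : Type*} [Unique ι] (h : IsCQ ρ) : CQSum (fun _ : ι => ρ) ρ :=
  ⟨fun _ => h, by rw [tsum_eq_single default (by simp [Unique.eq_default])]; exact h.ne_top,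
    fun m => hasSum_unique (β := ι) fun _ => ρ m⟩

theorem empty {ι : Type*} [IsEmpty ι] (f : ι → M → Op X) : CQSum f 0 :=
  ⟨fun i => isEmptyElim i, by simp, fun _ => hasSum_empty⟩

end CQSum

theorem cqSum_single {ι : Type*} (m : M) {f : ι → Op X} {A : Op X} (hf : ∀ i, (f i).IsPositive)
    (hA : etr A ≠ ∞) (h : HasSum f A) : CQSum (fun i => single m (f i)) (single m A) := by
  have h1 := etr_hasSum h hf
  refine ⟨fun i => isCQ_single m (hf i) ?_, ?_, fun m' => ?_⟩
  · exact ENNReal.ne_top_of_tsum_ne_top (h1 ▸ hA) i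
  · simp_rw [etrF_single]
    rwa [← h1]
  · by_cases hm : m = m'
    · simpa [single, hm] using h
    · simp only [single, hm, if_false]
      exact hasSum_zero

theorem IsCQ.cqSum_single {ρ : M → Op X} (h : IsCQ ρ) : CQSum (fun m => single m (ρ m)) ρ := by
  refine ⟨fun m => isCQ_single m (h.pos m) (ENNReal.ne_top_of_tsum_ne_top h.ne_top m), ?_,
    fun m => ?_⟩
  · simp_rw [etrF_single]
    exact h.ne_top
  · have := hasSum_single (f := fun m' => single m' (ρ m') m) m (fun m' hm => by simp [single, hm])
    simpa [single] using this

/-- Every cq-operator is a sum of pure states. -/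
theorem IsCQ.exists_pure {ρ : M → Op X} (h : IsCQ ρ) :
    ∃ ψ : M → X → L2 X, CQSum (fun p : M × X => pure p.1 (ψ p.1 p.2)) ρ := by
  have ht := fun m => ENNReal.ne_top_of_tsum_ne_top h.ne_top m
  choose ψ hψ using fun m => exists_hasSum_proj (h.pos m) (ht m)
  exact ⟨ψ, h.cqSum_single.prod fun m =>
    QRHL.cqSum_single m (fun _ => proj_isPositive _) (ht m) (hψ m)⟩

end

section

/-! ### Maps on cq-operators -/

variable {X Y Z M N P : Type u}

/-- Countably additive maps on cq-operators that do not increase the trace. -/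
structure Good (Φ : (M → Op X) → N → Op Y) : Prop where
  tr : ∀ ρ, IsCQ ρ → etrF (Φ ρ) ≤ etrF ρ
  sum : ∀ {ι : Type u} {f : ι → M → Op X} {ρ : M → Op X}, CQSum f ρ →
    CQSum (fun i => Φ (f i)) (Φ ρ)

/-! ### Additive maps that do not increase the trace -/

namespace Good

variable {Φ Ψ : (M → Op X) → N → Op Y}

theorem cq (h : Good Φ) {ρ : M → Op X} (hρ : IsCQ ρ) : IsCQ (Φ ρ) :=
  (h.sum (CQSum.const (ι := PUnit) hρ)).isCQ

theorem map_zero (h : Good Φ) : Φ 0 = 0 :=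
  (h.sum (CQSum.empty (ι := PEmpty) PEmpty.elim)).unique (CQSum.empty _)

/-- Both maps are additive, and every cq-operator is a sum of pure states. This reduces identities
between program semantics to pure inputs. -/
theorem ext (hΦ : Good Φ) (hΨ : Good Ψ) (h : ∀ m ψ, Φ (pure m ψ) = Ψ (pure m ψ))
    {ρ : M → Op X} (hρ : IsCQ ρ) : Φ ρ = Ψ ρ := by
  obtain ⟨ψ, hψ⟩ := hρ.exists_pure
  exact (hΦ.sum hψ).unique ((hΨ.sum hψ).congr fun p => (h _ _).symm)

theorem congr (h : Good Φ) (e : ∀ ρ, IsCQ ρ → Φ ρ = Ψ ρ) : Good Ψ where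
  tr ρ hρ := by rw [← e ρ hρ]; exact h.tr ρ hρ
  sum hf := by
    rw [← e _ hf.isCQ]
    exact (h.sum hf).congr fun i => e _ (hf.cq i)

theorem comp {Ξ : (N → Op Y) → P → Op Z} (hΞ : Good Ξ) (hΦ : Good Φ) :
    Good fun ρ => Ξ (Φ ρ) where
  tr ρ hρ := (hΞ.tr _ (hΦ.cq hρ)).trans (hΦ.tr ρ hρ)
  sum hf := hΞ.sum (hΦ.sum hf)

theorem id : Good fun ρ : M → Op X => ρ where
  tr _ _ := le_rfl
  sum hf := hf

theorem cqSum_tsum {ι : Type*} {Φ : ι → (M → Op X) → N → Op Y} (h : ∀ i, Good (Φ i))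
    (hle : ∀ ρ, IsCQ ρ → ∑' i, etrF (Φ i ρ) ≤ etrF ρ) {ρ : M → Op X} (hρ : IsCQ ρ) :
    CQSum (fun i => Φ i ρ) fun n => ∑' i, Φ i ρ n :=
  CQSum.mk' (fun i => (h i).cq hρ) (ne_top_of_le_ne_top hρ.ne_top (hle ρ hρ))

/-- By `hle` the double sum over `i` and over the terms of `ρ` has finite total trace, so it may be
regrouped in either order. -/
theorem tsum {ι : Type*} {Φ : ι → (M → Op X) → N → Op Y} (h : ∀ i, Good (Φ i))
    (hle : ∀ ρ, IsCQ ρ → ∑' i, etrF (Φ i ρ) ≤ etrF ρ) :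
    Good fun ρ n => ∑' i, Φ i ρ n where
  tr ρ hρ := by
    rw [(cqSum_tsum h hle hρ).etrF_eq]
    exact hle ρ hρ
  sum {κ f ρ} hf := by
    have h1 := (cqSum_tsum h hle hf.isCQ).prod fun i => (h i).sum hf
    exact CQSum.of_prod (g := fun k i => Φ i (f k)) (h1.comp_equiv (Equiv.prodComm _ _))
      fun k => cqSum_tsum h hle (hf.cq k)

end Good

/-- The map `|m⟩⟨m| ⊗ A ↦ ∑_j |t j m⟩⟨t j m| ⊗ K j m A (K j m)†`. -/
def kraus {J : Type u} (t : J → M → N) (K : J → M → L2 X →L[ℂ] L2 Y) (ρ : M → Op X) : N → Op Y :=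
  fun n => ∑' p : M × J, single (t p.2 p.1) (conj (K p.2 p.1) (ρ p.1)) n

/-! ### Kraus maps that also move the classical memory -/

section Kraus

variable {J : Type u} {t : J → M → N} {K : J → M → L2 X →L[ℂ] L2 Y}

theorem good_single (m : M) (n : N) {L : L2 X →L[ℂ] L2 Y} (hL : ∀ ψ, ‖L ψ‖ₑ ^ 2 ≤ ‖ψ‖ₑ ^ 2) :
    Good fun ρ : M → Op X => single n (conj L (ρ m)) := by
  have key : ∀ A : Op X, A.IsPositive → etr (conj L A) ≤ etr A := fun A hA => by
    have := tsum_etr_conj_le (fun _ : Unit => L) (fun ψ => by simpa using hL ψ) hA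
    simpa using this
  have tr : ∀ ρ : M → Op X, IsCQ ρ → etrF (single n (conj L (ρ m))) ≤ etrF ρ := fun ρ hρ => by
    rw [etrF_single]
    exact (key _ (hρ.pos m)).trans (ENNReal.le_tsum (f := fun m => etr (ρ m)) m)
  refine ⟨tr, fun {ι f ρ} hf => cqSum_single n (fun i => conj_isPositive _ ((hf.cq i).pos m)) ?_
    (conj_hasSum L (hf.sum m))⟩
  have := tr ρ hf.isCQ
  rw [etrF_single] at this
  exact ne_top_of_le_ne_top hf.isCQ.ne_top this

theorem kraus_le (hK : ∀ m ψ, ∑' j, ‖K j m ψ‖ₑ ^ 2 ≤ ‖ψ‖ₑ ^ 2) (ρ : M → Op X) (hρ : IsCQ ρ) :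
    ∑' p : M × J, etrF (single (t p.2 p.1) (conj (K p.2 p.1) (ρ p.1))) ≤ etrF ρ := by
  simp_rw [etrF_single]
  refine (ENNReal.tsum_prod (f := fun m j => etr (conj (K j m) (ρ m)))).trans_le ?_
  refine ENNReal.tsum_le_tsum fun m => ?_
  exact tsum_etr_conj_le (fun j => K j m) (hK m) (hρ.pos m)

theorem kraus_term (hK : ∀ m ψ, ∑' j, ‖K j m ψ‖ₑ ^ 2 ≤ ‖ψ‖ₑ ^ 2) (p : M × J) :
    Good fun ρ : M → Op X => single (t p.2 p.1) (conj (K p.2 p.1) (ρ p.1)) :=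
  good_single _ _ fun ψ =>
    (ENNReal.le_tsum (f := fun j => ‖K j p.1 ψ‖ₑ ^ 2) p.2).trans (hK p.1 ψ)

theorem kraus_good (hK : ∀ m ψ, ∑' j, ‖K j m ψ‖ₑ ^ 2 ≤ ‖ψ‖ₑ ^ 2) : Good (kraus t K) :=
  Good.tsum (kraus_term hK) (kraus_le hK)

theorem kraus_cqSum (hK : ∀ m ψ, ∑' j, ‖K j m ψ‖ₑ ^ 2 ≤ ‖ψ‖ₑ ^ 2) {ρ : M → Op X} (hρ : IsCQ ρ) :
    CQSum (fun p : M × J => single (t p.2 p.1) (conj (K p.2 p.1) (ρ p.1))) (kraus t K ρ) :=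
  Good.cqSum_tsum (kraus_term hK) (kraus_le hK) hρ

/-- Only the terms at the classical memory `m` survive, so the image of a pure state is an explicit
sum of pure states over `J`. Couplings are built by matching these sums. -/
theorem kraus_pure (hK : ∀ m ψ, ∑' j, ‖K j m ψ‖ₑ ^ 2 ≤ ‖ψ‖ₑ ^ 2) (m : M) (ψ : L2 X) :
    CQSum (fun j => pure (t j m) (K j m ψ)) (kraus t K (pure m ψ)) := by
  have h := (kraus_cqSum (t := t) hK (isCQ_pure m ψ)).comp_injective
    (e := fun j : J => (m, j)) (fun _ _ h => (Prod.mk.inj h).2) (by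
      rintro ⟨m', j⟩ hp
      have : m ≠ m' := by
        rintro rfl
        exact hp ⟨j, rfl⟩
      have h0 : pure m ψ m' = 0 := if_neg this
      rw [h0, conj_zero, single_zero])
  refine h.congr fun j => ?_
  simp [pure, single, conj_proj]

end Kraus

/-- A kraus map with a single operator. -/
def kraus₁ (t : M → N) (K : M → L2 X →L[ℂ] L2 Y) : (M → Op X) → N → Op Y :=
  kraus (J := PUnit) (fun _ => t) (fun _ => K)

section

variable {t : M → N} {K : M → L2 X →L[ℂ] L2 Y}

theorem kraus₁_good (hK : ∀ m ψ, ‖K m ψ‖ₑ ^ 2 ≤ ‖ψ‖ₑ ^ 2) : Good (kraus₁ t K) :=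
  kraus_good fun m ψ => by simpa using hK m ψ

theorem kraus₁_pure (hK : ∀ m ψ, ‖K m ψ‖ₑ ^ 2 ≤ ‖ψ‖ₑ ^ 2) (m : M) (ψ : L2 X) :
    kraus₁ t K (pure m ψ) = pure (t m) (K m ψ) :=
  (kraus_pure (J := PUnit) (t := fun _ => t) (K := fun _ => K) (fun m ψ => by simpa using hK m ψ)
    m ψ).unique (CQSum.const (isCQ_pure _ _))

theorem kraus₁_apply (ρ : M → Op X) (n : N) :
    kraus₁ t K ρ n = ∑' m, single (t m) (conj (K m) (ρ m)) n :=
  (Equiv.prodPUnit M).symm.tsum_eq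
    (fun p : M × PUnit => single (t p.1) (conj (K p.1) (ρ p.1)) n) |>.symm

/-- A kraus map that does not change the classical memory acts pointwise. -/
theorem kraus₁_id_apply (K : M → L2 X →L[ℂ] L2 Y) (ρ : M → Op X) (n : M) :
    kraus₁ (fun m => m) K ρ n = conj (K n) (ρ n) := by
  rw [kraus₁_apply, tsum_eq_single n (fun m hm => by simp [single, hm])]
  simp [single]

end

theorem kraus_id_apply {J : Type u} (K : J → M → L2 X →L[ℂ] L2 Y) (ρ : M → Op X) (n : M) :
    kraus (fun _ m => m) K ρ n = ∑' j, conj (K j n) (ρ n) := by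
  let e : J → M × J := fun j => (n, j)
  have he : Function.Injective e := fun _ _ h => (Prod.mk.inj h).2
  rw [kraus, ← he.tsum_eq]
  · simp [e, single]
  · rintro ⟨m, j⟩ hp
    by_cases hm : m = n
    · subst hm; exact ⟨j, rfl⟩
    · simp [single, hm] at hp

theorem id_le (ψ : L2 X) : ‖ContinuousLinearMap.id ℂ (L2 X) ψ‖ₑ ^ 2 ≤ ‖ψ‖ₑ ^ 2 := le_rfl

end

section

/-! ### Amplification and tensor products of operators -/

variable {X X' Y Z M N P : Type u}

theorem sliceFst_apply (y : Y) (ψ : L2 (X × Y)) (x : X) : sliceFst y ψ x = ψ (x, y) := rfl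

theorem sliceSnd_apply (x : X) (ψ : L2 (X × Y)) (y : Y) : sliceSnd x ψ y = ψ (x, y) := rfl

theorem tsum_enorm_sliceFst (ψ : L2 (X × Y)) : ∑' y, ‖sliceFst y ψ‖ₑ ^ 2 = ‖ψ‖ₑ ^ 2 := by
  simp_rw [L2.enorm_sq, ENNReal.tsum_prod', sliceFst_apply]
  exact ENNReal.tsum_comm

theorem tsum_enorm_sliceSnd (ψ : L2 (X × Y)) : ∑' x, ‖sliceSnd x ψ‖ₑ ^ 2 = ‖ψ‖ₑ ^ 2 := by
  simp_rw [L2.enorm_sq, ENNReal.tsum_prod', sliceSnd_apply]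

theorem summable_sq_of_enorm {f : X → ℂ} (h : ∑' x, ‖f x‖ₑ ^ 2 ≠ ∞) :
    Summable fun x => ‖f x‖ ^ 2 := by
  have := ENNReal.summable_toReal h
  simpa using this

theorem tsum_enorm_slices (G : L2 X →L[ℂ] L2 X') (ψ : L2 (X × Y)) :
    ∑' p : X' × Y, ‖G (sliceFst p.2 ψ) p.1‖ₑ ^ 2 = ∑' y, ‖G (sliceFst y ψ)‖ₑ ^ 2 := by
  simp_rw [L2.enorm_sq]
  rw [ENNReal.tsum_prod', ENNReal.tsum_comm]

theorem tsum_enorm_slices_le (G : L2 X →L[ℂ] L2 X') (ψ : L2 (X × Y)) :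
    ∑' p : X' × Y, ‖G (sliceFst p.2 ψ) p.1‖ₑ ^ 2 ≤ ‖G‖ₑ ^ 2 * ‖ψ‖ₑ ^ 2 := by
  rw [tsum_enorm_slices, ← tsum_enorm_sliceFst, ← ENNReal.tsum_mul_left]
  refine ENNReal.tsum_le_tsum fun y => ?_
  rw [← mul_pow]
  gcongr
  exact G.le_opENorm _

/-- `G ⊗ 1` for an operator `G` between different spaces. -/
def amplH (Y : Type u) (G : L2 X →L[ℂ] L2 X') : L2 (X × Y) →L[ℂ] L2 (X' × Y) :=
  LinearMap.mkContinuous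
    { toFun := fun ψ => ⟨fun p => G (sliceFst p.2 ψ) p.1,
        L2.mem_of_summable (summable_sq_of_enorm (ne_top_of_le_ne_top
          (ENNReal.mul_ne_top (by simp) (by simp)) (tsum_enorm_slices_le G ψ)))⟩
      map_add' := fun ψ φ => by ext p; simp; rfl
      map_smul' := fun c ψ => by ext p; simp } ‖G‖ (by
    intro ψ
    have h : ∀ χ : L2 (X' × Y), (∀ p, χ p = G (sliceFst p.2 ψ) p.1) → ‖χ‖ ≤ ‖G‖ * ‖ψ‖ := by
      intro χ hχ
      have h1 := tsum_enorm_slices_le G ψ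
      simp_rw [← hχ] at h1
      rw [← L2.enorm_sq, ← mul_pow] at h1
      have h2 := (ENNReal.pow_right_strictMono two_ne_zero).le_iff_le.1 h1
      rw [← ofReal_norm, ← ofReal_norm, ← ofReal_norm, ← ENNReal.ofReal_mul (norm_nonneg _),
        ENNReal.ofReal_le_ofReal_iff (by positivity)] at h2
      exact h2
    exact h _ fun _ => rfl)

theorem enorm_amplH (G : L2 X →L[ℂ] L2 X') (ψ : L2 (X × Y)) :
    ‖amplH Y G ψ‖ₑ ^ 2 = ∑' y, ‖G (sliceFst y ψ)‖ₑ ^ 2 := by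
  rw [L2.enorm_sq, ← tsum_enorm_slices]
  rfl

theorem norm_amplH_le (G : L2 X →L[ℂ] L2 X') (hG : ‖G‖ ≤ 1) : ‖amplH Y G‖ ≤ 1 :=
  opNorm_le_one_of_enorm fun ψ => by
    rw [enorm_amplH, ← tsum_enorm_sliceFst]
    exact ENNReal.tsum_le_tsum fun y => enorm_sq_le_of_opNorm hG _

theorem enorm_ampl (A : Op X) (ψ : L2 (X × Y)) :
    ‖ampl Y A ψ‖ₑ ^ 2 = ∑' y, ‖A (sliceFst y ψ)‖ₑ ^ 2 := enorm_amplH A ψ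

theorem ampl_tens (A : Op X) (ψ : L2 X) (φ : L2 Y) : ampl Y A (tens ψ φ) = tens (A ψ) φ := by
  ext p
  have : sliceFst p.2 (tens ψ φ) = φ p.2 • ψ := by
    ext x
    simp [sliceFst_apply, mul_comm]
  rw [ampl_apply, this, map_smul]
  simp [mul_comm]

theorem tensor_tens (A : Op X) (B : Op Y) (ψ : L2 X) (φ : L2 Y) :
    tensor A B (tens ψ φ) = tens (A ψ) (B φ) := by
  have h : reindex (Equiv.prodComm Y X) (ampl X B) (tens ψ φ) = tens ψ (B φ) := by
    have h1 : pull (Equiv.prodComm Y X).toEmbedding (tens ψ φ) = tens φ ψ := by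
      ext p; simp [mul_comm]
    rw [reindex, ContinuousLinearMap.comp_apply, ContinuousLinearMap.comp_apply, h1, ampl_tens]
    ext p; simp [mul_comm]
  rw [tensor, ContinuousLinearMap.comp_apply, h, ampl_tens]

theorem L2.hasSum_inner (ψ φ : L2 X) :
    HasSum (fun x => (starRingEnd ℂ) (ψ x) * φ x) (inner ℂ ψ φ) := by
  have h := (L2.hasSum_ket φ).mapL (innerSL ℂ ψ)
  refine h.congr_fun fun x => ?_
  rw [innerSL_apply_apply, inner_smul_right, inner_ket_right, mul_comm]

theorem hasSum_mul_prod {ι κ : Type*} {f : ι → ℂ} {g : κ → ℂ} {a b : ℂ}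
    (h1 : HasSum f a) (h2 : HasSum g b) : HasSum (fun p : ι × κ => f p.1 * g p.2) (a * b) :=
  h1.mul h2 (summable_mul_of_summable_norm h1.summable.norm h2.summable.norm)

theorem inner_tens (ψ ψ' : L2 X) (φ φ' : L2 Y) :
    inner ℂ (tens ψ φ) (tens ψ' φ') = inner ℂ ψ ψ' * inner ℂ φ φ' := by
  have h3 := hasSum_mul_prod (L2.hasSum_inner ψ ψ') (L2.hasSum_inner φ φ')
  rw [← h3.tsum_eq, ← (L2.hasSum_inner _ _).tsum_eq]
  refine tsum_congr fun p => ?_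
  rw [tens_apply, tens_apply, map_mul]
  ring

theorem adjoint_tensLeft_tens (ψ a : L2 X) (b : L2 Y) :
    (tensLeft ψ).adjoint (tens a b) = inner ℂ ψ a • b := by
  refine ext_inner_left ℂ fun φ => ?_
  rw [ContinuousLinearMap.adjoint_inner_right, tensLeft_apply, inner_tens, inner_smul_right]

theorem adjoint_tensRight_tens (φ b : L2 Y) (a : L2 X) :
    (tensRight φ).adjoint (tens a b) = inner ℂ φ b • a := by
  refine ext_inner_left ℂ fun ψ => ?_
  rw [ContinuousLinearMap.adjoint_inner_right, tensRight_apply, inner_tens, inner_smul_right,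
    mul_comm]

theorem tens_smul_left (c : ℂ) (ψ : L2 X) (φ : L2 Y) : tens (c • ψ) φ = c • tens ψ φ := by
  ext p; simp [mul_assoc]

theorem tens_smul_right (c : ℂ) (ψ : L2 X) (φ : L2 Y) : tens ψ (c • φ) = c • tens ψ φ := by
  ext p; simp [mul_left_comm]

theorem tensor_proj_left (ψ : L2 X) (B : Op Y) : tensor (proj ψ) B = conj (tensLeft ψ) B := by
  refine ext_ket fun p => ?_
  rw [show p = (p.1, p.2) from rfl, ket_prod, tensor_tens, proj_apply, conj,
    ContinuousLinearMap.comp_apply, ContinuousLinearMap.comp_apply, adjoint_tensLeft_tens,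
    map_smul, map_smul, tensLeft_apply, tens_smul_left]

theorem tensor_proj_right (A : Op X) (φ : L2 Y) : tensor A (proj φ) = conj (tensRight φ) A := by
  refine ext_ket fun p => ?_
  rw [show p = (p.1, p.2) from rfl, ket_prod, tensor_tens, proj_apply, conj,
    ContinuousLinearMap.comp_apply, ContinuousLinearMap.comp_apply, adjoint_tensRight_tens,
    map_smul, map_smul, tensRight_apply, tens_smul_right]

theorem tensor_proj_proj (ψ : L2 X) (φ : L2 Y) : tensor (proj ψ) (proj φ) = proj (tens ψ φ) := by
  rw [tensor_proj_left, conj_proj, tensLeft_apply]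

theorem adjoint_ket (A : Op X) (x y : X) :
    A.adjoint (ket x) y = (starRingEnd ℂ) (A (ket y) x) := by
  rw [← inner_ket_left, ContinuousLinearMap.adjoint_inner_right, inner_ket_right]

theorem ampl_adjoint (A : Op X) : (ampl Y A).adjoint = ampl Y A.adjoint := by
  refine ext_ket fun p => ?_
  ext q
  obtain ⟨x, y⟩ := p
  obtain ⟨x', y'⟩ := q
  rw [adjoint_ket, ket_prod, ket_prod, ampl_tens, ampl_tens, tens_apply, tens_apply, adjoint_ket,
    map_mul, ket_apply, ket_apply]
  by_cases h : y = y'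
  · simp [h]
  · simp [h, Ne.symm h]

theorem ptraceSnd_eq (ρ : Op (X × Y)) : ptraceSnd ρ = ∑' y, conj (sliceFst y) ρ := rfl
theorem ptraceFst_eq (ρ : Op (X × Y)) : ptraceFst ρ = ∑' x, conj (sliceSnd x) ρ := rfl

/-! ### Operators on lists of quantum variables -/

variable {S : VarSystem.{u}} {E E' : Type u} {k : ℕ}

theorem updList_injective {V : Type u} {τ : V → Type u} (Q : Fin k ↪ V) (m : ∀ v, τ v) :
    Function.Injective (updList Q m) := fun _ _ h =>
  (Prod.mk.inj ((splitList Q).symm.injective h)).1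

theorem updList_apply_mem {V : Type u} {τ : V → Type u} (Q : Fin k ↪ V) (m : ∀ v, τ v)
    (t : ∀ i, τ (Q i)) (i : Fin k) : updList Q m t (Q i) = t i := by
  rw [← splitList_fst Q (updList Q m t) i, updList, Equiv.apply_symm_apply]

theorem updList_apply_not_mem {V : Type u} {τ : V → Type u} (Q : Fin k ↪ V) (m : ∀ v, τ v)
    (t : ∀ i, τ (Q i)) {v : V} (hv : v ∉ Set.range Q) : updList Q m t v = m v := by
  rw [← splitList_snd Q (updList Q m t) ⟨v, hv⟩, updList, Equiv.apply_symm_apply]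
  rfl

/-- The values of the quantum variables in `Q`, the others being fixed. -/
def qslice (Q : Fin k ↪ S.QVar) (p : S.QMem) (e : E) :
    L2 (S.QMem × E) →L[ℂ] L2 (∀ i, S.qtyp (Q i)) :=
  pull ⟨fun z => (updList Q p z, e), fun _ _ h => updList_injective Q p (Prod.mk.inj h).1⟩

theorem qslice_apply (Q : Fin k ↪ S.QVar) (p : S.QMem) (e : E) (ψ : L2 (S.QMem × E))
    (z : ∀ i, S.qtyp (Q i)) : qslice Q p e ψ z = ψ (updList Q p z, e) := rfl

theorem liftOp_apply (Q : Fin k ↪ S.QVar) (A : Op (∀ i, S.qtyp (Q i))) (ψ : L2 (S.QMem × E))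
    (p : S.QMem) (e : E) : liftOp E Q A ψ (p, e) = A (qslice Q p e ψ) fun i => p (Q i) := rfl

theorem enorm_pull_equiv (σ : X ≃ Y) (ψ : L2 Y) : ‖pull σ.toEmbedding ψ‖ₑ ^ 2 = ‖ψ‖ₑ ^ 2 := by
  rw [L2.enorm_sq, L2.enorm_sq, ← σ.tsum_eq]
  rfl

theorem liftOp_eq (Q : Fin k ↪ S.QVar) (A : Op (∀ i, S.qtyp (Q i))) (ψ : L2 (S.QMem × E)) :
    liftOp E Q A ψ = pull (splitReg E Q).toEmbedding
      (ampl _ A (pull (splitReg E Q).symm.toEmbedding ψ)) := rfl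

theorem liftOp_adjoint (Q : Fin k ↪ S.QVar) (A : Op (∀ i, S.qtyp (Q i))) :
    (liftOp E Q A).adjoint = liftOp E Q A.adjoint := by
  rw [liftOp, liftOp, reindex, reindex, ContinuousLinearMap.adjoint_comp,
    ContinuousLinearMap.adjoint_comp, adjoint_pull_equiv, adjoint_pull_equiv, ampl_adjoint]
  rfl

theorem tsum_enorm_liftOp_le {J : Type*} (Q : Fin k ↪ S.QVar)
    (A : J → Op (∀ i, S.qtyp (Q i))) (hA : ∀ ψ, ∑' j, ‖A j ψ‖ₑ ^ 2 ≤ ‖ψ‖ₑ ^ 2)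
    (ψ : L2 (S.QMem × E)) : ∑' j, ‖liftOp E Q (A j) ψ‖ₑ ^ 2 ≤ ‖ψ‖ₑ ^ 2 := by
  simp_rw [liftOp_eq, enorm_pull_equiv, enorm_ampl]
  rw [ENNReal.tsum_comm, ← enorm_pull_equiv (splitReg E Q).symm ψ, ← tsum_enorm_sliceFst]
  exact ENNReal.tsum_le_tsum fun y => hA _

theorem enorm_liftOp_isometry (Q : Fin k ↪ S.QVar)
    (U : L2 (∀ i, S.qtyp (Q i)) →ₗᵢ[ℂ] L2 (∀ i, S.qtyp (Q i))) (ψ : L2 (S.QMem × E)) :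
    ‖liftOp E Q U.toContinuousLinearMap ψ‖ₑ ^ 2 ≤ ‖ψ‖ₑ ^ 2 := by
  have := tsum_enorm_liftOp_le (J := Unit) Q (fun _ => U.toContinuousLinearMap)
    (fun ψ => by simp) ψ
  simpa using this

/-- Bessel's inequality for mutually orthogonal vectors: expand `‖∑ v z - ψ‖² ≥ 0`. It is applied to
the components `v z = P z ψ` of a projective measurement. -/
theorem sum_norm_sq_le_of_inner_eq {D F : Type*} [NormedAddCommGroup F] [InnerProductSpace ℂ F]
    (v : D → F) (ψ : F) (hv : ∀ z, inner ℂ (v z) ψ = ((‖v z‖ ^ 2 : ℝ) : ℂ))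
    (horth : ∀ z z', z ≠ z' → inner ℂ (v z) (v z') = 0) (s : Finset D) :
    ∑ z ∈ s, ‖v z‖ ^ 2 ≤ ‖ψ‖ ^ 2 := by
  have h1 : inner ℂ (∑ z ∈ s, v z) ψ = ((∑ z ∈ s, ‖v z‖ ^ 2 : ℝ) : ℂ) := by
    rw [sum_inner, Complex.ofReal_sum]
    exact Finset.sum_congr rfl fun z _ => hv z
  have h2 : inner ℂ (∑ z ∈ s, v z) (∑ z ∈ s, v z) = ((∑ z ∈ s, ‖v z‖ ^ 2 : ℝ) : ℂ) := by
    rw [sum_inner, Complex.ofReal_sum]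
    refine Finset.sum_congr rfl fun z hz => ?_
    rw [inner_sum, Finset.sum_eq_single z (fun z' _ h => horth _ _ (Ne.symm h))
      (fun h => absurd hz h), inner_self_eq_norm_sq_to_K]
    simp
  have h3 := norm_sub_sq (𝕜 := ℂ) (∑ z ∈ s, v z) ψ
  rw [h1, ← inner_self_eq_norm_sq (𝕜 := ℂ) (∑ z ∈ s, v z), h2] at h3
  have h4 := sq_nonneg ‖∑ z ∈ s, v z - ψ‖
  rw [h3] at h4
  simp only [RCLike.re_to_complex, Complex.ofReal_re] at h4
  linarith

theorem ProjMeas.tsum_enorm_le {T D : Type u} (μ : ProjMeas T D) (ψ : L2 T) :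
    ∑' z, ‖μ.op z ψ‖ₑ ^ 2 ≤ ‖ψ‖ₑ ^ 2 := by
  have hself : ∀ z (a b : L2 T), inner ℂ (μ.op z a) b = inner ℂ a (μ.op z b) := by
    intro z a b
    have h : (μ.op z).adjoint = μ.op z := (μ.isProj z).isSelfAdjoint
    nth_rewrite 1 [← h]
    rw [ContinuousLinearMap.adjoint_inner_left]
  have hidem : ∀ z (a : L2 T), μ.op z (μ.op z a) = μ.op z a := fun z a =>
    DFunLike.congr_fun (μ.isProj z).isIdempotentElem.eq a
  have key := sum_norm_sq_le_of_inner_eq (fun z => μ.op z ψ) ψ (fun z => by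
      rw [← hidem, hself, inner_self_eq_norm_sq_to_K, hidem]; simp)
    (fun z z' h => by
      have : μ.op z (μ.op z' ψ) = 0 := DFunLike.congr_fun (μ.orthogonal z z' h) ψ
      rw [hself, this, inner_zero_right])
  rw [ENNReal.tsum_eq_iSup_sum]
  refine iSup_le fun F => ?_
  have h := ENNReal.ofReal_le_ofReal (key F)
  rw [ENNReal.ofReal_sum_of_nonneg (fun _ _ => sq_nonneg _),
    ENNReal.ofReal_pow (norm_nonneg _), ofReal_norm] at h
  refine le_trans (le_of_eq (Finset.sum_congr rfl fun z _ => ?_)) h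
  rw [ENNReal.ofReal_pow (norm_nonneg _), ofReal_norm]

end

section

/-! ### The semantics of programs on pure states -/

variable {S : VarSystem.{u}} {E E' : Type u} {k l : ℕ}

theorem ite_le (b : Prop) {X Y : Type u} {G : L2 X →L[ℂ] L2 Y}
    (hG : ∀ ψ, ‖G ψ‖ₑ ^ 2 ≤ ‖ψ‖ₑ ^ 2) (ψ : L2 X) :
    ‖(if b then G else 0) ψ‖ₑ ^ 2 ≤ ‖ψ‖ₑ ^ 2 := by
  split_ifs
  · exact hG ψ
  · simp

theorem restrictFam_eq (b : S.CMem → Prop) (ρ : Fam S E) :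
    restrictFam b ρ =
      kraus₁ (fun m => m) (fun m => if b m then ContinuousLinearMap.id ℂ _ else 0) ρ := by
  funext m
  rw [kraus₁_id_apply, restrictFam]
  split_ifs
  · rw [conj_id]
  · rw [conj_zero_left]

theorem restrictFam_good (b : S.CMem → Prop) : Good (restrictFam (E := E) b) :=
  (kraus₁_good (fun m ψ => ite_le (b m) id_le ψ)).congr fun ρ _ => (restrictFam_eq b ρ).symm

theorem restrictFam_pure (b : S.CMem → Prop) (m : S.CMem) (ψ : L2 (S.QMem × E)) :
    restrictFam b (pure m ψ) = if b m then pure m ψ else 0 := by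
  funext m'
  by_cases hm : m = m'
  · subst hm
    by_cases hb : b m <;> simp [restrictFam, hb]
  · by_cases hb : b m <;> simp [restrictFam, hb, pure, single, hm]

theorem etrF_restrictFam_add (b : S.CMem → Prop) (ρ : Fam S E) :
    etrF (restrictFam b ρ) + etrF (restrictFam (fun m => ¬ b m) ρ) = etrF ρ := by
  rw [etrF, etrF, ← ENNReal.tsum_add]
  refine tsum_congr fun m => ?_
  by_cases h : b m <;> simp [restrictFam, h, etr_zero]

/-! #### Basic statements -/

theorem denE_assign (X : Fin k ↪ S.CVar) (e : Expr S (∀ i, S.ctyp (X i))) (ρ : Fam S E) :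
    denE (.assign X e) E ρ =
      kraus₁ (fun m => updList X m (e.eval m)) (fun _ => ContinuousLinearMap.id ℂ _) ρ := by
  funext m
  rw [kraus₁_apply]
  simp only [denE, single, conj_id]

/-- `√p` times the identity. -/
def sqrtId (X : Type u) (p : NNReal) : Op X :=
  (Real.sqrt p : ℂ) • ContinuousLinearMap.id ℂ (L2 X)

theorem sqrtId_apply {X : Type u} (p : NNReal) (ψ : L2 X) :
    sqrtId X p ψ = (Real.sqrt p : ℂ) • ψ := rfl

theorem conj_smul {X Y : Type u} (c : ℂ) (K : L2 X →L[ℂ] L2 Y) (A : Op X) :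
    conj (c • K) A = ((‖c‖ : ℂ) ^ 2) • conj K A := by
  ext1 φ
  simp only [conj, ContinuousLinearMap.comp_apply, smul_apply, map_smulₛₗ, smul_smul,
    RingHom.id_apply]
  congr 1
  rw [← Complex.mul_conj', mul_comm]

theorem conj_sqrtId {X : Type u} (p : NNReal) (A : Op X) :
    conj (sqrtId X p) A = ((p : ℝ) : ℂ) • A := by
  rw [sqrtId, conj_smul, conj_id, Complex.norm_real, Real.norm_of_nonneg (Real.sqrt_nonneg _)]
  congr 1
  rw [← Complex.ofReal_pow, Real.sq_sqrt (NNReal.coe_nonneg p)]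

theorem enorm_sqrtId {X : Type u} (p : NNReal) (ψ : L2 X) :
    ‖sqrtId X p ψ‖ₑ ^ 2 = (p : ℝ≥0∞) * ‖ψ‖ₑ ^ 2 := by
  have h1 := etr_proj (sqrtId X p ψ)
  have : ‖(Real.sqrt p : ℂ)‖ₑ ^ 2 = (p : ℝ≥0∞) := by
    rw [← ofReal_norm, Complex.norm_real, Real.norm_of_nonneg (Real.sqrt_nonneg _),
      ← ENNReal.ofReal_pow (Real.sqrt_nonneg _), Real.sq_sqrt (NNReal.coe_nonneg p), ENNReal.ofReal_coe_nnreal]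
  rw [sqrtId_apply, enorm_smul, mul_pow, this]

theorem tsum_sqrtId_le {X T : Type u} (p : SubDistr T) (ψ : L2 X) :
    ∑' z, ‖sqrtId X (p.1 z) ψ‖ₑ ^ 2 ≤ ‖ψ‖ₑ ^ 2 := by
  simp_rw [enorm_sqrtId]
  rw [ENNReal.tsum_mul_right]
  exact mul_le_of_le_one_left' p.2

theorem tsum_kraus_prod {M N X Y J : Type u} {t : J → M → N} {K : J → M → L2 X →L[ℂ] L2 Y}
    (hK : ∀ m ψ, ∑' j, ‖K j m ψ‖ₑ ^ 2 ≤ ‖ψ‖ₑ ^ 2) {ρ : M → Op X} (hρ : IsCQ ρ) (n : N) :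
    kraus t K ρ n = ∑' m, ∑' j, single (t j m) (conj (K j m) (ρ m)) n :=
  ((kraus_cqSum hK hρ).sum n).summable.tsum_prod

theorem denE_sample (X : Fin k ↪ S.CVar) (e : Expr S (SubDistr (∀ i, S.ctyp (X i))))
    {ρ : Fam S E} (hρ : IsCQ ρ) : denE (.sample X e) E ρ =
      kraus (fun z m => updList X m z) (fun z m => sqrtId _ ((e.eval m).1 z)) ρ := by
  funext m
  rw [tsum_kraus_prod (fun m ψ => tsum_sqrtId_le (e.eval m) ψ) hρ]
  simp only [denE, single, conj_sqrtId]

theorem denE_qapply (Q : Fin k ↪ S.QVar)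
    (e : Expr S (L2 (∀ i, S.qtyp (Q i)) →ₗᵢ[ℂ] L2 (∀ i, S.qtyp (Q i)))) (ρ : Fam S E) :
    denE (.qapply Q e) E ρ =
      kraus₁ (fun m => m) (fun m => liftOp E Q (e.eval m).toContinuousLinearMap) ρ := by
  funext m
  rw [kraus₁_id_apply]
  rfl

theorem denE_measure (X : Fin k ↪ S.CVar) (Q : Fin l ↪ S.QVar)
    (e : Expr S (ProjMeas (∀ i, S.qtyp (Q i)) (∀ i, S.ctyp (X i)))) {ρ : Fam S E}
    (hρ : IsCQ ρ) : denE (.measure X Q e) E ρ =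
      kraus (fun z m => updList X m z) (fun z m => liftOp E Q ((e.eval m).op z)) ρ := by
  funext m
  rw [tsum_kraus_prod (fun m ψ => tsum_enorm_liftOp_le Q _ (e.eval m).tsum_enorm_le ψ) hρ]
  have h : ∀ m z, (liftOp E Q ((e.eval m).op z)).adjoint = liftOp E Q ((e.eval m).op z) := by
    intro m z
    rw [liftOp_adjoint, show ((e.eval m).op z).adjoint = (e.eval m).op z from
      ((e.eval m).isProj z).isSelfAdjoint]
  simp only [denE, single, conj, h]

/-- The operator `|e⟩⟨z|`. -/
def ketbra {X : Type u} (e : L2 X) (z : X) : Op X := InnerProductSpace.rankOne ℂ e (ket z)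

theorem ketbra_apply {X : Type u} (e : L2 X) (z : X) (ψ : L2 X) : ketbra e z ψ = ψ z • e := by
  simp [ketbra, inner_ket_left]

theorem tsum_ketbra_le {X : Type u} (e : L2 X) (he : ‖e‖ = 1) (ψ : L2 X) :
    ∑' z, ‖ketbra e z ψ‖ₑ ^ 2 ≤ ‖ψ‖ₑ ^ 2 := by
  have he' : ‖e‖ₑ = 1 := by rw [← ofReal_norm, he, ENNReal.ofReal_one]
  simp_rw [ketbra_apply, enorm_smul, he', mul_one]
  rw [L2.enorm_sq]

theorem hasSum_ptraceFst {X Y : Type u} {A : Op (X × Y)} (h : A.IsPositive) (hA : etr A ≠ ∞) :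
    HasSum (fun x => conj (sliceSnd x) A) (ptraceFst A) :=
  (summable_of_etr (fun _ => conj_isPositive _ h) (ne_top_of_le_ne_top hA
    (tsum_etr_conj_le _ (fun ψ => (tsum_enorm_sliceSnd ψ).le) h))).hasSum

theorem etr_conj_le {X Y : Type u} {K : L2 X →L[ℂ] L2 Y} (hK : ∀ ψ, ‖K ψ‖ₑ ^ 2 ≤ ‖ψ‖ₑ ^ 2)
    {A : Op X} (h : A.IsPositive) : etr (conj K A) ≤ etr A := by
  have := tsum_etr_conj_le (J := Unit) (fun _ => K) (fun ψ => by simpa using hK ψ) h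
  simpa using this

/-- Tracing out `Q` is a sum over the basis vectors `⟨z|`, and tensoring with the new state `e`
inserts `|e⟩`; together these are the Kraus operators `|e⟩⟨z|` on `Q`. -/
theorem denE_qinit (Q : Fin k ↪ S.QVar)
    (e : Expr S {ψ : L2 (∀ i, S.qtyp (Q i)) // ‖ψ‖ = 1}) {ρ : Fam S E} (hρ : IsCQ ρ) :
    denE (.qinit Q e) E ρ =
      kraus (fun _ m => m) (fun z m => liftOp E Q (ketbra (e.eval m).1 z)) ρ := by
  funext m
  rw [kraus_id_apply]
  have hpos := hρ.pos m
  have ht : etr (ρ m) ≠ ∞ := ENNReal.ne_top_of_tsum_ne_top hρ.ne_top m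
  have h1 := hasSum_ptraceFst (A := reindex (splitReg E Q) (ρ m))
    (by rw [reindex_eq_conj]; exact conj_isPositive _ hpos)
    (by
      rw [reindex_eq_conj]
      exact ne_top_of_le_ne_top ht (etr_conj_le (fun ψ => (enorm_pull_equiv _ ψ).le) hpos))
  have h2 := conj_hasSum (pull (splitReg E Q).toEmbedding)
    (conj_hasSum (tensLeft (e.eval m).1) h1)
  change reindex (splitReg E Q).symm (tensor (proj (e.eval m).1) _) = _
  rw [tensor_proj_left, reindex_eq_conj, Equiv.symm_symm, ← h2.tsum_eq]
  refine tsum_congr fun z => ?_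
  rw [reindex_eq_conj, conj_conj, conj_conj, conj_conj]
  congr 1
  ext ψ p
  obtain ⟨p, r⟩ := p
  rw [liftOp_apply, ketbra_apply]
  change (e.eval m).1 _ * ψ _ = ψ _ * (e.eval m).1 _
  rw [mul_comm]
  rfl

/-! #### Local variables -/

theorem update_injective_of_eq {V : Type u} {τ : V → Type u} (q : V) (b : τ q) {p p' : ∀ v, τ v}
    (h : Function.update p q b = Function.update p' q b) (hq : p q = p' q) : p = p' := by
  have := congrArg (fun f => Function.update f q (p q)) h
  simp only [Function.update_idem, Function.update_eq_self] at this
  rw [this, hq, Function.update_eq_self]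

/-- Initializing the local quantum variable `q`, with the old value saved in a register. -/
def locIn (E : Type u) (q : S.QVar) : L2 (S.QMem × E) →L[ℂ] L2 (S.QMem × (E × S.qtyp q)) :=
  prel {y | y.1 q = S.qinit q} (fun y => (Function.update y.1 q y.2.2, y.2.1)) (by
    rintro ⟨p, e, t⟩ hp ⟨p', e', t'⟩ hp' h
    simp only [Prod.mk.injEq] at h
    simp only [Set.mem_ofPred_eq] at hp hp'
    have ht : t = t' := by simpa using congrFun h.1 q
    subst ht
    rw [update_injective_of_eq q t h.1 (hp.trans hp'.symm), h.2])

theorem locIn_apply (q : S.QVar) (ψ : L2 (S.QMem × E)) (p : S.QMem) (e : E) (t : S.qtyp q) :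
    locIn E q ψ (p, (e, t)) =
      if p q = S.qinit q then ψ (Function.update p q t, e) else 0 := rfl

theorem locOut_injOn (E : Type u) (q : S.QVar) (b : S.qtyp q) : Set.InjOn
    (fun y : S.QMem × E => (Function.update y.1 q b, (y.2, y.1 q))) Set.univ := by
  rintro ⟨p, e⟩ - ⟨p', e'⟩ - h
  simp only [Prod.mk.injEq] at h
  rw [update_injective_of_eq q b h.1 h.2.2, h.2.1]

/-- Restoring the saved value of `q`; the discarded local variable has value `b`. -/
def locOut (E : Type u) (q : S.QVar) (b : S.qtyp q) :
    L2 (S.QMem × (E × S.qtyp q)) →L[ℂ] L2 (S.QMem × E) :=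
  prel Set.univ (fun y => (Function.update y.1 q b, (y.2, y.1 q))) (locOut_injOn E q b)

theorem locOut_apply (q : S.QVar) (b : S.qtyp q) (ψ : L2 (S.QMem × (E × S.qtyp q))) (p : S.QMem)
    (e : E) : locOut E q b ψ (p, e) = ψ (Function.update p q b, (e, p q)) := by
  exact if_pos (Set.mem_univ _)

theorem locIn_le (q : S.QVar) (ψ : L2 (S.QMem × E)) : ‖locIn E q ψ‖ₑ ^ 2 ≤ ‖ψ‖ₑ ^ 2 :=
  enorm_prel_le _ _ _ ψ

theorem tsum_locOut_le (q : S.QVar) (ψ : L2 (S.QMem × (E × S.qtyp q))) :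
    ∑' b, ‖locOut E q b ψ‖ₑ ^ 2 ≤ ‖ψ‖ₑ ^ 2 := by
  refine tsum_enorm_prel_le (J := S.qtyp q) (fun _ => Set.univ)
    (fun b (y : S.QMem × E) => (Function.update y.1 q b, (y.2, y.1 q)))
    (fun b => locOut_injOn E q b) ?_ ψ
  rintro b b' ⟨p, e⟩ ⟨p', e'⟩ - - h
  simp only [Prod.mk.injEq] at h
  have hb : b = b' := by simpa using congrFun h.1 q
  subst hb
  exact ⟨rfl, by rw [update_injective_of_eq q b h.1 h.2.2, h.2.1]⟩

/-- Adding a default register and swapping merge into the isometry `locIn`; swapping back and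
reading the register at the basis state `b` merge into `locOut`, with one Kraus operator for each
`b`. -/
theorem denE_loc_inr (q : S.QVar) (c : Prog S) (ρ : Fam S E) :
    denE (.loc (.inr q) c) E ρ = kraus (fun _ m => m) (fun b _ => locOut E q b)
      (denE c (E × S.qtyp q) (kraus₁ (fun m => m) (fun _ => locIn E q) ρ)) := by
  have hin : (fun m' => reindex (swapLocal S E q) (tensor (ρ m') (proj (ket (S.qinit q))))) =
      kraus₁ (fun m => m) (fun _ => locIn E q) ρ := by
    funext m
    rw [kraus₁_id_apply, tensor_proj_right, reindex_eq_conj, conj_conj]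
    congr 1
    ext ψ y
    obtain ⟨p, e, t⟩ := y
    change ψ (Function.update p q t, e) * ket (S.qinit q) (p q) = _
    rw [locIn_apply, ket_apply]
    split_ifs <;> simp
  funext m
  change ptraceSnd (reindex (swapLocal S E q).symm (denE c (E × S.qtyp q)
    (fun m' => reindex (swapLocal S E q) (tensor (ρ m') (proj (ket (S.qinit q))))) m)) = _
  rw [hin, kraus_id_apply, ptraceSnd_eq]
  refine tsum_congr fun b => ?_
  rw [reindex_eq_conj, conj_conj]
  congr 1
  ext ψ y
  rw [locOut_apply]
  rfl

/-- Assigning the value `b` to the classical variable `x`. -/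
def cset₁ (E : Type u) (x : S.CVar) (b : S.ctyp x) : Fam S E → Fam S E :=
  kraus₁ (fun m => Function.update m x b) fun _ => ContinuousLinearMap.id ℂ _

theorem cset₁_good (x : S.CVar) (b : S.ctyp x) : Good (cset₁ E x b) :=
  kraus₁_good fun _ => id_le

theorem cset₁_pure (x : S.CVar) (b : S.ctyp x) (m : S.CMem) (ψ : L2 (S.QMem × E)) :
    cset₁ E x b (pure m ψ) = pure (Function.update m x b) ψ :=
  kraus₁_pure (fun _ => id_le) m ψ

theorem update_eq_iff' {V : Type u} {τ : V → Type u} {x : V} {b : τ x} {m n : ∀ v, τ v} :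
    Function.update m x b = n ↔ n x = b ∧ m = Function.update n x (m x) := by
  constructor
  · rintro rfl
    simp
  · rintro ⟨rfl, h⟩
    rw [h]
    simp

theorem cset₁_apply (x : S.CVar) (b : S.ctyp x) (ρ : Fam S E) (n : S.CMem) :
    cset₁ E x b ρ n = if n x = b then ∑' a, ρ (Function.update n x a) else 0 := by
  rw [cset₁, kraus₁_apply]
  simp only [conj_id, single]
  split_ifs with h
  · have hi : Function.Injective fun a => Function.update n x a := Function.update_injective n x
    rw [← hi.tsum_eq]
    · refine tsum_congr fun a => ?_
      rw [if_pos]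
      simp [← h]
    · intro m hm
      by_contra hmr
      refine hm (if_neg fun h' => hmr ⟨m x, ?_⟩)
      exact (update_eq_iff'.1 h').2.symm
  · exact (tsum_congr fun m => if_neg fun h' => h (update_eq_iff'.1 h').1).trans tsum_zero

/-- The part of the semantics of a local classical variable that belongs to the saved value `b`. -/
def locPart (x : S.CVar) (Φ : Fam S E → Fam S E) (b : S.ctyp x) (ρ : Fam S E) : Fam S E :=
  cset₁ E x b (Φ (cset₁ E x (S.cinit x) (restrictFam (fun m => m x = b) ρ)))

/-- Written as a sum over the saved value `b`, the semantics is built from additive maps. At the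
memory `m` only the summand `b = m x` contributes. -/
theorem denE_loc_inl (x : S.CVar) (c : Prog S) (ρ : Fam S E) :
    denE (.loc (.inl x) c) E ρ = fun m => ∑' b, locPart x (denE c E) b ρ m := by
  funext m
  have h1 : ∀ b, cset₁ E x (S.cinit x) (restrictFam (fun m => m x = b) ρ) =
      fun m' => if m' x = S.cinit x then ρ (Function.update m' x b) else 0 := by
    intro b
    funext m'
    rw [cset₁_apply]
    split_ifs
    · rw [tsum_eq_single b]
      · simp [restrictFam]
      · intro a ha
        simp [restrictFam, ha]
    · rfl
  rw [tsum_eq_single (m x)]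
  · rw [locPart, cset₁_apply, if_pos rfl, h1]
    rfl
  · intro b hb
    rw [locPart, cset₁_apply, if_neg (Ne.symm hb)]

theorem locPart_good (x : S.CVar) {Φ : Fam S E → Fam S E} (hΦ : Good Φ) (b : S.ctyp x) :
    Good (locPart x Φ b) :=
  (cset₁_good x b).comp (hΦ.comp ((cset₁_good x _).comp (restrictFam_good _)))

theorem locPart_le (x : S.CVar) {Φ : Fam S E → Fam S E} (hΦ : Good Φ) (ρ : Fam S E)
    (hρ : IsCQ ρ) : ∑' b, etrF (locPart x Φ b ρ) ≤ etrF ρ := by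
  calc _ ≤ ∑' b, etrF (restrictFam (fun m => m x = b) ρ) := by
        refine ENNReal.tsum_le_tsum fun b => ?_
        have h0 := (restrictFam_good (E := E) fun m => m x = b).cq hρ
        have h1 := (cset₁_good x (S.cinit x)).cq h0
        exact ((cset₁_good x b).tr _ (hΦ.cq h1)).trans
          ((hΦ.tr _ h1).trans ((cset₁_good x _).tr _ h0))
    _ = etrF ρ := by
        unfold etrF
        rw [ENNReal.tsum_comm]
        refine tsum_congr fun m => ?_
        rw [tsum_eq_single (m x)]
        · simp [restrictFam]
        · intro b hb
          simp [restrictFam, Ne.symm hb, etr_zero]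

/-! #### Control structures -/

theorem denE_ite_eq (e : Expr S (ULift.{u} Bool)) (c d : Prog S) (ρ : Fam S E) :
    denE (.ite e c d) E ρ = fun m => ∑' b : Bool, (match b with
      | true => denE c E (restrictFam (fun m => (e.eval m).down = true) ρ)
      | false => denE d E (restrictFam (fun m => ¬ (e.eval m).down = true) ρ)) m := by
  funext m
  rw [tsum_bool, add_comm]
  rfl

/-- The body of a loop, including the test. -/
def loopStep (e : Expr S (ULift.{u} Bool)) (c : Prog S) (E : Type u) (σ : Fam S E) : Fam S E :=
  denE c E (restrictFam (fun m => (e.eval m).down = true) σ)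

/-- The states after `i` iterations in which the loop terminates. -/
def loopExit (e : Expr S (ULift.{u} Bool)) (c : Prog S) (E : Type u) (i : ℕ) (ρ : Fam S E) :
    Fam S E :=
  restrictFam (fun m => ¬ (e.eval m).down = true) ((loopStep e c E)^[i] ρ)

theorem loopStep_good (e : Expr S (ULift.{u} Bool)) {c : Prog S} (h : Good (denE c E)) :
    Good (loopStep e c E) := h.comp (restrictFam_good _)

theorem iterate_good {M X : Type u} {Φ : (M → Op X) → M → Op X} (h : Good Φ) :
    ∀ i, Good (Φ^[i])
  | 0 => Good.id
  | i + 1 => (iterate_good h i).comp h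

theorem loopExit_good (e : Expr S (ULift.{u} Bool)) {c : Prog S} (h : Good (denE c E)) (i : ℕ) :
    Good (loopExit e c E i) := (restrictFam_good _).comp (iterate_good (loopStep_good e h) i)

/-- Invariant: the trace that has left the loop during the first `n` rounds, plus the trace still
inside, never exceeds the initial trace. -/
theorem loopExit_le (e : Expr S (ULift.{u} Bool)) {c : Prog S} (h : Good (denE c E))
    (ρ : Fam S E) (hρ : IsCQ ρ) : ∑' i, etrF (loopExit e c E i ρ) ≤ etrF ρ := by
  have key : ∀ n, ∑ i ∈ Finset.range n, etrF (loopExit e c E i ρ) +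
      etrF ((loopStep e c E)^[n] ρ) ≤ etrF ρ := by
    intro n
    induction n with
    | zero => simp
    | succ n ih =>
      refine le_trans ?_ ih
      rw [Finset.sum_range_succ, add_assoc]
      gcongr
      have hc := (iterate_good (loopStep_good e h) n).cq hρ
      rw [Function.iterate_succ_apply',
        ← etrF_restrictFam_add (fun m => (e.eval m).down = true) ((loopStep e c E)^[n] ρ), add_comm]
      gcongr
      · exact h.tr _ ((restrictFam_good _).cq hc)
      · exact le_rfl
  exact ENNReal.tsum_le_of_sum_range_le fun n => le_self_add.trans (key n)

theorem qinit_le (Q : Fin k ↪ S.QVar) (e : Expr S {ψ : L2 (∀ i, S.qtyp (Q i)) // ‖ψ‖ = 1})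
    (m : S.CMem) (ψ : L2 (S.QMem × E)) :
    ∑' z, ‖liftOp E Q (ketbra (e.eval m).1 z) ψ‖ₑ ^ 2 ≤ ‖ψ‖ₑ ^ 2 :=
  tsum_enorm_liftOp_le Q _ (tsum_ketbra_le _ (e.eval m).2) ψ

theorem measure_le (X : Fin k ↪ S.CVar) (Q : Fin l ↪ S.QVar)
    (e : Expr S (ProjMeas (∀ i, S.qtyp (Q i)) (∀ i, S.ctyp (X i)))) (m : S.CMem)
    (ψ : L2 (S.QMem × E)) : ∑' z, ‖liftOp E Q ((e.eval m).op z) ψ‖ₑ ^ 2 ≤ ‖ψ‖ₑ ^ 2 :=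
  tsum_enorm_liftOp_le Q _ (e.eval m).tsum_enorm_le ψ

theorem denE_good : ∀ (c : Prog S) (E : Type u), Good (denE c E)
  | .hole i, _ => i.elim0
  | .skip, _ => Good.id
  | .assign X e, E => (kraus₁_good fun _ => id_le).congr fun ρ _ => (denE_assign X e ρ).symm
  | .sample X e, E => (kraus_good fun m ψ => tsum_sqrtId_le (e.eval m) ψ).congr
      fun _ hρ => (denE_sample X e hρ).symm
  | .ite e c d, E => by
      refine (Good.tsum (ι := Bool) (fun b => ?_) fun ρ hρ => ?_).congr
        fun ρ _ => (denE_ite_eq e c d ρ).symm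
      · cases b
        · exact (denE_good d E).comp (restrictFam_good _)
        · exact (denE_good c E).comp (restrictFam_good _)
      · rw [tsum_bool, ← etrF_restrictFam_add (fun m => (e.eval m).down = true) ρ, add_comm]
        gcongr
        · exact (denE_good c E).tr _ ((restrictFam_good _).cq hρ)
        · exact (denE_good d E).tr _ ((restrictFam_good _).cq hρ)
  | .whileLoop e c, E => Good.tsum (loopExit_good e (denE_good c E)) (loopExit_le e (denE_good c E))
  | .seq c d, E => (denE_good d E).comp (denE_good c E)
  | .qinit Q e, E => (kraus_good (qinit_le Q e)).congr fun _ hρ => (denE_qinit Q e hρ).symm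
  | .qapply Q e, E => (kraus₁_good fun m ψ => enorm_liftOp_isometry Q (e.eval m) ψ).congr
      fun ρ _ => (denE_qapply Q e ρ).symm
  | .measure X Q e, E => (kraus_good (measure_le X Q e)).congr fun _ hρ => (denE_measure X Q e hρ).symm
  | .loc (.inl x) c, E =>
      (Good.tsum (locPart_good x (denE_good c E)) (locPart_le x (denE_good c E))).congr
        fun ρ _ => (denE_loc_inl x c ρ).symm
  | .loc (.inr q) c, E =>
      ((kraus_good fun _ ψ => tsum_locOut_le q ψ).comp ((denE_good c (E × S.qtyp q)).comp
        (kraus₁_good fun _ ψ => locIn_le q ψ))).congr fun ρ _ => (denE_loc_inr q c ρ).symm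

theorem denE_ite_pure (e : Expr S (ULift.{u} Bool)) (c d : Prog S) (m : S.CMem)
    (ψ : L2 (S.QMem × E)) : denE (.ite e c d) E (pure m ψ) =
      if (e.eval m).down = true then denE c E (pure m ψ) else denE d E (pure m ψ) := by
  change denE c E (restrictFam _ _) + denE d E (restrictFam _ _) = _
  rw [restrictFam_pure, restrictFam_pure]
  split_ifs
  · rw [(denE_good d E).map_zero, add_zero]
  · rw [(denE_good c E).map_zero, zero_add]

theorem denE_while_cqSum (e : Expr S (ULift.{u} Bool)) (c : Prog S) {ρ : Fam S E}
    (hρ : IsCQ ρ) : CQSum (fun i => loopExit e c E i ρ) (denE (.whileLoop e c) E ρ) :=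
  Good.cqSum_tsum (loopExit_good e (denE_good c E)) (loopExit_le e (denE_good c E)) hρ

theorem denE_loc_inl_pure (x : S.CVar) (c : Prog S) (m : S.CMem) (ψ : L2 (S.QMem × E)) :
    denE (.loc (.inl x) c) E (pure m ψ) =
      cset₁ E x (m x) (denE c E (pure (Function.update m x (S.cinit x)) ψ)) := by
  rw [denE_loc_inl]
  funext n
  rw [tsum_eq_single (m x)]
  · rw [locPart, restrictFam_pure, if_pos rfl, cset₁_pure]
  · intro b hb
    rw [locPart, restrictFam_pure, if_neg (Ne.symm hb), (cset₁_good x _).map_zero,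
      (denE_good c E).map_zero, (cset₁_good x _).map_zero]
    rfl

theorem denE_loc_inr_pure (q : S.QVar) (c : Prog S) (m : S.CMem) (ψ : L2 (S.QMem × E)) :
    denE (.loc (.inr q) c) E (pure m ψ) = kraus (fun _ m => m) (fun b _ => locOut E q b)
      (denE c (E × S.qtyp q) (pure m (locIn E q ψ))) := by
  rw [denE_loc_inr, kraus₁_pure (fun _ ψ => locIn_le q ψ)]

end

section

/-! ### Operators that commute with a program -/

variable {S : VarSystem.{u}} {E E' : Type u} {k l : ℕ}

/-- The assignment `p`, overridden by `a` on `F`. -/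
def ov {V : Type u} {τ : V → Type u} (F : Set V) (a p : ∀ v, τ v) : ∀ v, τ v :=
  fun v => if v ∈ F then a v else p v

section ov

variable {V : Type u} {τ : V → Type u} {F : Set V} {a p : ∀ v, τ v} {v : V}

theorem ov_of_mem (h : v ∈ F) : ov F a p v = a v := if_pos h

theorem ov_of_not_mem (h : v ∉ F) : ov F a p v = p v := if_neg h

theorem ov_self : ov F p p = p := by
  funext v; by_cases h : v ∈ F <;> simp [ov, h]

theorem ov_eq_of_eqOn (h : ∀ v ∈ F, p v = a v) : ov F a p = p := by
  funext v
  by_cases hv : v ∈ F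
  · rw [ov_of_mem hv, h v hv]
  · rw [ov_of_not_mem hv]

theorem ov_empty : ov ∅ a p = p := by
  funext v; simp [ov]

end ov

theorem matUnit_injOn (E : Type u) (F : Set S.QVar) (u w : S.QMem) :
    Set.InjOn (fun y : S.QMem × E => (ov F w y.1, y.2)) {y | ∀ q ∈ F, y.1 q = u q} := by
  rintro ⟨p, e⟩ hp ⟨p', e'⟩ hp' h
  simp only [Prod.mk.injEq] at h
  obtain ⟨h1, rfl⟩ := h
  congr 1
  funext q
  by_cases hq : q ∈ F
  · exact (hp q hq).trans (hp' q hq).symm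
  · have := congrFun h1 q
    rwa [ov_of_not_mem hq, ov_of_not_mem hq] at this

/-- The operator `|u⟩⟨w|` on the quantum variables in `F`. -/
def matUnit (E : Type u) (F : Set S.QVar) (u w : S.QMem) :
    L2 (S.QMem × E) →L[ℂ] L2 (S.QMem × E) :=
  prel {y | ∀ q ∈ F, y.1 q = u q} (fun y => (ov F w y.1, y.2)) (matUnit_injOn E F u w)

theorem matUnit_apply (F : Set S.QVar) (u w : S.QMem) (ψ : L2 (S.QMem × E)) (p : S.QMem) (e : E) :
    matUnit E F u w ψ (p, e) = if ∀ q ∈ F, p q = u q then ψ (ov F w p, e) else 0 := rfl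

/-- `G` commutes with the operators on the quantum variables in `F`. -/
def Comm (F : Set S.QVar) (G : L2 (S.QMem × E) →L[ℂ] L2 (S.QMem × E')) : Prop :=
  ∀ F' ⊆ F, ∀ u w ψ, G (matUnit E F' u w ψ) = matUnit E' F' u w (G ψ)

theorem Comm.mono {F F' : Set S.QVar} {G : L2 (S.QMem × E) →L[ℂ] L2 (S.QMem × E')}
    (h : Comm F G) (hF : F' ⊆ F) : Comm F' G := fun F'' h' => h F'' (h'.trans hF)

theorem comm_id (F : Set S.QVar) : Comm F (ContinuousLinearMap.id ℂ (L2 (S.QMem × E))) :=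
  fun _ _ _ _ _ => rfl

theorem ov_updList {V : Type u} {τ : V → Type u} (Q : Fin k ↪ V) (a m : ∀ v, τ v)
    (t : ∀ i, τ (Q i)) : ov (Set.range Q) a (updList Q m t) = ov (Set.range Q) a m := by
  funext v
  by_cases hv : v ∈ Set.range Q
  · rw [ov_of_mem hv, ov_of_mem hv]
  · rw [ov_of_not_mem hv, ov_of_not_mem hv, updList_apply_not_mem _ _ _ hv]

theorem qslice_matUnit (Q : Fin k ↪ S.QVar) (p r : S.QMem) (f : E) (ψ : L2 (S.QMem × E)) :
    qslice Q r f (matUnit E (Set.range Q) p p ψ) =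
      ψ (ov (Set.range Q) p r, f) • ket fun i => p (Q i) := by
  ext z
  rw [qslice_apply, matUnit_apply, ov_updList]
  simp only [lp.coeFn_smul, Pi.smul_apply, ket_apply, smul_eq_mul, Set.forall_mem_range,
    updList_apply_mem, funext_iff]
  split_ifs <;> simp

theorem liftOp_matUnit (Q : Fin k ↪ S.QVar) (A : Op (∀ i, S.qtyp (Q i))) (p r : S.QMem) (f : E)
    (ψ : L2 (S.QMem × E)) : liftOp E Q A (matUnit E (Set.range Q) p p ψ) (r, f) =
      ψ (ov (Set.range Q) p r, f) * A (ket fun i => p (Q i)) fun i => r (Q i) := by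
  rw [liftOp_apply, qslice_matUnit, map_smul]
  rfl

theorem matUnit_ket (F : Set S.QVar) (p : S.QMem) (e : E) :
    matUnit E F p p (ket (p, e)) = ket (p, e) := by
  ext ⟨r, f⟩
  rw [matUnit_apply, ket_apply, ket_apply]
  by_cases h : ∀ q ∈ F, r q = p q
  · rw [if_pos h, ov_eq_of_eqOn h]
  · rw [if_neg h, if_neg]
    rintro ⟨⟩
    exact h fun _ _ => rfl

/-- Commuting with matrix units is enough for an arbitrary `A`, and no infinite sum of matrix units
is needed. The two sides are compared in one coordinate of the image of one basis vector; there a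
single matrix entry of `A`, times one matrix unit, is all that matters. -/
theorem Comm.liftOp {F : Set S.QVar} {G : L2 (S.QMem × E) →L[ℂ] L2 (S.QMem × E')} (h : Comm F G)
    (Q : Fin k ↪ S.QVar) (hQ : Set.range Q ⊆ F) (A : Op (∀ i, S.qtyp (Q i)))
    (ψ : L2 (S.QMem × E)) : G (liftOp E Q A ψ) = liftOp E' Q A (G ψ) := by
  suffices G ∘L QRHL.liftOp E Q A = QRHL.liftOp E' Q A ∘L G from DFunLike.congr_fun this ψ
  refine ext_ket ?_
  rintro ⟨p, e⟩
  rw [ContinuousLinearMap.comp_apply, ContinuousLinearMap.comp_apply]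
  have hc := h _ hQ
  ext ⟨p', e'⟩
  -- Projecting the output of `A` onto the values `p'` on `Q` leaves the entry of `A` between `p'`
  -- and `p`, times `|p'⟩⟨p|`.
  have h1 : matUnit E (Set.range Q) p' p' (QRHL.liftOp E Q A (ket (p, e))) =
      (A (ket fun i => p (Q i)) fun i => p' (Q i)) •
        matUnit E (Set.range Q) p' p (ket (p, e)) := by
    ext ⟨r, f⟩
    rw [matUnit_apply, ← matUnit_ket (Set.range Q) p e, liftOp_matUnit, matUnit_ket]
    simp only [lp.coeFn_smul, Pi.smul_apply, matUnit_apply, smul_eq_mul]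
    split_ifs with hr
    · have hr' : (fun i => r (Q i)) = fun i => p' (Q i) := funext fun i => hr _ ⟨i, rfl⟩
      rw [ov_eq_of_eqOn hr, mul_comm, hr']
    · simp
  -- The image of the basis vector still has the definite values `p` on `Q`, since `G` commutes with
  -- the projection onto them.
  have h2 : G (ket (p, e)) = matUnit E' (Set.range Q) p p (G (ket (p, e))) := by
    rw [← hc, matUnit_ket]
  rw [h2, liftOp_matUnit]
  have h3 : G (QRHL.liftOp E Q A (ket (p, e))) (p', e') =
      matUnit E' (Set.range Q) p' p' (G (QRHL.liftOp E Q A (ket (p, e)))) (p', e') := by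
    rw [matUnit_apply, if_pos fun _ _ => rfl, ov_self]
  rw [h3, ← hc, h1, map_smul, hc]
  simp only [lp.coeFn_smul, Pi.smul_apply, smul_eq_mul]
  rw [matUnit_apply, if_pos fun _ _ => rfl, mul_comm]

/-! #### Local quantum variables -/

/-- `G ⊗ 1` for the saved value of `q`; in the memory, `q` belongs to the other system. -/
def locG (q : S.QVar) (G : L2 (S.QMem × E) →L[ℂ] L2 (S.QMem × E')) :
    L2 (S.QMem × (E × S.qtyp q)) →L[ℂ] L2 (S.QMem × (E' × S.qtyp q)) :=
  pull (swapLocal S E' q).symm.toEmbedding ∘L amplH (S.qtyp q) G ∘L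
    pull (swapLocal S E q).toEmbedding

theorem locG_apply (q : S.QVar) (G : L2 (S.QMem × E) →L[ℂ] L2 (S.QMem × E'))
    (φ : L2 (S.QMem × (E × S.qtyp q))) (p : S.QMem) (e : E') (t : S.qtyp q) :
    locG q G φ (p, (e, t)) = G (locOut E q (p q) φ) (Function.update p q t, e) := by
  have h : sliceFst (p q) (pull (swapLocal S E q).toEmbedding φ) = locOut E q (p q) φ := by
    ext ⟨r, f⟩
    rw [locOut_apply]
    rfl
  rw [← h]
  rfl

theorem locG_le (q : S.QVar) {G : L2 (S.QMem × E) →L[ℂ] L2 (S.QMem × E')} (hG : ‖G‖ ≤ 1)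
    (φ : L2 (S.QMem × (E × S.qtyp q))) : ‖locG q G φ‖ₑ ^ 2 ≤ ‖φ‖ₑ ^ 2 := by
  rw [← enorm_pull_equiv (swapLocal S E q) φ, locG, ContinuousLinearMap.comp_apply,
    enorm_pull_equiv]
  exact enorm_sq_le_of_opNorm (norm_amplH_le G hG) _

theorem locOut_locIn (q : S.QVar) (b : S.qtyp q) (ψ : L2 (S.QMem × E)) :
    locOut E q b (locIn E q ψ) = if b = S.qinit q then ψ else 0 := by
  ext ⟨p, e⟩
  rw [locOut_apply, locIn_apply]
  by_cases h : b = S.qinit q <;> simp [h]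

theorem locG_locIn (q : S.QVar) (G : L2 (S.QMem × E) →L[ℂ] L2 (S.QMem × E'))
    (ψ : L2 (S.QMem × E)) : locG q G (locIn E q ψ) = locIn E' q (G ψ) := by
  ext ⟨p, e, t⟩
  rw [locG_apply, locIn_apply, locOut_locIn]
  split_ifs <;> simp

theorem locOut_locG (q : S.QVar) (b : S.qtyp q) (G : L2 (S.QMem × E) →L[ℂ] L2 (S.QMem × E'))
    (φ : L2 (S.QMem × (E × S.qtyp q))) : locOut E' q b (locG q G φ) = G (locOut E q b φ) := by
  ext ⟨p, e⟩
  rw [locOut_apply, locG_apply]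
  simp

theorem ov_diff_update {V : Type u} {τ : V → Type u} {F : Set V} {q : V} (w p : ∀ v, τ v)
    (t : τ q) : ov (F \ {q}) w (Function.update p q t) = Function.update (ov F w p) q t := by
  funext v
  by_cases hv : v = q
  · subst hv
    rw [ov_of_not_mem (by simp), Function.update_self, Function.update_self]
  · by_cases hF : v ∈ F
    · rw [ov_of_mem (show v ∈ F \ {q} from ⟨hF, hv⟩), Function.update_of_ne hv, ov_of_mem hF]
    · rw [ov_of_not_mem (show v ∉ F \ {q} from fun h => hF h.1), Function.update_of_ne hv, Function.update_of_ne hv,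
        ov_of_not_mem hF]

theorem locOut_matUnit (F : Set S.QVar) (q : S.QVar) (b : S.qtyp q) (u w : S.QMem)
    (φ : L2 (S.QMem × (E × S.qtyp q))) :
    locOut E q b (matUnit _ F u w φ) =
      if q ∈ F then (if b = u q then matUnit E (F \ {q}) u w (locOut E q (w q) φ) else 0)
      else matUnit E (F \ {q}) u w (locOut E q b φ) := by
  ext ⟨p, e⟩
  rw [locOut_apply, matUnit_apply]
  have hF : (∀ r ∈ F, Function.update p q b r = u r) ↔
      (q ∈ F → b = u q) ∧ ∀ r ∈ F \ {q}, p r = u r := by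
    constructor
    · intro h
      refine ⟨fun hq => by simpa using h q hq, fun r hr => ?_⟩
      have := h r hr.1
      rwa [Function.update_of_ne (fun h => hr.2 h)] at this
    · rintro ⟨h1, h2⟩ r hr
      by_cases hrq : r = q
      · subst hrq
        simpa using h1 hr
      · rw [Function.update_of_ne hrq, h2 r ⟨hr, hrq⟩]
  by_cases hq : q ∈ F
  · have hov : ov F w (Function.update p q b) =
        Function.update (ov (F \ {q}) w p) q (w q) := by
      funext v
      by_cases hv : v = q
      · subst hv
        rw [ov_of_mem hq, Function.update_self]
      · by_cases hvF : v ∈ F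
        · rw [ov_of_mem hvF, Function.update_of_ne hv, 
            ov_of_mem (show v ∈ F \ {q} from ⟨hvF, hv⟩)]
        · rw [ov_of_not_mem hvF, Function.update_of_ne hv, Function.update_of_ne hv,
            ov_of_not_mem (show v ∉ F \ {q} from fun h => hvF h.1)]
    rw [if_pos hq, hov]
    by_cases hb : b = u q
    · rw [if_pos hb, matUnit_apply, locOut_apply, ov_of_not_mem (v := q) (by simp)]
      exact if_congr (hF.trans ⟨fun h => h.2, fun h => ⟨fun _ => hb, h⟩⟩) rfl rfl
    · rw [if_neg hb, if_neg fun h => hb ((hF.1 h).1 hq)]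
      rfl
  · have hF' : F \ {q} = F := by simp [hq]
    rw [if_neg hq, matUnit_apply, locOut_apply, hF', ov_of_not_mem hq]
    have h1 : ov F w (Function.update p q b) = Function.update (ov F w p) q b := by
      rw [← ov_diff_update, hF']
    rw [h1]
    simp only [hF, hq, hF', false_implies, true_and]

/-- Inside the scope of `local q`, the variable `q` that `G` acts on has moved to the register. So
`locG q G` commutes with operators on the new `q` even if `G` does not commute with operators on the
old one. -/
theorem Comm.locG {F F' : Set S.QVar} {q : S.QVar}
    {G : L2 (S.QMem × E) →L[ℂ] L2 (S.QMem × E')} (h : Comm F' G) (hF : F \ {q} ⊆ F') :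
    Comm F (locG q G) := by
  intro F₀ hF₀ u w φ
  have hc := h (F₀ \ {q}) ((Set.sdiff_subset_sdiff_left hF₀).trans hF)
  ext ⟨p, e, t⟩
  rw [locG_apply, matUnit_apply, locG_apply, locOut_matUnit]
  by_cases hq : q ∈ F₀
  · rw [if_pos hq, ov_of_mem hq]
    by_cases hp : p q = u q
    · rw [if_pos hp, hc, matUnit_apply, ov_diff_update]
      refine if_congr ⟨fun h r hr => ?_, fun h r hr => ?_⟩ rfl rfl
      · by_cases hrq : r = q
        · rw [hrq, hp]
        · have := h r ⟨hr, hrq⟩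
          rwa [Function.update_of_ne hrq] at this
      · rw [Function.update_of_ne (fun h => hr.2 h)]
        exact h r hr.1
    · rw [if_neg hp, if_neg fun h => hp (h q hq), map_zero]
      rfl
  · have hF' : F₀ \ {q} = F₀ := by simp [hq]
    rw [if_neg hq, hc, matUnit_apply, ov_of_not_mem hq, ov_diff_update]
    refine if_congr ⟨fun h r hr => ?_, fun h r hr => ?_⟩ rfl rfl
    · have hrq : r ≠ q := fun h => hq (h ▸ hr)
      have := h r ⟨hr, hrq⟩
      rwa [Function.update_of_ne hrq] at this
    · rw [Function.update_of_ne (fun h => hr.2 h)]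
      exact h r hr.1

end

section

/-! ### Programs commute with operations on variables that they do not use -/

variable {S : VarSystem.{u}} {E E' : Type u} {k l : ℕ}

/-- The map `|m⟩⟨m| ⊗ A ↦ |h m⟩⟨h m| ⊗ G A G†` if `b m` holds, and `0` otherwise. -/
def theta (b : S.CMem → Prop) (h : S.CMem → S.CMem) (G : L2 (S.QMem × E) →L[ℂ] L2 (S.QMem × E')) :
    Fam S E → Fam S E' :=
  kraus₁ h fun m => if b m then G else 0

/-! ### Filters and operators that commute with program steps -/

section theta

variable {b : S.CMem → Prop} {h : S.CMem → S.CMem} {G : L2 (S.QMem × E) →L[ℂ] L2 (S.QMem × E')}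

theorem theta_good (hG : ‖G‖ ≤ 1) : Good (theta b h G) :=
  kraus₁_good fun m => ite_le (b m) (enorm_sq_le_of_opNorm hG)

theorem theta_pure (hG : ‖G‖ ≤ 1) (m : S.CMem) (ψ : L2 (S.QMem × E)) :
    theta b h G (pure m ψ) = if b m then pure (h m) (G ψ) else 0 := by
  rw [theta, kraus₁_pure fun m => ite_le (b m) (enorm_sq_le_of_opNorm hG)]
  split_ifs
  · rfl
  · exact pure_zero _

/-- On a pure state both sides are sums over the same index set `J`, so it suffices to compare
targets and operators for each `j`. -/
theorem kraus_theta {J : Type u} {t : J → S.CMem → S.CMem}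
    {K : J → S.CMem → Op (S.QMem × E)} {K' : J → S.CMem → Op (S.QMem × E')}
    (hG : ‖G‖ ≤ 1) (hK : ∀ m ψ, ∑' j, ‖K j m ψ‖ₑ ^ 2 ≤ ‖ψ‖ₑ ^ 2)
    (hK' : ∀ m ψ, ∑' j, ‖K' j m ψ‖ₑ ^ 2 ≤ ‖ψ‖ₑ ^ 2)
    (ht : ∀ j m, t j (h m) = h (t j m)) (hb : ∀ j m, b (t j m) ↔ b m)
    (hc : ∀ j m ψ, K' j (h m) (G ψ) = G (K j m ψ)) {ρ : Fam S E} (hρ : IsCQ ρ) :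
    kraus t K' (theta b h G ρ) = theta b h G (kraus t K ρ) := by
  refine Good.ext ((kraus_good hK').comp (theta_good hG)) ((theta_good hG).comp (kraus_good hK))
    (fun m ψ => ?_) hρ
  have h1 := (theta_good (b := b) (h := h) hG).sum (kraus_pure (t := t) hK m ψ)
  refine CQSum.unique (f := fun j => theta b h G (pure (t j m) (K j m ψ))) ?_ h1
  rw [theta_pure hG]
  by_cases hm : b m
  · rw [if_pos hm]
    refine (kraus_pure hK' (h m) (G ψ)).congr fun j => ?_
    rw [theta_pure hG, if_pos ((hb j m).2 hm), ht, hc]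
  · rw [if_neg hm, (kraus_good hK').map_zero]
    have h0 : ∀ j, theta b h G (pure (t j m) (K j m ψ)) = 0 := fun j => by
      rw [theta_pure hG, if_neg fun h' => hm ((hb j m).1 h')]
    simp_rw [h0]
    exact ⟨fun _ => isCQ_zero, by simp [etrF_zero], fun _ => hasSum_zero⟩

theorem restrictFam_theta {t : S.CMem → Prop} (hG : ‖G‖ ≤ 1) (ht : ∀ m, t (h m) ↔ t m)
    {ρ : Fam S E} (hρ : IsCQ ρ) :
    restrictFam t (theta b h G ρ) = theta b h G (restrictFam t ρ) := by
  refine Good.ext ((restrictFam_good t).comp (theta_good hG))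
    ((theta_good hG).comp (restrictFam_good t)) (fun m ψ => ?_) hρ
  rw [theta_pure hG, restrictFam_pure]
  by_cases hm : b m <;> by_cases hm' : t m <;>
    simp [hm, hm', ht, theta_pure hG, restrictFam_pure, (theta_good hG).map_zero,
      (restrictFam_good t).map_zero]

theorem cset₁_theta {b' : S.CMem → Prop} {h' : S.CMem → S.CMem} {x : S.CVar} {u v : S.ctyp x}
    (hG : ‖G‖ ≤ 1) (hb : ∀ n, b' n ↔ b (Function.update n x u))
    (hh : ∀ n, Function.update (h' n) x v = h (Function.update n x u)) {ρ : Fam S E}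
    (hρ : IsCQ ρ) : cset₁ E' x v (theta b' h' G ρ) = theta b h G (cset₁ E x u ρ) := by
  refine Good.ext ((cset₁_good x v).comp (theta_good hG))
    ((theta_good hG).comp (cset₁_good x u)) (fun m ψ => ?_) hρ
  rw [theta_pure hG, cset₁_pure, theta_pure hG]
  by_cases hm : b' m
  · rw [if_pos hm, if_pos ((hb m).1 hm), cset₁_pure, hh]
  · rw [if_neg hm, if_neg fun h' => hm ((hb m).2 h'), (cset₁_good x v).map_zero]

end theta

theorem Good.sum_nat {M N X Y : Type u} {Φ : (M → Op X) → N → Op Y} (h : Good Φ)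
    {f : ℕ → M → Op X} {ρ : M → Op X} (hf : CQSum f ρ) : CQSum (fun i => Φ (f i)) (Φ ρ) :=
  (h.sum (hf.comp_equiv Equiv.ulift.{u})).comp_equiv Equiv.ulift.{u}.symm

/-- The quantum variables that occur in a program. -/
def Ctx.writtenQ {n : ℕ} (c : Ctx S n) : Set S.QVar := {q | Sum.inr q ∈ c.written}

/-- Equality outside the written variables. -/
def Ctx.EqOffWritten {n : ℕ} (c : Ctx S n) (m m' : S.CMem) : Prop :=
  ∀ x, Sum.inl x ∉ c.written → m x = m' x

theorem Expr.eval_ov {α : Type u} (e : Expr S α) {U : Set S.CVar}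
    (hU : ∀ x ∈ U, Sum.inl x ∉ e.fv) (a m : S.CMem) : e.eval (ov U a m) = e.eval m := by
  refine e.dependsOn fun x hx => ov_of_not_mem fun h => hU x h ?_
  exact ⟨x, hx, rfl⟩

theorem updList_ov (X : Fin k ↪ S.CVar) {U : Set S.CVar} (hU : ∀ i, X i ∉ U) (a m : S.CMem)
    (z : ∀ i, S.ctyp (X i)) : updList X (ov U a m) z = ov U a (updList X m z) := by
  funext x
  by_cases hx : x ∈ Set.range X
  · obtain ⟨i, rfl⟩ := hx
    rw [updList_apply_mem, ov_of_not_mem (hU i), updList_apply_mem]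
  · rw [updList_apply_not_mem _ _ _ hx]
    by_cases hxU : x ∈ U
    · rw [ov_of_mem hxU, ov_of_mem hxU]
    · rw [ov_of_not_mem hxU, ov_of_not_mem hxU, updList_apply_not_mem _ _ _ hx]

theorem mem_cset {X : Fin k ↪ S.CVar} {x : S.CVar} :
    (Sum.inl x : S.Var) ∈ Ctx.cset X ↔ x ∈ Set.range X := by
  simp [Ctx.cset]

theorem mem_qset {Q : Fin k ↪ S.QVar} {q : S.QVar} :
    (Sum.inr q : S.Var) ∈ Ctx.qset Q ↔ q ∈ Set.range Q := by
  simp [Ctx.qset]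

theorem eqOff_updList {X : Fin k ↪ S.CVar} {W : Set S.Var} (hW : Ctx.cset X ⊆ W) (m : S.CMem)
    (z : ∀ i, S.ctyp (X i)) (x : S.CVar) (hx : Sum.inl x ∉ W) : updList X m z x = m x :=
  updList_apply_not_mem _ _ _ fun h => hx (hW (mem_cset.2 h))

theorem kraus_theta_qinit (Q : Fin k ↪ S.QVar)
    (e : Expr S {ψ : L2 (∀ i, S.qtyp (Q i)) // ‖ψ‖ = 1}) {b : S.CMem → Prop} {U : Set S.CVar}
    {a : S.CMem} {G : L2 (S.QMem × E) →L[ℂ] L2 (S.QMem × E')} (hG : ‖G‖ ≤ 1)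
    (hU : ∀ x ∈ U, Sum.inl x ∉ e.fv) (hc : Comm (Ctx.writtenQ (n := 0) (.qinit Q e)) G)
    {ρ : Fam S E} (hρ : IsCQ ρ) :
    kraus (fun _ m => m) (fun z m => liftOp E' Q (ketbra (e.eval m).1 z))
        (theta b (ov U a) G ρ) =
      theta b (ov U a) G
        (kraus (fun _ m => m) (fun z m => liftOp E Q (ketbra (e.eval m).1 z)) ρ) := by
  have hc' : ∀ (z : ∀ i, S.qtyp (Q i)) (m : S.CMem) (ψ : L2 (S.QMem × E)),
      liftOp E' Q (ketbra (e.eval (ov U a m)).1 z) (G ψ) =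
        G (liftOp E Q (ketbra (e.eval m).1 z) ψ) := by
    intro z m ψ
    rw [e.eval_ov hU]
    exact (hc.liftOp Q (by rintro _ ⟨i, rfl⟩; exact mem_qset.2 ⟨i, rfl⟩) _ ψ).symm
  exact kraus_theta hG (qinit_le Q e) (qinit_le Q e) (by intros; rfl)
    (by intros; exact Iff.rfl) hc' hρ

/-- The map `theta b (ov U a) G` touches nothing that `c` touches: `b` ignores the written classical
variables, `U` avoids the free variables, and `G` commutes with operators on the written quantum
variables. The register of the output of `G` may differ from that of its input, which allows `G` to
decode a register. The filter `b` and the projections used for `G` serve the frame rule; `U` serves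
overwritten and unused variables. -/
theorem denE_theta : ∀ (c : Prog S) {E E' : Type u} {b : S.CMem → Prop} {U : Set S.CVar}
    {a : S.CMem} {G : L2 (S.QMem × E) →L[ℂ] L2 (S.QMem × E')}, ‖G‖ ≤ 1 →
    (∀ x ∈ U, Sum.inl x ∉ c.fv) → (∀ m m', c.EqOffWritten m m' → (b m ↔ b m')) →
    Comm c.writtenQ G → ∀ {ρ : Fam S E}, IsCQ ρ →
    denE c E' (theta b (ov U a) G ρ) = theta b (ov U a) G (denE c E ρ)
  | .hole i, _, _, _, _, _, _, _, _, _, _, _, _ => i.elim0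
  | .skip, _, _, _, _, _, _, _, _, _, _, _, _ => rfl
  | .assign X e, E, E', b, U, a, G, hG, hU, hb, hc, ρ, hρ => by
      rw [denE_assign, denE_assign]
      refine kraus_theta hG (fun m ψ => by simp) (fun m ψ => by simp) (fun _ m => ?_)
        (fun _ m => hb _ _ ?_) (fun _ _ _ => rfl) hρ
      · rw [e.eval_ov fun x hx h => hU x hx (Or.inr h),
          updList_ov X fun i h => hU _ h (Or.inl (mem_cset.2 ⟨i, rfl⟩))]
      · exact fun x hx => eqOff_updList le_rfl _ _ _ hx
  | .sample X e, E, E', b, U, a, G, hG, hU, hb, hc, ρ, hρ => by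
      rw [denE_sample X e ((theta_good hG).cq hρ), denE_sample X e hρ]
      refine kraus_theta hG (fun m ψ => tsum_sqrtId_le (e.eval m) ψ)
        (fun m ψ => tsum_sqrtId_le (e.eval m) ψ) (fun z m => ?_)
        (fun _ m => hb _ _ ?_) (fun z m ψ => ?_) hρ
      · rw [updList_ov X fun i h => hU _ h (Or.inl (mem_cset.2 ⟨i, rfl⟩))]
      · exact fun x hx => eqOff_updList le_rfl _ _ _ hx
      · rw [e.eval_ov fun x hx h => hU x hx (Or.inr h), sqrtId_apply, sqrtId_apply, map_smul]
  | .qinit Q e, E, E', b, U, a, G, hG, hU, hb, hc, ρ, hρ => by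
      rw [denE_qinit Q e ((theta_good hG).cq hρ), denE_qinit Q e hρ]
      exact kraus_theta_qinit Q e hG (fun x hx h => hU x hx (Or.inr h)) hc hρ
  | .qapply Q e, E, E', b, U, a, G, hG, hU, hb, hc, ρ, hρ => by
      rw [denE_qapply, denE_qapply]
      have hU' : ∀ x ∈ U, Sum.inl x ∉ e.fv := fun x hx h => hU x hx (Or.inr h)
      have hc' : ∀ (z : PUnit) (m : S.CMem) (ψ : L2 (S.QMem × E)),
          liftOp E' Q (e.eval (ov U a m)).toContinuousLinearMap (G ψ) =
            G (liftOp E Q (e.eval m).toContinuousLinearMap ψ) := by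
        intro z m ψ
        rw [e.eval_ov hU']
        exact (hc.liftOp Q (by rintro _ ⟨i, rfl⟩; exact mem_qset.2 ⟨i, rfl⟩) _ ψ).symm
      exact kraus_theta hG (fun m ψ => by simpa using enorm_liftOp_isometry Q (e.eval m) ψ)
        (fun m ψ => by simpa using enorm_liftOp_isometry Q (e.eval m) ψ) (by intros; rfl)
        (by intros; exact Iff.rfl) hc' hρ
  | .measure X Q e, E, E', b, U, a, G, hG, hU, hb, hc, ρ, hρ => by
      rw [denE_measure X Q e ((theta_good hG).cq hρ), denE_measure X Q e hρ]
      refine kraus_theta hG (measure_le X Q e) (measure_le X Q e) (fun z m => ?_)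
        (fun _ m => hb _ _ ?_) (fun z m ψ => ?_) hρ
      · rw [updList_ov X fun i h => hU _ h (Or.inl (Or.inr (mem_cset.2 ⟨i, rfl⟩)))]
      · exact fun x hx => eqOff_updList (Set.subset_union_left) _ _ _ hx
      · rw [e.eval_ov fun x hx h => hU x hx (Or.inr h)]
        exact (hc.liftOp Q
          (by rintro _ ⟨i, rfl⟩; exact Or.inr (mem_qset.2 ⟨i, rfl⟩)) _ ψ).symm
  | .seq c d, E, E', b, U, a, G, hG, hU, hb, hc, ρ, hρ => by
      have h1 := denE_theta c (a := a) hG (fun x hx h => hU x hx (Or.inl h))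
        (fun m m' h => hb m m' fun x hx => h x fun h' => hx (Or.inl h'))
        (hc.mono fun q hq => Or.inl hq) hρ
      have h2 := denE_theta d (a := a) hG (fun x hx h => hU x hx (Or.inr h))
        (fun m m' h => hb m m' fun x hx => h x fun h' => hx (Or.inr h'))
        (hc.mono fun q hq => Or.inr hq) ((denE_good c E).cq hρ)
      change denE d E' (denE c E' _) = _
      rw [h1, h2]
      rfl
  | .ite e c d, E, E', b, U, a, G, hG, hU, hb, hc, ρ, hρ => by
      refine Good.ext ((denE_good _ _).comp (theta_good hG))
        ((theta_good hG).comp (denE_good _ _)) (fun m ψ => ?_) hρ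
      have h1 := denE_theta c (a := a) hG (fun x hx h => hU x hx (Or.inl (Or.inr h)))
        (fun m m' h => hb m m' fun x hx => h x fun h' => hx (Or.inl h'))
        (hc.mono fun q hq => Or.inl hq) (isCQ_pure m ψ)
      have h2 := denE_theta d (a := a) hG (fun x hx h => hU x hx (Or.inr h))
        (fun m m' h => hb m m' fun x hx => h x fun h' => hx (Or.inr h'))
        (hc.mono fun q hq => Or.inr hq) (isCQ_pure m ψ)
      rw [denE_ite_pure]
      by_cases he : (e.eval m).down = true
      · rw [if_pos he, ← h1, theta_pure hG]
        split_ifs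
        · rw [denE_ite_pure, e.eval_ov fun x hx h => hU x hx (Or.inl (Or.inl h)), if_pos he]
        · rw [(denE_good _ _).map_zero, (denE_good _ _).map_zero]
      · rw [if_neg he, ← h2, theta_pure hG]
        split_ifs
        · rw [denE_ite_pure, e.eval_ov fun x hx h => hU x hx (Or.inl (Or.inl h)), if_neg he]
        · rw [(denE_good _ _).map_zero, (denE_good _ _).map_zero]
  | .whileLoop e c, E, E', b, U, a, G, hG, hU, hb, hc, ρ, hρ => by
      have he : ∀ m, e.eval (ov U a m) = e.eval m :=
        e.eval_ov (fun x hx h => hU x hx (Or.inl h)) a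
      have h1 : ∀ {σ : Fam S E}, IsCQ σ →
          loopStep e c E' (theta b (ov U a) G σ) = theta b (ov U a) G (loopStep e c E σ) := by
        intro σ hσ
        rw [loopStep, restrictFam_theta hG (fun m => by rw [he]) hσ]
        exact denE_theta c hG (fun x hx h => hU x hx (Or.inr h)) hb hc ((restrictFam_good _).cq hσ)
      have h2 : ∀ i, (loopStep e c E')^[i] (theta b (ov U a) G ρ) =
          theta b (ov U a) G ((loopStep e c E)^[i] ρ) := by
        intro i
        induction i with
        | zero => rfl
        | succ i ih =>
          rw [Function.iterate_succ_apply', Function.iterate_succ_apply', ih,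
            h1 ((iterate_good (loopStep_good e (denE_good c E)) i).cq hρ)]
      have h3 := (theta_good (b := b) (h := ov U a) hG).sum_nat (denE_while_cqSum e c hρ)
      refine (denE_while_cqSum e c ((theta_good hG).cq hρ)).unique (h3.congr fun i => ?_)
      rw [loopExit, loopExit, h2, restrictFam_theta hG (fun m => by rw [he])
        ((iterate_good (loopStep_good e (denE_good c E)) i).cq hρ)]
  | .loc (.inl x) c, E, E', b, U, a, G, hG, hU, hb, hc, ρ, hρ => by
      refine Good.ext ((denE_good _ _).comp (theta_good hG))
        ((theta_good hG).comp (denE_good _ _)) (fun m ψ => ?_) hρ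
      have hU' : ∀ y ∈ U \ {x}, Sum.inl y ∉ c.fv := fun y hy h =>
        hU y hy.1 ⟨h, fun h' => hy.2 (Sum.inl_injective h')⟩
      have hb' : ∀ n n', c.EqOffWritten n n' →
          (b (Function.update n x (m x)) ↔ b (Function.update n' x (m x))) := by
        intro n n' hn
        refine hb _ _ fun y hy => ?_
        by_cases hyx : y = x
        · subst hyx; simp
        · rw [Function.update_of_ne hyx, Function.update_of_ne hyx]
          exact hn y fun h => hy ⟨h, fun h' => hyx (Sum.inl_injective h')⟩
      have hc' : Comm c.writtenQ G := hc.mono fun q hq => ⟨hq, by simp⟩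
      -- The filter concerns the memory after `x` has been restored. In the scope it is therefore
      -- evaluated with the saved value `m x` in place of the local one, and `x` is removed from
      -- `U`.
      have h1 := denE_theta c (b := fun n => b (Function.update n x (m x))) (a := a) hG hU' hb' hc'
        (isCQ_pure (Function.update m x (S.cinit x)) ψ)
      -- If `x ∈ U`, the value restored on the transformed side is `a x`, not `m x`; hence `v := ov
      -- U a m x`.
      have h2 := cset₁_theta (b := b) (b' := fun n => b (Function.update n x (m x)))
        (h := ov U a) (h' := ov (U \ {x}) a) (x := x) (u := m x) (v := ov U a m x) hG
        (fun n => Iff.rfl) (fun n => by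
          funext y
          by_cases hyx : y = x
          · subst hyx
            by_cases hyU : y ∈ U <;> simp [ov, hyU]
          · by_cases hyU : y ∈ U <;> simp [ov, hyU, hyx])
        ((denE_good c E).cq (isCQ_pure (Function.update m x (S.cinit x)) ψ))
      rw [denE_loc_inl_pure, ← h2, ← h1, theta_pure hG, theta_pure hG, Function.update_idem,
        Function.update_eq_self]
      split_ifs
      · rw [denE_loc_inl_pure, ov_diff_update]
      · rw [(denE_good _ _).map_zero, (denE_good _ _).map_zero, (cset₁_good _ _).map_zero]
  | .loc (.inr q) c, E, E', b, U, a, G, hG, hU, hb, hc, ρ, hρ => by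
      have hG' : ‖locG q G‖ ≤ 1 := opNorm_le_one_of_enorm (locG_le q hG)
      have hc' : Comm c.writtenQ (locG q G) :=
        hc.locG fun r hr => ⟨hr.1, fun h => hr.2 (Sum.inr_injective h)⟩
      have h0 : IsCQ (kraus₁ (fun m => m) (fun _ => locIn E q) ρ) :=
        (kraus₁_good fun _ ψ => locIn_le q ψ).cq hρ
      have h1 : kraus₁ (fun m => m) (fun _ => locIn E' q) (theta b (ov U a) G ρ) =
          theta b (ov U a) (locG q G) (kraus₁ (fun m => m) (fun _ => locIn E q) ρ) := by
        refine Good.ext ((kraus₁_good fun _ ψ => locIn_le q ψ).comp (theta_good hG))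
          ((theta_good hG').comp (kraus₁_good fun _ ψ => locIn_le q ψ)) (fun m ψ => ?_) hρ
        rw [theta_pure hG, kraus₁_pure (fun _ ψ => locIn_le q ψ), theta_pure hG']
        split_ifs
        · rw [kraus₁_pure (fun _ ψ => locIn_le q ψ), locG_locIn]
        · exact (kraus₁_good fun _ ψ => locIn_le q ψ).map_zero
      have h2 := denE_theta c (b := b) (U := U) (a := a) hG'
        (fun x hx h => hU x hx ⟨h, by simp⟩)
        (fun m m' h => hb m m' fun x hx => h x fun h' => hx ⟨h', by simp⟩) hc' h0
      have h3 : ∀ {σ : Fam S (E × S.qtyp q)}, IsCQ σ →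
          kraus (fun _ m => m) (fun b _ => locOut E' q b) (theta b (ov U a) (locG q G) σ) =
          theta b (ov U a) G (kraus (fun _ m => m) (fun b _ => locOut E q b) σ) := by
        intro σ hσ
        refine Good.ext ((kraus_good fun _ ψ => tsum_locOut_le q ψ).comp (theta_good hG'))
          ((theta_good hG).comp (kraus_good fun _ ψ => tsum_locOut_le q ψ)) (fun m ψ => ?_) hσ
        have h4 := (theta_good (b := b) (h := ov U a) hG).sum (kraus_pure
          (t := fun _ m => m) (K := fun b _ => locOut E q b) (fun _ ψ => tsum_locOut_le q ψ) m ψ)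
        refine CQSum.unique ?_ h4
        rw [theta_pure hG']
        by_cases hm : b m
        · rw [if_pos hm]
          refine (kraus_pure (fun _ ψ => tsum_locOut_le q ψ) _ _).congr fun y => ?_
          rw [theta_pure hG, if_pos hm, locOut_locG]
        · rw [if_neg hm, (kraus_good fun _ ψ => tsum_locOut_le q ψ).map_zero]
          simp_rw [theta_pure hG, if_neg hm]
          exact ⟨fun _ => isCQ_zero, by simp [etrF_zero], fun _ => hasSum_zero⟩
      rw [denE_loc_inr, denE_loc_inr, h1, h2, h3 ((denE_good c _).cq h0)]

/-! ### Overwritten variables -/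

theorem ov_union_split {V : Type u} {τ : V → Type u} (U U₁ : Set V) (hU : U₁ ⊆ U)
    (a m : ∀ v, τ v) : ov U a m = ov U₁ a (ov (U \ U₁) a m) := by
  funext v
  by_cases h1 : v ∈ U₁
  · simp [ov, h1, hU h1]
  · by_cases h2 : v ∈ U <;> simp [ov, h1, h2]

theorem updList_ov_of_subset (X : Fin k ↪ S.CVar) {U : Set S.CVar} (hU : U ⊆ Set.range X)
    (a m : S.CMem) (z : ∀ i, S.ctyp (X i)) : updList X (ov U a m) z = updList X m z := by
  funext x
  by_cases hx : x ∈ Set.range X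
  · obtain ⟨i, rfl⟩ := hx
    rw [updList_apply_mem, updList_apply_mem]
  · rw [updList_apply_not_mem _ _ _ hx, updList_apply_not_mem _ _ _ hx,
      ov_of_not_mem fun h => hx (hU h)]

/-- In a sequence `c; d`, the set `U` splits into the variables that `c` overwrites and the rest.
The rest does not occur in `c`, so its change is carried through `c` by `denE_theta` with the
identity operator, and is then absorbed by `d`. -/
theorem denE_overwr : ∀ (c : Prog S) {E : Type u} {U : Set S.CVar} (a : S.CMem),
    (∀ x ∈ U, Sum.inl x ∈ c.overwr) → ∀ m (ψ : L2 (S.QMem × E)),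
    denE c E (pure (ov U a m) ψ) = denE c E (pure m ψ)
  | .hole i, _, _, _, _, _, _ => i.elim0
  | .skip, _, _, _, hU, m, ψ => by
      rw [ov_eq_of_eqOn fun x hx => (hU x hx).elim]
  | .assign X e, _, _, _, hU, m, ψ => by
      rw [denE_assign, denE_assign, kraus₁_pure (fun _ => id_le), kraus₁_pure (fun _ => id_le),
        e.eval_ov (fun x hx => (hU x hx).2),
        updList_ov_of_subset X (fun x hx => mem_cset.1 (hU x hx).1)]
  | .sample X e, E, U, a, hU, m, ψ => by
      rw [denE_sample X e (isCQ_pure _ _), denE_sample X e (isCQ_pure _ _)]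
      have hK := fun m ψ => tsum_sqrtId_le (X := S.QMem × E) (e.eval m) ψ
      refine (kraus_pure hK _ _).unique ((kraus_pure hK _ _).congr fun z => ?_)
      rw [e.eval_ov (fun x hx => (hU x hx).2),
        updList_ov_of_subset X (fun x hx => mem_cset.1 (hU x hx).1)]
  | .qinit Q e, _, _, _, hU, m, ψ => by
      rw [ov_eq_of_eqOn fun x hx => by simpa [Ctx.qset] using show _ ∈ Ctx.qset Q from hU x hx]
  | .qapply Q e, _, _, _, hU, m, ψ => by
      rw [ov_eq_of_eqOn fun x hx => (hU x hx).elim]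
  | .measure X Q e, E, U, a, hU, m, ψ => by
      rw [denE_measure X Q e (isCQ_pure _ _), denE_measure X Q e (isCQ_pure _ _)]
      have hK := measure_le (E := E) X Q e
      refine (kraus_pure hK _ _).unique ((kraus_pure hK _ _).congr fun z => ?_)
      rw [e.eval_ov (fun x hx => (hU x hx).2),
        updList_ov_of_subset X (fun x hx => mem_cset.1 (hU x hx).1)]
  | .ite e c d, _, _, a, hU, m, ψ => by
      rw [denE_ite_pure, denE_ite_pure, e.eval_ov (fun x hx => (hU x hx).2),
        denE_overwr c a (fun x hx => (hU x hx).1.1), denE_overwr d a (fun x hx => (hU x hx).1.2)]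
  | .whileLoop e c, _, _, _, hU, m, ψ => by
      rw [ov_eq_of_eqOn fun x hx => (hU x hx).elim]
  | .seq c d, E, U, a, hU, m, ψ => by
      have hid : ‖ContinuousLinearMap.id ℂ (L2 (S.QMem × E))‖ ≤ 1 :=
        opNorm_le_one_of_enorm id_le
      set U₁ : Set S.CVar := {x ∈ U | Sum.inl x ∈ c.overwr} with hU₁
      have h2 : ∀ x ∈ U \ U₁, Sum.inl x ∈ d.overwr ∧ Sum.inl x ∉ c.fv := by
        intro x hx
        rcases hU x hx.1 with h | h
        · exact absurd ⟨hx.1, h⟩ hx.2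
        · exact h.1
      have h3 := denE_theta c (E := E) (b := fun _ => True) (a := a) hid
        (fun x hx => (h2 x hx).2) (fun _ _ _ => Iff.rfl) (comm_id _) (isCQ_pure m ψ)
      rw [theta_pure hid, if_pos trivial] at h3
      change denE d E (denE c E _) = denE d E (denE c E _)
      rw [ov_union_split U U₁ (fun x hx => hx.1), denE_overwr c a (fun x hx => hx.2)]
      erw [h3]
      refine Good.ext ((denE_good d E).comp (theta_good hid)) (denE_good d E) (fun n φ => ?_)
        ((denE_good c E).cq (isCQ_pure m ψ))
      rw [theta_pure hid, if_pos trivial, ← denE_overwr d a (fun x hx => (h2 x hx).1) n φ]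
      rfl
  | .loc (.inl x) c, E, U, a, hU, m, ψ => by
      have hx : x ∉ U := fun h => (hU x h).2 rfl
      rw [denE_loc_inl_pure, denE_loc_inl_pure, ov_of_not_mem hx]
      have : Function.update (ov U a m) x (S.cinit x) =
          ov U a (Function.update m x (S.cinit x)) := by
        rw [← ov_diff_update, Set.sdiff_singleton_eq_self hx]
      rw [this, denE_overwr c a (fun x hx => (hU x hx).1)]
  | .loc (.inr q) c, E, U, a, hU, m, ψ => by
      rw [denE_loc_inr_pure, denE_loc_inr_pure, denE_overwr c a (fun x hx => (hU x hx).1)]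

end

section

/-! ### Couplings -/

variable {S : VarSystem.{u}} {E E' : Type u} {k l : ℕ} {M N X Y : Type u}

/-- `ρ` and `σ` are sums of pure states that are related by `G` term by term. -/
def Cpl (G : M → L2 X → M → L2 X → Prop) (ρ σ : M → Op X) : Prop :=
  ∃ (ι : Type u) (m₁ m₂ : ι → M) (ψ₁ ψ₂ : ι → L2 X), (∀ i, G (m₁ i) (ψ₁ i) (m₂ i) (ψ₂ i)) ∧
    CQSum (fun i => pure (m₁ i) (ψ₁ i)) ρ ∧ CQSum (fun i => pure (m₂ i) (ψ₂ i)) σ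

/-! ### Composition of couplings -/

namespace Cpl

variable {G : M → L2 X → M → L2 X → Prop} {H : N → L2 Y → N → L2 Y → Prop} {ρ σ : M → Op X}

theorem zero : Cpl G 0 0 :=
  ⟨PEmpty, PEmpty.elim, PEmpty.elim, PEmpty.elim, PEmpty.elim, fun i => i.elim, CQSum.empty _,
    CQSum.empty _⟩

theorem pure {m₁ m₂ : M} {ψ₁ ψ₂ : L2 X} (h : G m₁ ψ₁ m₂ ψ₂) :
    Cpl G (QRHL.pure m₁ ψ₁) (QRHL.pure m₂ ψ₂) :=
  ⟨PUnit, fun _ => m₁, fun _ => m₂, fun _ => ψ₁, fun _ => ψ₂, fun _ => h,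
    CQSum.const (isCQ_pure _ _), CQSum.const (isCQ_pure _ _)⟩

theorem mono {G' : M → L2 X → M → L2 X → Prop} (h : Cpl G ρ σ)
    (hG : ∀ m₁ ψ₁ m₂ ψ₂, G m₁ ψ₁ m₂ ψ₂ → G' m₁ ψ₁ m₂ ψ₂) : Cpl G' ρ σ := by
  obtain ⟨ι, m₁, m₂, ψ₁, ψ₂, h0, h1, h2⟩ := h
  exact ⟨ι, m₁, m₂, ψ₁, ψ₂, fun i => hG _ _ _ _ (h0 i), h1, h2⟩

theorem sum {ι : Type u} {f g : ι → M → Op X} (h : ∀ i, Cpl G (f i) (g i)) (hf : CQSum f ρ)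
    (hg : CQSum g σ) : Cpl G ρ σ := by
  choose κ m₁ m₂ ψ₁ ψ₂ h0 h1 h2 using h
  exact ⟨Σ i, κ i, fun p => m₁ p.1 p.2, fun p => m₂ p.1 p.2, fun p => ψ₁ p.1 p.2,
    fun p => ψ₂ p.1 p.2, fun p => h0 p.1 p.2, hf.sigma h1, hg.sigma h2⟩

theorem sum_nat {f g : ℕ → M → Op X} (h : ∀ i, Cpl G (f i) (g i)) (hf : CQSum f ρ)
    (hg : CQSum g σ) : Cpl G ρ σ :=
  sum (fun i : ULift.{u} ℕ => h i.down) (hf.comp_equiv Equiv.ulift) (hg.comp_equiv Equiv.ulift)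

theorem bind {Φ Ψ : (M → Op X) → N → Op Y} (hΦ : Good Φ) (hΨ : Good Ψ) (h : Cpl G ρ σ)
    (hG : ∀ m₁ ψ₁ m₂ ψ₂, G m₁ ψ₁ m₂ ψ₂ →
      Cpl H (Φ (QRHL.pure m₁ ψ₁)) (Ψ (QRHL.pure m₂ ψ₂))) : Cpl H (Φ ρ) (Ψ σ) := by
  obtain ⟨ι, m₁, m₂, ψ₁, ψ₂, h0, h1, h2⟩ := h
  exact sum (fun i => hG _ _ _ _ (h0 i)) (hΦ.sum h1) (hΨ.sum h2)

/-- Related vectors have equal norm, so they vanish together and can be dropped together. Nonzero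
terms are needed to divide by norms and to conclude that a predicate on a product vector really
holds. -/
theorem ne_zero (h : Cpl G ρ σ) (hn : ∀ m₁ ψ₁ m₂ ψ₂, G m₁ ψ₁ m₂ ψ₂ → ‖ψ₁‖ = ‖ψ₂‖) :
    Cpl (fun m₁ ψ₁ m₂ ψ₂ => G m₁ ψ₁ m₂ ψ₂ ∧ ψ₁ ≠ 0 ∧ ψ₂ ≠ 0) ρ σ := by
  obtain ⟨ι, m₁, m₂, ψ₁, ψ₂, h0, h1, h2⟩ := h
  have hz : ∀ i, ψ₂ i = 0 ↔ ψ₁ i = 0 := fun i => by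
    rw [← norm_eq_zero, ← norm_eq_zero (a := ψ₁ i), hn _ _ _ _ (h0 i)]
  refine ⟨{i // ψ₁ i ≠ 0}, fun i => m₁ i, fun i => m₂ i, fun i => ψ₁ i, fun i => ψ₂ i,
    fun i => ⟨h0 i, i.2, fun h => i.2 ((hz _).1 h)⟩, ?_, ?_⟩
  · refine h1.comp_injective Subtype.val_injective fun i hi => ?_
    have : ψ₁ i = 0 := by
      by_contra h
      exact hi ⟨⟨i, h⟩, rfl⟩
    rw [this, pure_zero]
  · refine h2.comp_injective Subtype.val_injective fun i hi => ?_
    have : ψ₁ i = 0 := by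
      by_contra h
      exact hi ⟨⟨i, h⟩, rfl⟩
    rw [(hz i).2 this, pure_zero]

end Cpl

/-! ### Equality of registers -/

/-- The laws of a rectangular band: `X` is a product, and `mix x y` combines the first component
of `x` with the second component of `y`. -/
structure RectBand (mix : X → X → X) : Prop where
  self : ∀ x, mix x x = x
  left : ∀ x y z, mix (mix x y) z = mix x z
  right : ∀ x y z, mix x (mix y z) = mix x z

/-- The second components of `ψ₁` and `ψ₂` are in the same state. -/
def Rel (mix : X → X → X) (ψ₁ ψ₂ : L2 X) : Prop :=
  ∀ x y, ψ₁ x * ψ₂ y = ψ₁ (mix x y) * ψ₂ (mix y x)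

/-- The operator `K` acts on the second component. -/
def Loc (mix : X → X → X) (K : Op X) : Prop :=
  ∀ ψ₁ ψ₂, Rel mix ψ₁ ψ₂ → ∀ x y, K ψ₁ x * ψ₂ y = ψ₁ (mix x y) * K ψ₂ (mix y x)

/-! ### Swap invariance of product vectors in coordinates -/

section Rel

variable {mix : X → X → X} {ψ₁ ψ₂ : L2 X} {K : Op X}

theorem Rel.symm (h : Rel mix ψ₁ ψ₂) : Rel mix ψ₂ ψ₁ := fun x y => by
  rw [mul_comm, h y x, mul_comm]

theorem Rel.smul (h : Rel mix ψ₁ ψ₂) (a b : ℂ) : Rel mix (a • ψ₁) (b • ψ₂) := fun x y => by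
  have := h x y
  simp only [lp.coeFn_smul, Pi.smul_apply, smul_eq_mul]
  linear_combination a * b * this

theorem rel_zero_left : Rel mix 0 ψ₂ := fun x y => by simp

theorem rel_zero_right : Rel mix ψ₁ 0 := fun x y => by simp

/-- Fixing a coordinate `x₀` with `ψ₁ x₀ ≠ 0` in the defining equation shows that `K ψ₂` is `ψ₂` in
the first component times a function of the second component, which is a multiple of `K ψ₁`. The
same holds with the roles exchanged, and substituting one description into the other gives the
symmetry. -/
theorem Loc.rel (hm : RectBand mix) (hK : Loc mix K) (h : Rel mix ψ₁ ψ₂) :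
    Rel mix (K ψ₁) (K ψ₂) := by
  by_cases h1 : ψ₁ = 0
  · rw [h1, map_zero]; exact rel_zero_left
  by_cases h2 : ψ₂ = 0
  · rw [h2, map_zero]; exact rel_zero_right
  obtain ⟨x₀, hx⟩ : ∃ x, ψ₁ x ≠ 0 := by
    by_contra hc
    push Not at hc
    exact h1 (by ext x; simpa using hc x)
  obtain ⟨y₀, hy⟩ : ∃ x, ψ₂ x ≠ 0 := by
    by_contra hc
    push Not at hc
    exact h2 (by ext x; simpa using hc x)
  have k1 := hK _ _ h
  have k2 := hK _ _ h.symm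
  have e2 : ∀ y, K ψ₂ y = ψ₂ (mix y x₀) * (K ψ₁ (mix x₀ y) / ψ₁ x₀) := fun y => by
    rw [← mul_div_assoc, eq_div_iff hx]
    exact k2 y x₀
  have e1 : ∀ x, K ψ₁ x = ψ₁ (mix x y₀) * (K ψ₂ (mix y₀ x) / ψ₂ y₀) := fun x => by
    rw [← mul_div_assoc, eq_div_iff hy]
    exact k1 x y₀
  intro x y
  rw [e1 x, e1 (mix x y), hm.left, hm.right, e2 y, e2 (mix y x), e2 (mix y₀ x), e2 (mix y₀ y)]
  simp only [hm.left, hm.right]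
  ring

/-- Swapping the second components is an involution of the basis of the product space, and it
carries `ψ₁ ⊗ K ψ₂` to `K ψ₁ ⊗ ψ₂`. -/
theorem Loc.norm (hm : RectBand mix) (hK : Loc mix K) (h : Rel mix ψ₁ ψ₂) :
    ‖K ψ₁‖ * ‖ψ₂‖ = ‖ψ₁‖ * ‖K ψ₂‖ := by
  rw [← norm_tens, ← norm_tens]
  let σ : X × X ≃ X × X :=
    { toFun := fun p => (mix p.1 p.2, mix p.2 p.1)
      invFun := fun p => (mix p.1 p.2, mix p.2 p.1)
      left_inv := fun p => by simp [hm.left, hm.right, hm.self]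
      right_inv := fun p => by simp [hm.left, hm.right, hm.self] }
  have : tens (K ψ₁) ψ₂ = pull σ.toEmbedding (tens ψ₁ (K ψ₂)) := by
    ext p
    simp only [tens_apply, pull_apply]
    exact hK _ _ h p.1 p.2
  rw [this]
  exact norm_eq_of_enorm_sq (enorm_pull_equiv σ _)

end Rel

/-- Combining memory and register: the quantum variables in `V` are taken from `y`. -/
def mixX (V : Set S.Var) (μ : E → E → E) (x y : S.QMem × E) : S.QMem × E :=
  (ov {q | Sum.inr q ∈ V} y.1 x.1, μ x.2 y.2)

theorem RectBand.mixX {μ : E → E → E} (hμ : RectBand μ) (V : Set S.Var) :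
    RectBand (mixX V μ) where
  self x := Prod.ext ov_self (hμ.self _)
  left x y z := Prod.ext (by
    funext q; by_cases h : Sum.inr q ∈ V <;> simp [QRHL.mixX, ov, h]) (hμ.left _ _ _)
  right x y z := Prod.ext (by
    funext q; by_cases h : Sum.inr q ∈ V <;> simp [QRHL.mixX, ov, h]) (hμ.right _ _ _)

theorem mixX_congr {V W : Set S.Var} (h : ∀ q, Sum.inr q ∈ V ↔ Sum.inr q ∈ W)
    (μ : E → E → E) : mixX V μ = mixX W μ := by
  funext x y
  simp [mixX, h]

/-- An operator on equal quantum variables. -/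
theorem loc_liftOp {V : Set S.Var} {μ : E → E → E} (Q : Fin k ↪ S.QVar)
    (hQ : ∀ i, Sum.inr (Q i) ∈ V) (A : Op (∀ i, S.qtyp (Q i))) :
    Loc (mixX V μ) (liftOp E Q A) := by
  rintro ψ₁ ψ₂ h ⟨p, e⟩ ⟨p', e'⟩
  have h1 : mixX V μ (p', e') (p, e) = (ov {q | Sum.inr q ∈ V} p p', μ e' e) := rfl
  rw [h1, liftOp_apply, liftOp_apply]
  -- As functions of the values on `Q`, the slices of the two vectors are proportional. Applying the
  -- linear operator `A` to this identity gives the claim.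
  have h2 : ψ₂ (p', e') • qslice Q p e ψ₁ = ψ₁ (mixX V μ (p, e) (p', e')) •
      qslice Q (ov {q | Sum.inr q ∈ V} p p') (μ e' e) ψ₂ := by
    ext z
    have h3 := h (updList Q p z, e) (p', e')
    simp only [lp.coeFn_smul, Pi.smul_apply, smul_eq_mul, qslice_apply]
    rw [mul_comm, h3]
    congr 1
    · refine congrArg _ (Prod.ext ?_ rfl)
      funext q
      by_cases hq : Sum.inr q ∈ V
      · simp [mixX, ov, hq]
      · have : q ∉ Set.range Q := by rintro ⟨i, rfl⟩; exact hq (hQ i)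
        simp [mixX, ov, hq, updList_apply_not_mem _ _ _ this]
    · refine congrArg _ (Prod.ext ?_ rfl)
      funext q
      by_cases hr : q ∈ Set.range Q
      · obtain ⟨i, rfl⟩ := hr
        simp [mixX, ov, hQ i, updList_apply_mem]
      · by_cases hq : Sum.inr q ∈ V <;> simp [mixX, ov, hq, updList_apply_not_mem _ _ _ hr]
  have h4 := congrArg (fun φ => A φ fun i => p (Q i)) h2
  simp only [map_smul, lp.coeFn_smul, Pi.smul_apply, smul_eq_mul] at h4
  rw [mul_comm, h4]
  congr 1
  refine congrArg _ ?_
  funext i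
  exact (ov_of_mem (show Q i ∈ {q | Sum.inr q ∈ V} from hQ i)).symm

/-! ### Related pairs of states -/

/-- Two pure states with a register satisfy the predicate `R`. -/
def InPred (R : QPred S) (m₁ : S.CMem) (ψ₁ : L2 (S.QMem × E)) (m₂ : S.CMem)
    (ψ₂ : L2 (S.QMem × E)) : Prop :=
  ∀ e₁ e₂, tens (sliceFst e₁ ψ₁) (sliceFst e₂ ψ₂) ∈ R m₁ m₂

/-- Two pure states of the same norm satisfy `R ⊓ eqv V`, and the parts of the register that are
determined by `μ` are equal. -/
structure PairGood (R : QPred S) (V : Set S.Var) (μ : E → E → E) (m₁ : S.CMem)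
    (ψ₁ : L2 (S.QMem × E)) (m₂ : S.CMem) (ψ₂ : L2 (S.QMem × E)) : Prop where
  norm : ‖ψ₁‖ = ‖ψ₂‖
  cl : ∀ x, Sum.inl x ∈ V → m₁ x = m₂ x
  rel : Rel (mixX V μ) ψ₁ ψ₂
  pred : InPred R m₁ ψ₁ m₂ ψ₂

theorem PairGood.top {R : QPred S} {V : Set S.Var} {μ : E → E → E} {m₁ m₂ : S.CMem}
    {ψ₁ ψ₂ : L2 (S.QMem × E)} (h : PairGood R V μ m₁ ψ₁ m₂ ψ₂) : PairGood ⊤ V μ m₁ ψ₁ m₂ ψ₂ :=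
  ⟨h.norm, h.cl, h.rel, fun _ _ => trivial⟩

/-- Only classical variables can be dropped from `V`. Two copies of an entangled state are invariant
under swapping all its variables, but not under swapping some of them. -/
theorem PairGood.weaken {R : QPred S} {V W : Set S.Var} {μ : E → E → E} {m₁ m₂ : S.CMem}
    {ψ₁ ψ₂ : L2 (S.QMem × E)} (h : PairGood R V μ m₁ ψ₁ m₂ ψ₂) (hW : W ⊆ V)
    (hq : ∀ q, Sum.inr q ∈ V → Sum.inr q ∈ W) : PairGood R W μ m₁ ψ₁ m₂ ψ₂ :=
  ⟨h.norm, fun x hx => h.cl x (hW hx),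
    mixX_congr (V := V) (W := W) (fun q => ⟨hq q, fun h => hW h⟩) μ ▸ h.rel, h.pred⟩

theorem PairGood.loc {V W : Set S.Var} {μ : E → E → E} {m₁ m₂ n₁ n₂ : S.CMem}
    {ψ₁ ψ₂ : L2 (S.QMem × E)} {K : Op (S.QMem × E)} (hμ : RectBand μ)
    (h : PairGood ⊤ V μ m₁ ψ₁ m₂ ψ₂) (h0 : ψ₁ ≠ 0) (hK : Loc (mixX V μ) K)
    (hn : ∀ x, Sum.inl x ∈ W → n₁ x = n₂ x) (hq : ∀ q, Sum.inr q ∈ V ↔ Sum.inr q ∈ W) :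
    PairGood ⊤ W μ n₁ (K ψ₁) n₂ (K ψ₂) := by
  refine ⟨?_, hn, mixX_congr hq μ ▸ hK.rel (hμ.mixX V) h.rel, fun _ _ => trivial⟩
  -- The two inputs have the same nonzero norm; cancelling it leaves equality of the norms of the
  -- outputs.
  have h1 := hK.norm (hμ.mixX V) h.rel
  rw [← h.norm, mul_comm] at h1
  exact mul_left_cancel₀ (norm_ne_zero_iff.2 h0) h1

/-- `{R ⊓ eqv Vin} c ~ d {R ⊓ eqv Vout}` for pure states with a register. -/
def XJ (R : QPred S) (Vin Vout : Set S.Var) (c d : Prog S) : Prop :=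
  ∀ (E : Type u) (μ : E → E → E), RectBand μ → ∀ m₁ ψ₁ m₂ ψ₂, ψ₁ ≠ 0 → ψ₂ ≠ 0 →
    PairGood R Vin μ m₁ ψ₁ m₂ ψ₂ →
    Cpl (PairGood R Vout μ) (denE c E (pure m₁ ψ₁)) (denE d E (pure m₂ ψ₂))

theorem XJ.bind {R : QPred S} {Vin Vout : Set S.Var} {c d : Prog S} (h : XJ R Vin Vout c d)
    {μ : E → E → E} (hμ : RectBand μ) {ρ σ : Fam S E} (hρ : Cpl (PairGood R Vin μ) ρ σ) :
    Cpl (PairGood R Vout μ) (denE c E ρ) (denE d E σ) :=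
  (hρ.ne_zero fun _ _ _ _ h => h.norm).bind (denE_good c E) (denE_good d E)
    fun _ _ _ _ hG => h E μ hμ _ _ _ _ hG.2.1 hG.2.2 hG.1

theorem XJ.seq {R : QPred S} {V₁ V₂ V₃ : Set S.Var} {c d c' d' : Prog S} (h : XJ R V₁ V₂ c c')
    (h' : XJ R V₂ V₃ d d') : XJ R V₁ V₃ (.seq c d) (.seq c' d') :=
  fun E μ hμ _ _ _ _ h1 h2 hG => h'.bind hμ (h E μ hμ _ _ _ _ h1 h2 hG)

theorem XJ.weaken {R : QPred S} {V₁ V₂ W₁ W₂ : Set S.Var} {c d : Prog S} (h : XJ R V₁ V₂ c d)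
    (h1 : V₁ ⊆ W₁) (h1' : ∀ q, Sum.inr q ∈ W₁ → Sum.inr q ∈ V₁) (h2 : W₂ ⊆ V₂)
    (h2' : ∀ q, Sum.inr q ∈ V₂ → Sum.inr q ∈ W₂) : XJ R W₁ W₂ c d :=
  fun E μ hμ _ _ _ _ h3 h4 hG => (h E μ hμ _ _ _ _ h3 h4 (hG.weaken h1 h1')).mono
    fun _ _ _ _ hG => hG.weaken h2 h2'

theorem XJ.ite {R : QPred S} {V W : Set S.Var} {c d c' d' : Prog S}
    {e : Expr S (ULift.{u} Bool)} (he : e.fv ⊆ V) (h : XJ R V W c c') (h' : XJ R V W d d') :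
    XJ R V W (.ite e c d) (.ite e c' d') := by
  intro E μ hμ m₁ ψ₁ m₂ ψ₂ h1 h2 hG
  have : e.eval m₁ = e.eval m₂ := e.dependsOn fun x hx => hG.cl x (he ⟨x, hx, rfl⟩)
  rw [denE_ite_pure, denE_ite_pure, this]
  split_ifs
  · exact h E μ hμ _ _ _ _ h1 h2 hG
  · exact h' E μ hμ _ _ _ _ h1 h2 hG

theorem Cpl.restrictFam {R : QPred S} {V : Set S.Var} {μ : E → E → E} {ρ σ : Fam S E}
    {b : S.CMem → Prop} (hb : ∀ m₁ m₂, (∀ x, Sum.inl x ∈ V → m₁ x = m₂ x) → (b m₁ ↔ b m₂))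
    (h : Cpl (PairGood R V μ) ρ σ) :
    Cpl (PairGood R V μ) (restrictFam b ρ) (restrictFam b σ) :=
  h.bind (restrictFam_good b) (restrictFam_good b) fun m₁ ψ₁ m₂ ψ₂ hG => by
    rw [restrictFam_pure, restrictFam_pure]
    simp only [hb m₁ m₂ hG.cl]
    split_ifs
    · exact Cpl.pure hG
    · exact Cpl.zero

/-- The guard has the same value on both sides, so the two loops run in step: the parts that leave
after exactly `i` rounds are coupled for each `i`. -/
theorem XJ.whileLoop {R : QPred S} {V : Set S.Var} {c c' : Prog S}
    {e : Expr S (ULift.{u} Bool)} (he : e.fv ⊆ V) (h : XJ R V V c c') :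
    XJ R V V (.whileLoop e c) (.whileLoop e c') := by
  intro E μ hμ m₁ ψ₁ m₂ ψ₂ h1 h2 hG
  have he' : ∀ m₁ m₂ : S.CMem, (∀ x, Sum.inl x ∈ V → m₁ x = m₂ x) → e.eval m₁ = e.eval m₂ :=
    fun m₁ m₂ h => e.dependsOn fun x hx => h x (he ⟨x, hx, rfl⟩)
  refine Cpl.sum_nat (fun i => ?_) (denE_while_cqSum e c (isCQ_pure m₁ ψ₁))
    (denE_while_cqSum e c' (isCQ_pure m₂ ψ₂))
  refine Cpl.restrictFam (fun m₁ m₂ h => by rw [he' m₁ m₂ h]) ?_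
  induction i with
  | zero => exact Cpl.pure hG
  | succ i ih =>
    rw [Function.iterate_succ_apply', Function.iterate_succ_apply']
    exact h.bind hμ (Cpl.restrictFam (fun m₁ m₂ h => by rw [he' m₁ m₂ h]) ih)

theorem kraus_cpl {G : M → L2 X → M → L2 X → Prop} {J : Type u} {t : J → N → M}
    {K K' : J → N → L2 Y →L[ℂ] L2 X} (hK : ∀ m ψ, ∑' j, ‖K j m ψ‖ₑ ^ 2 ≤ ‖ψ‖ₑ ^ 2)
    (hK' : ∀ m ψ, ∑' j, ‖K' j m ψ‖ₑ ^ 2 ≤ ‖ψ‖ₑ ^ 2) {m₁ m₂ : N} {ψ₁ ψ₂ : L2 Y}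
    (h : ∀ j, G (t j m₁) (K j m₁ ψ₁) (t j m₂) (K' j m₂ ψ₂)) :
    Cpl G (kraus t K (pure m₁ ψ₁)) (kraus t K' (pure m₂ ψ₂)) :=
  ⟨J, fun j => t j m₁, fun j => t j m₂, fun j => K j m₁ ψ₁, fun j => K' j m₂ ψ₂, h,
    kraus_pure hK m₁ ψ₁, kraus_pure hK' m₂ ψ₂⟩

end

section

/-! ### Elementary programs preserve equality -/

variable {S : VarSystem.{u}} {E E' : Type u} {k l : ℕ} {M N X Y : Type u}

theorem Expr.eval_eq {α : Type u} (e : Expr S α) {V : Set S.Var} (he : e.fv ⊆ V) {m₁ m₂ : S.CMem}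
    (h : ∀ x, Sum.inl x ∈ V → m₁ x = m₂ x) : e.eval m₁ = e.eval m₂ :=
  e.dependsOn fun x hx => h x (he ⟨x, hx, rfl⟩)

theorem updList_eq_on {X : Fin k ↪ S.CVar} {V W : Set S.Var} (hW : W ⊆ V ∪ Ctx.cset X)
    {m₁ m₂ : S.CMem} (h : ∀ x, Sum.inl x ∈ V → m₁ x = m₂ x) (z : ∀ i, S.ctyp (X i))
    (x : S.CVar) (hx : Sum.inl x ∈ W) : updList X m₁ z x = updList X m₂ z x := by
  by_cases hX : x ∈ Set.range X
  · obtain ⟨i, rfl⟩ := hX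
    rw [updList_apply_mem, updList_apply_mem]
  · rw [updList_apply_not_mem _ _ _ hX, updList_apply_not_mem _ _ _ hX]
    exact h x ((hW hx).resolve_right fun h' => hX (mem_cset.1 h'))

theorem loc_smul_id (mix : X → X → X) (c : ℂ) :
    Loc mix (c • ContinuousLinearMap.id ℂ (L2 X)) := fun ψ₁ ψ₂ h x y => by
  have := h x y
  simp only [smul_apply, ContinuousLinearMap.coe_id', id_eq, lp.coeFn_smul, Pi.smul_apply,
    smul_eq_mul]
  linear_combination c * this

theorem loc_id (mix : X → X → X) : Loc mix (ContinuousLinearMap.id ℂ (L2 X)) :=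
  fun _ _ h => h

theorem xj_skip (R : QPred S) (V : Set S.Var) : XJ R V V .skip .skip :=
  fun _ _ _ _ _ _ _ _ _ h => Cpl.pure h

/-- Here and in the following rules the predicate is trivial; `XJ.frame` puts `R` back. -/
theorem xj_assign {V W : Set S.Var} (X : Fin k ↪ S.CVar) (e : Expr S (∀ i, S.ctyp (X i)))
    (he : e.fv ⊆ V) (hW : W ⊆ V ∪ Ctx.cset X) (hq : ∀ q, Sum.inr q ∈ V ↔ Sum.inr q ∈ W) :
    XJ ⊤ V W (.assign X e) (.assign X e) := by
  intro E μ hμ m₁ ψ₁ m₂ ψ₂ h1 h2 hG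
  rw [denE_assign, denE_assign, kraus₁_pure fun _ => id_le, kraus₁_pure fun _ => id_le,
    e.eval_eq he hG.cl]
  exact Cpl.pure (hG.loc hμ h1 (loc_id _) (updList_eq_on hW hG.cl _) hq)

theorem xj_sample {V W : Set S.Var} (X : Fin k ↪ S.CVar)
    (e : Expr S (SubDistr (∀ i, S.ctyp (X i)))) (he : e.fv ⊆ V) (hW : W ⊆ V ∪ Ctx.cset X)
    (hq : ∀ q, Sum.inr q ∈ V ↔ Sum.inr q ∈ W) : XJ ⊤ V W (.sample X e) (.sample X e) := by
  intro E μ hμ m₁ ψ₁ m₂ ψ₂ h1 h2 hG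
  rw [denE_sample X e (isCQ_pure _ _), denE_sample X e (isCQ_pure _ _)]
  have hK := fun m ψ => tsum_sqrtId_le (X := S.QMem × E) (e.eval m) ψ
  refine kraus_cpl hK hK fun z => ?_
  rw [e.eval_eq he hG.cl]
  exact hG.loc hμ h1 (loc_smul_id _ _) (updList_eq_on hW hG.cl _) hq

theorem xj_qapply {V : Set S.Var} (Q : Fin k ↪ S.QVar)
    (e : Expr S (L2 (∀ i, S.qtyp (Q i)) →ₗᵢ[ℂ] L2 (∀ i, S.qtyp (Q i)))) (he : e.fv ⊆ V)
    (hQ : Ctx.qset Q ⊆ V) : XJ ⊤ V V (.qapply Q e) (.qapply Q e) := by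
  intro E μ hμ m₁ ψ₁ m₂ ψ₂ h1 h2 hG
  have hK := fun m => enorm_liftOp_isometry (E := E) Q (e.eval m)
  rw [denE_qapply, denE_qapply, kraus₁_pure hK, kraus₁_pure hK, e.eval_eq he hG.cl]
  exact Cpl.pure (hG.loc hμ h1 (loc_liftOp Q (fun i => hQ ⟨i, rfl⟩) _) hG.cl fun _ => Iff.rfl)

theorem xj_measure {V W : Set S.Var} (X : Fin k ↪ S.CVar) (Q : Fin l ↪ S.QVar)
    (e : Expr S (ProjMeas (∀ i, S.qtyp (Q i)) (∀ i, S.ctyp (X i)))) (he : e.fv ⊆ V)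
    (hQ : Ctx.qset Q ⊆ V) (hW : W ⊆ V ∪ Ctx.cset X)
    (hq : ∀ q, Sum.inr q ∈ V ↔ Sum.inr q ∈ W) : XJ ⊤ V W (.measure X Q e) (.measure X Q e) := by
  intro E μ hμ m₁ ψ₁ m₂ ψ₂ h1 h2 hG
  rw [denE_measure X Q e (isCQ_pure _ _), denE_measure X Q e (isCQ_pure _ _)]
  have hK := measure_le (E := E) X Q e
  refine kraus_cpl hK hK fun z => ?_
  rw [e.eval_eq he hG.cl]
  exact hG.loc hμ h1 (loc_liftOp Q (fun i => hQ ⟨i, rfl⟩) _) (updList_eq_on hW hG.cl _) hq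

/-! ### Initializations -/

theorem hasSum_of_enorm {ι : Type*} {a : ι → L2 X} {ψ : L2 Y}
    (h : ∑' i, ‖a i‖ₑ ^ 2 = ‖ψ‖ₑ ^ 2) : HasSum (fun i => ‖a i‖ ^ 2) (‖ψ‖ ^ 2) := by
  have h0 : ∑' i, ‖a i‖ₑ ^ 2 ≠ ∞ := by
    rw [h]
    exact ENNReal.pow_ne_top enorm_ne_top
  have h1 := ENNReal.hasSum_toReal h0
  rw [← ENNReal.tsum_toReal_eq (ENNReal.ne_top_of_tsum_ne_top h0), h] at h1
  simpa using h1

/-- A pure state splits into rescaled copies of itself, with weights `‖c i‖²` that add up to `r²`.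
-/
theorem cqSum_smul {ι : Type*} {c : ι → ℂ} {r : ℝ} (hc : HasSum (fun i => ‖c i‖ ^ 2) (r ^ 2))
    (m : M) (ψ : L2 X) : CQSum (fun i => pure m (c i • ψ)) (pure m ((r : ℂ) • ψ)) := by
  refine cqSum_single m (fun _ => proj_isPositive _)
    (by rw [etr_proj]; exact ENNReal.pow_ne_top enorm_ne_top) ?_
  have h1 : HasSum (fun i => ((‖c i‖ ^ 2 : ℝ) : ℂ)) ((r ^ 2 : ℝ) : ℂ) :=
    Complex.hasSum_ofReal.2 hc
  have h2 := h1.smul_const (proj ψ)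
  convert h2 using 2
  · rw [proj_smul]
    push_cast
    rfl
  · rw [proj_smul, Complex.norm_real, Real.norm_eq_abs]
    norm_cast
    rw [sq_abs]

/-- The product coupling. -/
theorem Cpl.prod {G : M → L2 X → M → L2 X → Prop} {J : Type u} {a b : J → L2 X} {ψ₁ ψ₂ : L2 X}
    {ρ σ : M → Op X} {m₁ m₂ : M} (ha : CQSum (fun j => QRHL.pure m₁ (a j)) ρ)
    (hb : CQSum (fun j => QRHL.pure m₂ (b j)) σ) (ha' : ∑' j, ‖a j‖ₑ ^ 2 = ‖ψ₁‖ₑ ^ 2)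
    (hb' : ∑' j, ‖b j‖ₑ ^ 2 = ‖ψ₂‖ₑ ^ 2) (hn : ‖ψ₁‖ = ‖ψ₂‖) (h0 : ψ₁ ≠ 0)
    (hG : ∀ i j, G m₁ (((‖b j‖ / ‖ψ₁‖ : ℝ) : ℂ) • a i) m₂ (((‖a i‖ / ‖ψ₁‖ : ℝ) : ℂ) • b j)) :
    Cpl G ρ σ := by
  have hz : ‖ψ₁‖ ^ 2 ≠ 0 := pow_ne_zero _ (norm_ne_zero_iff.2 h0)
  -- The numbers `‖c j‖² / ‖ψ₁‖²` are the probabilities of the outcomes `j` on one side. Splitting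
  -- each state of the other side with these weights makes the two index sets match, and gives both
  -- members of a pair the norm `‖a i‖ ‖b j‖ / ‖ψ₁‖`.
  have key : ∀ {c : J → L2 X} {ψ : L2 X}, ∑' j, ‖c j‖ₑ ^ 2 = ‖ψ‖ₑ ^ 2 → ‖ψ‖ = ‖ψ₁‖ →
      ∀ (m : M) (φ : L2 X), CQSum (fun j => QRHL.pure m (((‖c j‖ / ‖ψ₁‖ : ℝ) : ℂ) • φ)) (QRHL.pure m φ) := by
    intro c ψ hc hψ m φ
    have h1 := (hasSum_of_enorm hc).div_const (‖ψ₁‖ ^ 2)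
    rw [hψ, div_self hz] at h1
    have h2 := cqSum_smul (c := fun j => ((‖c j‖ / ‖ψ₁‖ : ℝ) : ℂ)) (r := 1) (m := m) (ψ := φ)
      (by simpa only [Complex.norm_real, norm_div, norm_norm, div_pow, one_pow] using h1)
    rwa [Complex.ofReal_one, one_smul] at h2
  refine ⟨J × J, fun _ => m₁, fun _ => m₂, fun p => ((‖b p.2‖ / ‖ψ₁‖ : ℝ) : ℂ) • a p.1,
    fun p => ((‖a p.1‖ / ‖ψ₁‖ : ℝ) : ℂ) • b p.2, fun p => hG p.1 p.2, ?_, ?_⟩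
  · exact ha.prod fun i => key hb' hn.symm m₁ (a i)
  · exact (hb.prod fun j => key ha' rfl m₂ (b j)).comp_equiv (Equiv.prodComm J J)

/-- Values for the quantum variables in `H`. -/
def Vals (S : VarSystem.{u}) (H : Set S.QVar) : Type u :=
  {w : S.QMem // ∀ q, q ∉ H → w q = S.qinit q}

/-- Resetting loses no norm: the values `w` on `H` sort the coordinates of `ψ` into disjoint classes
that cover everything. -/
theorem tsum_matUnit (E : Type u) (H : Set S.QVar) (ψ : L2 (S.QMem × E)) :
    ∑' w : Vals S H, ‖matUnit E H S.qinit w.1 ψ‖ₑ ^ 2 = ‖ψ‖ₑ ^ 2 := by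
  refine tsum_enorm_prel_eq (J := Vals S H) _ _ _ ?_ ψ ?_
  · rintro ⟨w, hw⟩ ⟨w', hw'⟩ ⟨p, e⟩ ⟨p', e'⟩ hp hp' h
    simp only [Prod.mk.injEq] at h
    obtain ⟨h1, rfl⟩ := h
    constructor
    · refine Subtype.ext (funext fun q => ?_)
      by_cases hq : q ∈ H
      · simpa [ov, hq] using congrFun h1 q
      · exact (hw q hq).trans (hw' q hq).symm
    · congr 1
      funext q
      by_cases hq : q ∈ H
      · exact (hp q hq).trans (hp' q hq).symm
      · simpa [ov, hq] using congrFun h1 q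
  · rintro ⟨p, e⟩ -
    refine ⟨⟨ov H p S.qinit, fun q hq => ov_of_not_mem hq⟩, (ov H S.qinit p, e),
      fun q hq => ov_of_mem hq, ?_⟩
    refine Prod.ext (funext fun q => ?_) rfl
    by_cases hq : q ∈ H <;> simp [ov, hq]

/-- Resetting the quantum variables in `H` to their default values. -/
def reset (E : Type u) (H : Set S.QVar) : Fam S E → Fam S E :=
  kraus (fun _ m => m) fun (w : Vals S H) _ => matUnit E H S.qinit w.1

theorem reset_le (H : Set S.QVar) (_m : S.CMem) (ψ : L2 (S.QMem × E)) :
    ∑' w : Vals S H, ‖matUnit E H S.qinit w.1 ψ‖ₑ ^ 2 ≤ ‖ψ‖ₑ ^ 2 := (tsum_matUnit E H ψ).le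

theorem liftOp_ketbra (Q : Fin k ↪ S.QVar) (e : L2 (∀ i, S.qtyp (Q i))) (z : ∀ i, S.qtyp (Q i))
    (ψ : L2 (S.QMem × E)) (p : S.QMem) (f : E) :
    liftOp E Q (ketbra e z) ψ (p, f) = ψ (updList Q p z, f) * e fun i => p (Q i) := by
  rw [liftOp_apply, ketbra_apply]
  rfl

/-- The old content of `Q` is discarded by the initialization, so a reset of part of it beforehand
cannot be noticed. -/
theorem denE_qinit_reset (Q : Fin k ↪ S.QVar)
    (e : Expr S {ψ : L2 (∀ i, S.qtyp (Q i)) // ‖ψ‖ = 1}) {H : Set S.QVar}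
    (hH : H ⊆ Set.range Q) (m : S.CMem) (ψ : L2 (S.QMem × E)) :
    denE (.qinit Q e) E (reset E H (pure m ψ)) = denE (.qinit Q e) E (pure m ψ) := by
  have hK := qinit_le (E := E) Q e
  have h1 := (denE_good (.qinit Q e) E).sum (kraus_pure (t := fun _ m => m) (reset_le H) m ψ)
  have h2 : ∀ w : Vals S H, CQSum
      (fun z => pure m (liftOp E Q (ketbra (e.eval m).1 z) (matUnit E H S.qinit w.1 ψ)))
      (denE (.qinit Q e) E (pure m (matUnit E H S.qinit w.1 ψ))) := fun w => by
    rw [denE_qinit Q e (isCQ_pure _ _)]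
    exact kraus_pure (t := fun _ m => m) hK m _
  refine (h1.prod h2).unique ?_
  -- The Kraus index `z` corresponds to this pair: the reset reads `z` on `H`, after which the
  -- initialization reads the default value on `H` and `z` elsewhere. All other pairs contribute
  -- `0`.
  let j : (∀ i, S.qtyp (Q i)) → Vals S H × (∀ i, S.qtyp (Q i)) := fun z =>
    (⟨ov H (updList Q S.qinit z) S.qinit, fun q hq => ov_of_not_mem hq⟩,
      fun i => if Q i ∈ H then S.qinit (Q i) else z i)
  have hj : ∀ z, liftOp E Q (ketbra (e.eval m).1 (j z).2) (matUnit E H S.qinit (j z).1.1 ψ) =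
      liftOp E Q (ketbra (e.eval m).1 z) ψ := by
    intro z
    ext ⟨p, f⟩
    rw [liftOp_ketbra, liftOp_ketbra, matUnit_apply, if_pos]
    · congr 1
      refine congrArg _ (Prod.ext (funext fun q => ?_) rfl)
      by_cases hq : q ∈ Set.range Q
      · obtain ⟨i, rfl⟩ := hq
        by_cases hH : Q i ∈ H <;> simp [j, ov, hH, updList_apply_mem]
      · have hq' : q ∉ H := fun h => hq (hH h)
        simp [ov, hq', updList_apply_not_mem _ _ _ hq]
    · intro q hq
      obtain ⟨i, rfl⟩ := hH hq
      simp [j, updList_apply_mem, hq]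
  refine CQSum.of_comp_injective (e := j) ?_ ?_ ?_
  · rw [denE_qinit Q e (isCQ_pure _ _)]
    refine (kraus_pure hK m ψ).congr fun z => ?_
    rw [hj]
  · intro z z' h
    have h3 := congrArg (fun p => p.1.1) h
    have h4 := congrArg (fun p => p.2) h
    funext i
    by_cases hi : Q i ∈ H
    · simpa [j, ov, hi, updList_apply_mem] using congrFun h3 (Q i)
    · simpa [j, hi] using congrFun h4 i
  · rintro ⟨w, z⟩ hw
    convert pure_zero m
    ext ⟨p, f⟩
    rw [liftOp_ketbra, matUnit_apply, if_neg, zero_mul]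
    · rfl
    · intro h
      apply hw
      refine ⟨fun i => if Q i ∈ H then w.1 (Q i) else z i, Prod.ext (Subtype.ext ?_) ?_⟩
      · funext q
        by_cases hq : q ∈ H
        · obtain ⟨i, rfl⟩ := hH hq
          simp [j, ov, hq, updList_apply_mem]
        · simp [j, ov, hq, w.2 q hq]
      · funext i
        by_cases hi : Q i ∈ H
        · simpa [j, hi, updList_apply_mem] using (h (Q i) hi).symm
        · simp [j, hi]

/-- After the operation both vectors have the same definite values `u` on `H`, so including `H` in
the swap changes nothing. The old values `w` and `w'` may differ, because `H` lies outside `V`. -/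
theorem rel_matUnit {V W : Set S.Var} {μ : E → E → E} {H : Set S.QVar} {ψ₁ ψ₂ : L2 (S.QMem × E)}
    (hH : ∀ q ∈ H, Sum.inr q ∉ V) (hW : ∀ q, Sum.inr q ∈ W ↔ Sum.inr q ∈ V ∨ q ∈ H)
    (h : Rel (mixX V μ) ψ₁ ψ₂) (u w w' : S.QMem) :
    Rel (mixX W μ) (matUnit E H u w ψ₁) (matUnit E H u w' ψ₂) := by
  rintro ⟨p, e⟩ ⟨p', e'⟩
  have hov : ∀ a p p' : S.QMem, ov H a (ov {q | Sum.inr q ∈ W} p' p) =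
      ov {q | Sum.inr q ∈ V} (ov H a p') (ov H a p) := by
    intro a p p'
    funext q
    by_cases hq : q ∈ H
    · simp [ov, hq]
    · by_cases hV : Sum.inr q ∈ V <;> simp [ov, hq, hW, hV]
  have hov' : ∀ a b p p' : S.QMem, ov {q | Sum.inr q ∈ V} (ov H a p') (ov H b p) =
      ov {q | Sum.inr q ∈ V} (ov H b p') (ov H b p) := by
    intro a b p p'
    funext q
    by_cases hq : q ∈ H
    · simp [ov, hH q hq]
    · simp [ov, hq]
  have e1 : mixX W μ (p, e) (p', e') = (ov {q | Sum.inr q ∈ W} p' p, μ e e') := rfl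
  have e2 : mixX W μ (p', e') (p, e) = (ov {q | Sum.inr q ∈ W} p p', μ e' e) := rfl
  rw [e1, e2, matUnit_apply, matUnit_apply, matUnit_apply, matUnit_apply]
  have hP : (∀ q ∈ H, ov {q | Sum.inr q ∈ W} p' p q = u q) ↔ ∀ q ∈ H, p' q = u q :=
    forall₂_congr fun q hq => by
      rw [ov_of_mem (show q ∈ {q | Sum.inr q ∈ W} from (hW q).2 (Or.inr hq))]
  have hP' : (∀ q ∈ H, ov {q | Sum.inr q ∈ W} p p' q = u q) ↔ ∀ q ∈ H, p q = u q :=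
    forall₂_congr fun q hq => by
      rw [ov_of_mem (show q ∈ {q | Sum.inr q ∈ W} from (hW q).2 (Or.inr hq))]
  simp only [hP, hP']
  by_cases h1 : ∀ q ∈ H, p q = u q <;> by_cases h2 : ∀ q ∈ H, p' q = u q
  · simp only [if_pos h1, if_pos h2]
    have h3 := h (ov H w p, e) (ov H w' p', e')
    simp only [mixX, hov' w' w, hov' w w'] at h3
    rw [h3, hov, hov]
  all_goals simp [h1, h2]

/-- The variables in `Q` outside `V` are first reset on both sides, independently of each other,
through the product coupling. From then on all of `Q` is equal, and the Kraus operators of the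
initialization act on equal variables. -/
theorem xj_qinit {V W : Set S.Var} (Q : Fin k ↪ S.QVar)
    (e : Expr S {ψ : L2 (∀ i, S.qtyp (Q i)) // ‖ψ‖ = 1}) (he : e.fv ⊆ V)
    (hW : ∀ x, Sum.inl x ∈ W → Sum.inl x ∈ V)
    (hq : ∀ q, Sum.inr q ∈ W ↔ Sum.inr q ∈ V ∨ q ∈ Set.range Q) :
    XJ ⊤ V W (.qinit Q e) (.qinit Q e) := by
  intro E μ hμ m₁ ψ₁ m₂ ψ₂ h1 h2 hG
  set H : Set S.QVar := {q | q ∈ Set.range Q ∧ Sum.inr q ∉ V} with hH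
  have hHQ : H ⊆ Set.range Q := fun q hq => hq.1
  rw [← denE_qinit_reset Q e hHQ, ← denE_qinit_reset Q e hHQ]
  have hm : e.eval m₁ = e.eval m₂ := e.eval_eq he hG.cl
  -- `W` need not contain the variables of `e`, so equality of the values of `e` is recorded
  -- separately.
  have h3 : Cpl (fun n₁ φ₁ n₂ φ₂ => PairGood ⊤ W μ n₁ φ₁ n₂ φ₂ ∧ e.eval n₁ = e.eval n₂)
      (reset E H (pure m₁ ψ₁)) (reset E H (pure m₂ ψ₂)) := by
    refine Cpl.prod (kraus_pure (t := fun _ m => m) (reset_le H) m₁ ψ₁)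
      (kraus_pure (t := fun _ m => m) (reset_le H) m₂ ψ₂)
      (tsum_matUnit E H ψ₁) (tsum_matUnit E H ψ₂) hG.norm h1 fun w w' => ⟨⟨?_, ?_, ?_, ?_⟩, hm⟩
    · simp only [norm_smul, Complex.norm_real, norm_div, norm_norm]
      ring
    · exact fun x hx => hG.cl x (hW x hx)
    · refine (rel_matUnit (fun q hq => hq.2) (fun q => ?_) hG.rel _ _ _).smul _ _
      rw [hq]
      by_cases hV : Sum.inr q ∈ V <;> simp [hH, hV]
    · exact fun _ _ => trivial
  refine (h3.ne_zero fun _ _ _ _ h => h.1.norm).bind (denE_good _ E) (denE_good _ E)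
    fun n₁ φ₁ n₂ φ₂ h => ?_
  rw [denE_qinit Q e (isCQ_pure _ _), denE_qinit Q e (isCQ_pure _ _)]
  have hK := qinit_le (E := E) Q e
  refine kraus_cpl hK hK fun z => ?_
  rw [h.1.2]
  exact h.1.1.loc hμ h.2.1 (loc_liftOp Q (fun i => (hq _).2 (Or.inr ⟨i, rfl⟩)) _) h.1.1.cl
    fun _ => Iff.rfl

end

section

/-! ### Adjoints and invariant subspaces -/

variable {S : VarSystem.{u}} {E E' : Type u} {k l : ℕ} {M N X Y : Type u}

theorem inner_prel {D : Set Y} {g : Y → X} (hg : Set.InjOn g D) {D' : Set X} {g' : X → Y}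
    (hg' : Set.InjOn g' D') (h : ∀ y ∈ D, g y ∈ D' ∧ g' (g y) = y)
    (h' : ∀ x ∈ D', g' x ∈ D ∧ g (g' x) = x) (ψ : L2 X) (φ : L2 Y) :
    inner ℂ (prel D g hg ψ) φ = inner ℂ ψ (prel D' g' hg' φ) := by
  have e1 := (L2.hasSum_inner (prel D g hg ψ) φ).tsum_eq
  have e2 := (L2.hasSum_inner ψ (prel D' g' hg' φ)).tsum_eq
  rw [← e1, ← e2]
  have f1 : (fun y => (starRingEnd ℂ) (prel D g hg ψ y) * φ y) =
      D.indicator fun y => (starRingEnd ℂ) (ψ (g y)) * φ y := by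
    funext y
    by_cases hy : y ∈ D <;> simp [prel_apply, hy]
  have f2 : (fun x => (starRingEnd ℂ) (ψ x) * prel D' g' hg' φ x) =
      D'.indicator fun x => (starRingEnd ℂ) (ψ x) * φ (g' x) := by
    funext x
    by_cases hx : x ∈ D' <;> simp [prel_apply, hx]
  rw [f1, f2, ← tsum_subtype, ← tsum_subtype]
  let σ : D ≃ D' :=
    { toFun := fun y => ⟨g y, (h y y.2).1⟩
      invFun := fun x => ⟨g' x, (h' x x.2).1⟩
      left_inv := fun y => Subtype.ext (h y y.2).2
      right_inv := fun x => Subtype.ext (h' x x.2).2 }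
  rw [← σ.tsum_eq]
  refine tsum_congr fun y => ?_
  change _ = (starRingEnd ℂ) (ψ (g y)) * φ (g' (g y))
  rw [(h y y.2).2]

/-- The orthogonal projection onto a closed subspace. -/
def projOn (N : ClosedSubmodule ℂ (L2 X)) : Op X :=
  haveI : CompleteSpace N.toSubmodule := N.isClosed.completeSpace_coe
  N.toSubmodule.starProjection

/-! ### Orthogonal projections onto closed subspaces -/

section projOn

variable {N : ClosedSubmodule ℂ (L2 X)} {ψ : L2 X}

theorem projOn_mem (ψ : L2 X) : projOn N ψ ∈ N :=
  haveI : CompleteSpace N.toSubmodule := N.isClosed.completeSpace_coe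
  Submodule.starProjection_apply_mem N.toSubmodule ψ

theorem inner_sub_projOn (ψ : L2 X) {φ : L2 X} (hφ : φ ∈ N) : inner ℂ φ (ψ - projOn N ψ) = 0 :=
  haveI : CompleteSpace N.toSubmodule := N.isClosed.completeSpace_coe
  (Submodule.mem_orthogonal _ _).1
    (Submodule.sub_starProjection_mem_orthogonal (K := N.toSubmodule) ψ) φ hφ

theorem projOn_of_mem (h : ψ ∈ N) : projOn N ψ = ψ :=
  haveI : CompleteSpace N.toSubmodule := N.isClosed.completeSpace_coe
  Submodule.starProjection_eq_self_iff.2 h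

theorem mem_of_norm_projOn (h : ‖projOn N ψ‖ = ‖ψ‖) : ψ ∈ N :=
  haveI : CompleteSpace N.toSubmodule := N.isClosed.completeSpace_coe
  (Submodule.mem_iff_norm_starProjection N.toSubmodule ψ).2 h

theorem norm_projOn_le : ‖projOn N‖ ≤ 1 :=
  haveI : CompleteSpace N.toSubmodule := N.isClosed.completeSpace_coe
  Submodule.starProjection_norm_le N.toSubmodule

/-- `B` is the adjoint of `A`. A closed subspace that is invariant under both reduces `A`, because
`A` then also preserves the orthogonal complement. -/
theorem projOn_comm {A B : Op X} (hAB : ∀ φ ψ, inner ℂ (B φ) ψ = inner ℂ φ (A ψ))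
    (hA : ∀ ψ ∈ N, A ψ ∈ N) (hB : ∀ ψ ∈ N, B ψ ∈ N) (ψ : L2 X) :
    projOn N (A ψ) = A (projOn N ψ) := by
  have : CompleteSpace N.toSubmodule := N.isClosed.completeSpace_coe
  refine (Submodule.eq_starProjection_of_mem_of_inner_eq_zero (K := N.toSubmodule)
    (hA _ (projOn_mem ψ)) fun w hw => ?_)
  rw [← map_sub, ← inner_conj_symm, ← hAB, inner_sub_projOn ψ (hB w hw), map_zero]

end projOn

theorem inner_matUnit (F : Set S.QVar) (u w : S.QMem) (ψ φ : L2 (S.QMem × E)) :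
    inner ℂ (matUnit E F u w ψ) φ = inner ℂ ψ (matUnit E F w u φ) := by
  have key : ∀ u w : S.QMem, ∀ y ∈ {y : S.QMem × E | ∀ q ∈ F, y.1 q = u q},
      (ov F w y.1, y.2) ∈ {y : S.QMem × E | ∀ q ∈ F, y.1 q = w q} ∧
        (ov F u (ov F w y.1), y.2) = y := fun u w y hy =>
    ⟨fun q hq => ov_of_mem hq, Prod.ext (funext fun q => by
      by_cases hq : q ∈ F
      · exact (ov_of_mem hq).trans (hy q hq).symm
      · simp [ov, hq]) rfl⟩
  exact inner_prel _ _ (key u w) (key w u) ψ φ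

/-- The operator `|u⟩⟨w|` on the quantum variables in `H₁` (first memory) and `H₂` (second
memory). -/
def matUnit₂ (H₁ H₂ : Set S.QVar) (u w : S.QMem × S.QMem) : Op (S.QMem × S.QMem) :=
  prel {y | (∀ q ∈ H₁, y.1 q = u.1 q) ∧ ∀ q ∈ H₂, y.2 q = u.2 q}
    (fun y => (ov H₁ w.1 y.1, ov H₂ w.2 y.2)) (by
      rintro ⟨p, p'⟩ hp ⟨r, r'⟩ hr h
      simp only [Prod.mk.injEq] at h
      refine Prod.ext (funext fun q => ?_) (funext fun q => ?_)
      · by_cases hq : q ∈ H₁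
        · exact (hp.1 q hq).trans (hr.1 q hq).symm
        · simpa [ov, hq] using congrFun h.1 q
      · by_cases hq : q ∈ H₂
        · exact (hp.2 q hq).trans (hr.2 q hq).symm
        · simpa [ov, hq] using congrFun h.2 q)

theorem matUnit₂_apply (H₁ H₂ : Set S.QVar) (u w : S.QMem × S.QMem) (ψ : L2 (S.QMem × S.QMem))
    (p : S.QMem × S.QMem) : matUnit₂ H₁ H₂ u w ψ p =
      if (∀ q ∈ H₁, p.1 q = u.1 q) ∧ ∀ q ∈ H₂, p.2 q = u.2 q then
        ψ (ov H₁ w.1 p.1, ov H₂ w.2 p.2) else 0 := by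
  refine Eq.trans (@prel_apply _ _ _ _ _ ψ p) ?_
  congr

theorem inner_matUnit₂ (H₁ H₂ : Set S.QVar) (u w : S.QMem × S.QMem)
    (ψ φ : L2 (S.QMem × S.QMem)) :
    inner ℂ (matUnit₂ H₁ H₂ u w ψ) φ = inner ℂ ψ (matUnit₂ H₁ H₂ w u φ) := by
  have key : ∀ u w : S.QMem × S.QMem,
      ∀ y ∈ {y : S.QMem × S.QMem | (∀ q ∈ H₁, y.1 q = u.1 q) ∧ ∀ q ∈ H₂, y.2 q = u.2 q},
      (ov H₁ w.1 y.1, ov H₂ w.2 y.2) ∈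
        {y : S.QMem × S.QMem | (∀ q ∈ H₁, y.1 q = w.1 q) ∧ ∀ q ∈ H₂, y.2 q = w.2 q} ∧
        (ov H₁ u.1 (ov H₁ w.1 y.1), ov H₂ u.2 (ov H₂ w.2 y.2)) = y := fun u w y hy =>
    ⟨⟨fun q hq => ov_of_mem hq, fun q hq => ov_of_mem hq⟩, Prod.ext
      (funext fun q => by
        by_cases hq : q ∈ H₁
        · exact (ov_of_mem hq).trans (hy.1 q hq).symm
        · simp [ov, hq])
      (funext fun q => by
        by_cases hq : q ∈ H₂
        · exact (ov_of_mem hq).trans (hy.2 q hq).symm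
        · simp [ov, hq])⟩
  exact inner_prel _ _ (key u w) (key w u) ψ φ

/-! ### The free variables of a predicate -/

/-- The quantum variables in `V`. -/
def qs (V : Set S.Var) : Set S.QVar := {q | Sum.inr q ∈ V}

theorem glue_eq (F : Set S.Var) (a b : S.QMem) :
    glue F (fun q => a q) (fun q => b q) = ov (qs F) a b := by
  funext q
  by_cases h : Sum.inr q ∈ F <;>
    simp [glue, ov, qs, h, Equiv.piEquivPiSubtypeProd]

/-- The slice at `b`. -/
def sliceAt (F₁ F₂ : Set S.Var) (b : S.QMem × S.QMem) : L2 (S.QMem × S.QMem) →L[ℂ]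
    L2 ((∀ q : {q // Sum.inr q ∈ F₁}, S.qtyp q) × (∀ q : {q // Sum.inr q ∈ F₂}, S.qtyp q)) :=
  slice F₁ F₂ (fun q => b.1 q) (fun q => b.2 q)

theorem sliceAt_apply (F₁ F₂ : Set S.Var) (b : S.QMem × S.QMem) (ψ : L2 (S.QMem × S.QMem))
    (a : S.QMem × S.QMem) : sliceAt F₁ F₂ b ψ (fun q => a.1 q, fun q => a.2 q) =
      ψ (ov (qs F₁) a.1 b.1, ov (qs F₂) a.2 b.2) := by
  rw [← glue_eq, ← glue_eq]
  rfl

theorem exists_extend (P : S.QVar → Prop) (a : ∀ q : {q // P q}, S.qtyp q) :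
    ∃ p : S.QMem, a = fun q : {q // P q} => p q := by
  refine ⟨fun q => if h : P q then a ⟨q, h⟩ else S.qinit q, ?_⟩
  funext q
  simp [q.2]

theorem sliceAt_ext (F₁ F₂ : Set S.Var) {b b' : S.QMem × S.QMem} {ψ ψ' : L2 (S.QMem × S.QMem)}
    (h : ∀ a : S.QMem × S.QMem, ψ (ov (qs F₁) a.1 b.1, ov (qs F₂) a.2 b.2) =
      ψ' (ov (qs F₁) a.1 b'.1, ov (qs F₂) a.2 b'.2)) :
    sliceAt F₁ F₂ b ψ = sliceAt F₁ F₂ b' ψ' := by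
  ext ⟨a₁, a₂⟩
  obtain ⟨a₁, rfl⟩ := exists_extend _ a₁
  obtain ⟨a₂, rfl⟩ := exists_extend _ a₂
  exact (sliceAt_apply F₁ F₂ b ψ (a₁, a₂)).trans
    ((h (a₁, a₂)).trans (sliceAt_apply F₁ F₂ b' ψ' (a₁, a₂)).symm)

theorem sliceAt_eq_zero (F₁ F₂ : Set S.Var) {b : S.QMem × S.QMem} {ψ : L2 (S.QMem × S.QMem)}
    (h : ∀ a : S.QMem × S.QMem, ψ (ov (qs F₁) a.1 b.1, ov (qs F₂) a.2 b.2) = 0) :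
    sliceAt F₁ F₂ b ψ = 0 := by
  rw [← map_zero (sliceAt F₁ F₂ b)]
  exact sliceAt_ext F₁ F₂ h

/-- The subspace is determined by the quantum variables in `F₁` and `F₂`. -/
def SpaceOver (A : ClosedSubmodule ℂ (L2 (S.QMem × S.QMem))) (F₁ F₂ : Set S.Var) : Prop :=
  ∃ T : ClosedSubmodule ℂ
      (L2 ((∀ q : {q // Sum.inr q ∈ F₁}, S.qtyp q) × (∀ q : {q // Sum.inr q ∈ F₂}, S.qtyp q))),
    ∀ ψ, ψ ∈ A ↔ ∀ b, sliceAt F₁ F₂ b ψ ∈ T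

theorem spaceOver_iff {A : ClosedSubmodule ℂ (L2 (S.QMem × S.QMem))} {F₁ F₂ : Set S.Var} :
    SpaceOver A F₁ F₂ ↔ ∃ T : ClosedSubmodule ℂ
      (L2 ((∀ q : {q // Sum.inr q ∈ F₁}, S.qtyp q) × (∀ q : {q // Sum.inr q ∈ F₂}, S.qtyp q))),
    ∀ ψ, ψ ∈ A ↔ ∀ b₁ b₂, slice F₁ F₂ b₁ b₂ ψ ∈ T := by
  refine exists_congr fun T => forall_congr' fun ψ => iff_congr Iff.rfl ?_
  constructor
  · intro h b₁ b₂
    obtain ⟨b₁, rfl⟩ := exists_extend _ b₁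
    obtain ⟨b₂, rfl⟩ := exists_extend _ b₂
    exact h (b₁, b₂)
  · exact fun h b => h _ _

theorem SpaceOver.mem_of_slices {A : ClosedSubmodule ℂ (L2 (S.QMem × S.QMem))} {F₁ F₂ : Set S.Var}
    (h : SpaceOver A F₁ F₂) {φ : L2 (S.QMem × S.QMem)}
    (hφ : ∀ b, sliceAt F₁ F₂ b φ = 0 ∨ ∃ ψ ∈ A, ∃ b', sliceAt F₁ F₂ b φ = sliceAt F₁ F₂ b' ψ) :
    φ ∈ A := by
  obtain ⟨T, hT⟩ := h
  refine (hT φ).2 fun b => ?_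
  rcases hφ b with h | ⟨ψ, hψ, b', h⟩
  · rw [h]; exact T.zero_mem
  · rw [h]; exact (hT ψ).1 hψ b'

theorem SpaceOver.matUnit₂_mem {A : ClosedSubmodule ℂ (L2 (S.QMem × S.QMem))} {F₁ F₂ : Set S.Var}
    (h : SpaceOver A F₁ F₂) {H₁ H₂ : Set S.QVar} (h1 : ∀ q ∈ H₁, q ∉ qs F₁)
    (h2 : ∀ q ∈ H₂, q ∉ qs F₂) (u w : S.QMem × S.QMem) {ψ : L2 (S.QMem × S.QMem)}
    (hψ : ψ ∈ A) : matUnit₂ H₁ H₂ u w ψ ∈ A := by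
  refine h.mem_of_slices fun b => ?_
  by_cases hb : (∀ q ∈ H₁, b.1 q = u.1 q) ∧ ∀ q ∈ H₂, b.2 q = u.2 q
  · refine Or.inr ⟨ψ, hψ, (ov H₁ w.1 b.1, ov H₂ w.2 b.2), sliceAt_ext _ _ fun a => ?_⟩
    rw [matUnit₂_apply, if_pos]
    · refine congrArg _ (Prod.ext (funext fun q => ?_) (funext fun q => ?_))
      · by_cases hq : q ∈ H₁
        · simp [ov, hq, h1 q hq]
        · simp [ov, hq]
      · by_cases hq : q ∈ H₂
        · simp [ov, hq, h2 q hq]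
        · simp [ov, hq]
    · exact ⟨fun q hq => (ov_of_not_mem (h1 q hq)).trans (hb.1 q hq),
        fun q hq => (ov_of_not_mem (h2 q hq)).trans (hb.2 q hq)⟩
  · refine Or.inl (sliceAt_eq_zero _ _ fun a => ?_)
    rw [matUnit₂_apply, if_neg]
    exact fun h' => hb ⟨fun q hq => (ov_of_not_mem (h1 q hq)).symm.trans (h'.1 q hq),
      fun q hq => (ov_of_not_mem (h2 q hq)).symm.trans (h'.2 q hq)⟩

/-- Converse of `SpaceOver.matUnit₂_mem`: a closed subspace that is invariant under all matrix units
on the outer variables has the form `T ⊗` everything. This criterion makes intersections and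
enlargements of the variable sets accessible. -/
theorem spaceOver_of_matUnit₂ {A : ClosedSubmodule ℂ (L2 (S.QMem × S.QMem))} {F₁ F₂ : Set S.Var}
    (h : ∀ u w, ∀ ψ ∈ A, matUnit₂ (qs F₁)ᶜ (qs F₂)ᶜ u w ψ ∈ A) : SpaceOver A F₁ F₂ := by
  let emb : S.QMem × S.QMem → L2 ((∀ q : {q // Sum.inr q ∈ F₁}, S.qtyp q) ×
      (∀ q : {q // Sum.inr q ∈ F₂}, S.qtyp q)) →L[ℂ] L2 (S.QMem × S.QMem) := fun c =>
    prel {y | (∀ q ∉ qs F₁, y.1 q = c.1 q) ∧ ∀ q ∉ qs F₂, y.2 q = c.2 q}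
      (fun y => (fun q => y.1 q, fun q => y.2 q)) (by
        rintro ⟨p, p'⟩ hp ⟨r, r'⟩ hr h
        simp only [Prod.mk.injEq] at h
        refine Prod.ext (funext fun q => ?_) (funext fun q => ?_)
        · by_cases hq : q ∈ qs F₁
          · exact congrFun h.1 ⟨q, hq⟩
          · exact (hp.1 q hq).trans (hr.1 q hq).symm
        · by_cases hq : q ∈ qs F₂
          · exact congrFun h.2 ⟨q, hq⟩
          · exact (hp.2 q hq).trans (hr.2 q hq).symm)
  have hemb : ∀ c b ψ, emb c (sliceAt F₁ F₂ b ψ) = matUnit₂ (qs F₁)ᶜ (qs F₂)ᶜ c b ψ := by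
    intro c b ψ
    ext p
    rw [matUnit₂_apply]
    refine (@prel_apply _ _ _ _ _ _ p).trans ?_
    refine @if_congr _ _ _ (_) (_) _ _ _ _ Iff.rfl ?_ rfl
    rw [sliceAt_apply]
    refine congrArg _ (Prod.ext (funext fun q => ?_) (funext fun q => ?_))
    · by_cases hq : q ∈ qs F₁ <;> simp [ov, hq]
    · by_cases hq : q ∈ qs F₂ <;> simp [ov, hq]
  -- `T` consists of the vectors that lie in `A` whatever basis state `c` of the outer variables
  -- they are completed with.
  refine ⟨⨅ c, A.comap (emb c), fun ψ => ⟨fun hψ b => ?_, fun hψ => ?_⟩⟩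
  · rw [ClosedSubmodule.mem_iInf]
    intro c
    rw [ClosedSubmodule.mem_comap, hemb]
    exact h _ _ _ hψ
  · have h1 : ∀ u, matUnit₂ (qs F₁)ᶜ (qs F₂)ᶜ u u ψ ∈ A := fun u => by
      have := ClosedSubmodule.mem_iInf.1 (hψ u) u
      rwa [ClosedSubmodule.mem_comap, hemb] at this
    -- All diagonal compressions of `ψ` lie in `A`, and the projection onto `A` commutes with them.
    -- Hence every compression of the defect `ψ - projOn A ψ` vanishes, and reading it at its own
    -- coordinate shows that the defect is `0`.
    have h2 : ∀ u, matUnit₂ (qs F₁)ᶜ (qs F₂)ᶜ u u (ψ - projOn A ψ) = 0 := fun u => by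
      rw [map_sub, ← projOn_comm (inner_matUnit₂ _ _ u u) (h u u) (h u u),
        projOn_of_mem (h1 u), sub_self]
    have h3 : ψ - projOn A ψ = 0 := by
      ext p
      have := congrArg (fun φ : L2 (S.QMem × S.QMem) => φ p) (h2 p)
      simp only [matUnit₂_apply, ov_self] at this
      simpa using this
    rw [sub_eq_zero.1 h3]
    exact projOn_mem ψ

/-- A matrix unit on the complement of `F ∩ G` factors into one on the complement of `F` and one on
the part of `F` outside `G`; each factor preserves the subspace. -/
theorem SpaceOver.inter {A : ClosedSubmodule ℂ (L2 (S.QMem × S.QMem))}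
    {F₁ F₂ G₁ G₂ : Set S.Var} (h : SpaceOver A F₁ F₂) (h' : SpaceOver A G₁ G₂) :
    SpaceOver A (F₁ ∩ G₁) (F₂ ∩ G₂) := by
  refine spaceOver_of_matUnit₂ fun u w ψ hψ => ?_
  have h1 := h.matUnit₂_mem (H₁ := (qs F₁)ᶜ) (H₂ := (qs F₂)ᶜ) (fun q hq => hq) (fun q hq => hq)
    u w (h'.matUnit₂_mem (H₁ := (qs G₁)ᶜ \ (qs F₁)ᶜ) (H₂ := (qs G₂)ᶜ \ (qs F₂)ᶜ)
      (fun q hq => hq.1) (fun q hq => hq.1) u w hψ)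
  convert h1 using 1
  ext p
  have key : ∀ (F G : Set S.Var) (p u : S.QMem), (∀ q ∈ (qs (F ∩ G))ᶜ, p q = u q) ↔
      (∀ q ∈ (qs F)ᶜ, p q = u q) ∧ ∀ q ∈ (qs G)ᶜ \ (qs F)ᶜ, p q = u q := by
    intro F G p u
    constructor
    · exact fun h => ⟨fun q hq => h q fun h' => hq h'.1, fun q hq => h q fun h' => hq.1 h'.2⟩
    · rintro ⟨h1, h2⟩ q hq
      by_cases hF : q ∈ qs F
      · exact h2 q ⟨fun hG => hq ⟨hF, hG⟩, fun h => h hF⟩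
      · exact h1 q hF
  have key2 : ∀ (F G : Set S.Var) (p u w : S.QMem),
      (∀ q ∈ (qs G)ᶜ \ (qs F)ᶜ, ov (qs F)ᶜ w p q = u q) ↔
        ∀ q ∈ (qs G)ᶜ \ (qs F)ᶜ, p q = u q := fun F G p u w =>
    forall₂_congr fun q hq => by rw [ov_of_not_mem hq.2]
  have key3 : ∀ (F G : Set S.Var) (p w : S.QMem),
      ov (qs (F ∩ G))ᶜ w p = ov ((qs G)ᶜ \ (qs F)ᶜ) w (ov (qs F)ᶜ w p) := by
    intro F G p w
    funext q
    by_cases hF : Sum.inr q ∈ F <;> by_cases hG : Sum.inr q ∈ G <;> simp [ov, qs, hF, hG]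
  rw [matUnit₂_apply, matUnit₂_apply, matUnit₂_apply]
  simp only [key, key2, key3]
  split_ifs <;> first | rfl | tauto

theorem SpaceOver.mono {A : ClosedSubmodule ℂ (L2 (S.QMem × S.QMem))}
    {F₁ F₂ G₁ G₂ : Set S.Var} (h : SpaceOver A F₁ F₂) (h1 : F₁ ⊆ G₁) (h2 : F₂ ⊆ G₂) :
    SpaceOver A G₁ G₂ :=
  spaceOver_of_matUnit₂ fun _ _ _ hψ => h.matUnit₂_mem
    (H₁ := (qs G₁)ᶜ) (H₂ := (qs G₂)ᶜ) (fun _ hq hF => hq (h1 hF)) (fun _ hq hF => hq (h2 hF))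
    _ _ hψ

theorem isOver_iff {A : QPred S} {F₁ F₂ : Set S.Var} : A.IsOver F₁ F₂ ↔
    (∀ m₁ m₂ m₁' m₂' : S.CMem, (∀ x, Sum.inl x ∈ F₁ → m₁ x = m₁' x) →
      (∀ x, Sum.inl x ∈ F₂ → m₂ x = m₂' x) → A m₁ m₂ = A m₁' m₂') ∧
    ∀ m₁ m₂, SpaceOver (A m₁ m₂) F₁ F₂ :=
  and_congr Iff.rfl (forall₂_congr fun _ _ => spaceOver_iff.symm)

theorem QPred.IsOver.inter {A : QPred S} {F₁ F₂ G₁ G₂ : Set S.Var} (h : A.IsOver F₁ F₂)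
    (h' : A.IsOver G₁ G₂) : A.IsOver (F₁ ∩ G₁) (F₂ ∩ G₂) := by
  rw [isOver_iff] at *
  refine ⟨fun m₁ m₂ m₁' m₂' h1 h2 => ?_, fun m₁ m₂ => (h.2 m₁ m₂).inter (h'.2 m₁ m₂)⟩
  -- The memories are changed in two moves: the intermediate ones agree with the old memories on `F`
  -- and with the new ones elsewhere.
  refine (h.1 m₁ m₂ (ov {x | Sum.inl x ∈ F₁} m₁ m₁') (ov {x | Sum.inl x ∈ F₂} m₂ m₂')
    (fun x hx => ?_) (fun x hx => ?_)).trans (h'.1 _ _ _ _ (fun x hx => ?_) (fun x hx => ?_))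
  · simp [ov, hx]
  · simp [ov, hx]
  · by_cases hF : Sum.inl x ∈ F₁ <;> simp [ov, hF]
    exact h1 x ⟨hF, hx⟩
  · by_cases hF : Sum.inl x ∈ F₂ <;> simp [ov, hF]
    exact h2 x ⟨hF, hx⟩

theorem QPred.IsOver.mono {A : QPred S} {F₁ F₂ G₁ G₂ : Set S.Var} (h : A.IsOver F₁ F₂)
    (h1 : F₁ ⊆ G₁) (h2 : F₂ ⊆ G₂) : A.IsOver G₁ G₂ := by
  rw [isOver_iff] at *
  exact ⟨fun _ _ _ _ h3 h4 => h.1 _ _ _ _ (fun x hx => h3 x (h1 hx)) fun x hx => h4 x (h2 hx),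
    fun m₁ m₂ => (h.2 m₁ m₂).mono h1 h2⟩

/-- A predicate with finite support is a predicate over its free variables. -/
theorem QPred.FinitelySupported.isOver_fv {A : QPred S} (h : A.FinitelySupported) :
    A.IsOver A.fv₁ A.fv₂ := by
  obtain ⟨F₁, F₂, h1, h2, h0⟩ := h
  -- The intersection property is available for finitely many sets only. The superfluous variables
  -- of the finite set `s` are therefore removed one at a time, each by intersecting with a
  -- representation that avoids it.
  have key : ∀ s : Set S.Var, s.Finite → ∀ G₁ G₂, A.IsOver G₁ G₂ →
      ∃ G₁' G₂', A.IsOver G₁' G₂' ∧ G₁' ⊆ G₁ ∧ G₂' ⊆ G₂ ∧ s ∩ G₁' ⊆ A.fv₁ ∧ s ∩ G₂' ⊆ A.fv₂ := by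
    intro s hs
    induction s, hs using Set.Finite.induction_on with
    | empty => exact fun G₁ G₂ hG => ⟨G₁, G₂, hG, le_rfl, le_rfl, by simp, by simp⟩
    | @insert v s _ _ ih =>
      intro G₁ G₂ hG
      obtain ⟨G₁', G₂', a1, a2, a3, a4, a5⟩ := ih G₁ G₂ hG
      obtain ⟨K₁, K₂, b1, b2⟩ : ∃ K₁ K₂, A.IsOver K₁ K₂ ∧ (v ∈ K₁ → v ∈ A.fv₁) := by
        by_cases hv : v ∈ A.fv₁
        · exact ⟨_, _, a1, fun _ => hv⟩
        · have hv' := hv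
          simp only [fv₁, Set.mem_ofPred_eq, not_forall] at hv
          obtain ⟨K₁, K₂, b1, b2⟩ := hv
          exact ⟨K₁, K₂, b1, fun h => (b2 h).elim⟩
      obtain ⟨L₁, L₂, c1, c2⟩ : ∃ K₁ K₂, A.IsOver K₁ K₂ ∧ (v ∈ K₂ → v ∈ A.fv₂) := by
        by_cases hv : v ∈ A.fv₂
        · exact ⟨_, _, a1, fun _ => hv⟩
        · have hv' := hv
          simp only [fv₂, Set.mem_ofPred_eq, not_forall] at hv
          obtain ⟨K₁, K₂, b1, b2⟩ := hv
          exact ⟨K₁, K₂, b1, fun h => (b2 h).elim⟩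
      refine ⟨_, _, (a1.inter b1).inter c1, fun x hx => a2 hx.1.1, fun x hx => a3 hx.1.1, ?_, ?_⟩
      · rintro x ⟨rfl | hx, hx'⟩
        · exact b2 hx'.1.2
        · exact a4 ⟨hx, hx'.1.1⟩
      · rintro x ⟨rfl | hx, hx'⟩
        · exact c2 hx'.2
        · exact a5 ⟨hx, hx'.1.1⟩
  obtain ⟨G₁, G₂, a1, a2, a3, a4, a5⟩ := key (F₁ ∪ F₂) (h1.union h2) F₁ F₂ h0
  exact a1.mono (fun x hx => a4 ⟨Or.inl (a2 hx), hx⟩) fun x hx => a5 ⟨Or.inr (a3 hx), hx⟩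

end

section

/-! ### The frame rule -/

variable {S : VarSystem.{u}} {E E' : Type u} {k l : ℕ} {M N X Y : Type u}

/-- On the quantum variables in `F`, all slices of `χ` are slices of `ψ` or `0`. -/
def SliceLe (F : Set S.Var) (ψ : L2 (S.QMem × E)) (χ : L2 (S.QMem × E')) : Prop :=
  ∀ p f, (∀ a, χ (ov (qs F) a p, f) = 0) ∨ ∃ p' e, ∀ a, χ (ov (qs F) a p, f) =
    ψ (ov (qs F) a p', e)

theorem sliceLe_refl (F : Set S.Var) (ψ : L2 (S.QMem × E)) : SliceLe F ψ ψ :=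
  fun p f => Or.inr ⟨p, f, fun _ => rfl⟩

/-- Membership in a subspace over `F` is decided by the slices on `F`, and `SliceLe` adds no new
nonzero slices. -/
theorem InPred.of_sliceLe {R : QPred S} {F : Set S.Var} {m₁ m₂ : S.CMem}
    (hR : SpaceOver (R m₁ m₂) F F) {ψ₁ ψ₂ : L2 (S.QMem × E)} {χ₁ χ₂ : L2 (S.QMem × E')}
    (h : InPred R m₁ ψ₁ m₂ ψ₂) (h1 : SliceLe F ψ₁ χ₁) (h2 : SliceLe F ψ₂ χ₂) :
    InPred R m₁ χ₁ m₂ χ₂ := by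
  intro f₁ f₂
  refine hR.mem_of_slices fun b => ?_
  rcases h1 b.1 f₁ with h1 | ⟨p₁, e₁, h1⟩
  · exact Or.inl (sliceAt_eq_zero _ _ fun a => by simp [sliceFst_apply, h1])
  rcases h2 b.2 f₂ with h2 | ⟨p₂, e₂, h2⟩
  · exact Or.inl (sliceAt_eq_zero _ _ fun a => by simp [sliceFst_apply, h2])
  · exact Or.inr ⟨_, h e₁ e₂, (p₁, p₂), sliceAt_ext _ _ fun a => by
      simp [sliceFst_apply, h1, h2]⟩

theorem sliceLe_matUnit {F : Set S.Var} {H : Set S.QVar} (hH : ∀ q ∈ H, Sum.inr q ∉ F)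
    (u w : S.QMem) (ψ : L2 (S.QMem × E)) : SliceLe F ψ (matUnit E H u w ψ) := by
  intro p f
  have h0 : ∀ a, (∀ q ∈ H, ov (qs F) a p q = u q) ↔ ∀ q ∈ H, p q = u q := fun a =>
    forall₂_congr fun q hq => by rw [ov_of_not_mem (show q ∉ qs F from hH q hq)]
  by_cases hp : ∀ q ∈ H, p q = u q
  · refine Or.inr ⟨ov H w p, f, fun a => ?_⟩
    rw [matUnit_apply, if_pos ((h0 a).2 hp)]
    refine congrArg _ (Prod.ext (funext fun q => ?_) rfl)
    by_cases hq : q ∈ H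
    · simp [ov, hq, show q ∉ qs F from hH q hq]
    · simp [ov, hq]
  · exact Or.inl fun a => by rw [matUnit_apply, if_neg fun h => hp ((h0 a).1 h)]

/-- The map cannot increase the trace of any term, and the total trace is unchanged and finite; so
no single term loses trace. -/
theorem theta_fixed {b : S.CMem → Prop} {h : S.CMem → S.CMem} {G : Op (S.QMem × E)}
    (hG : ‖G‖ ≤ 1) {ι : Type u} {m : ι → S.CMem} {ψ : ι → L2 (S.QMem × E)} {ρ : Fam S E}
    (hρ : CQSum (fun i => pure (m i) (ψ i)) ρ) (h0 : theta b h G ρ = ρ) (i : ι) (hi : ψ i ≠ 0) :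
    b (m i) ∧ ‖G (ψ i)‖ = ‖ψ i‖ := by
  have h1 := ((theta_good (b := b) (h := h) hG).sum hρ).etrF_eq
  rw [h0, hρ.etrF_eq] at h1
  have hle : ∀ j, etrF (theta b h G (pure (m j) (ψ j))) ≤ etrF (pure (m j) (ψ j)) := fun j =>
    (theta_good hG).tr _ (isCQ_pure _ _)
  have h2 : etrF (theta b h G (pure (m i) (ψ i))) = etrF (pure (m i) (ψ i)) := by
    refine le_antisymm (hle i) (le_of_not_gt fun hlt => ?_)
    refine (ENNReal.tsum_lt_tsum ?_ hle hlt).ne h1.symm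
    exact h1 ▸ hρ.fin
  rw [theta_pure hG, etrF_pure] at h2
  have hne : ‖ψ i‖ₑ ^ 2 ≠ 0 := pow_ne_zero _ (by simpa using hi)
  by_cases hb : b (m i)
  · rw [if_pos hb, etrF_pure] at h2
    exact ⟨hb, norm_eq_of_enorm_sq h2⟩
  · rw [if_neg hb, etrF_zero] at h2
    exact absurd h2.symm hne

/-- Programs preserve closed subspaces that do not depend on the written variables. -/
theorem denE_invariant {c : Prog S} {F : Set S.Var} (hF : ∀ v ∈ F, v ∉ c.written)
    {N : ClosedSubmodule ℂ (L2 (S.QMem × E))}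
    (hN : ∀ ψ χ : L2 (S.QMem × E), SliceLe F ψ χ → ψ ∈ N → χ ∈ N) {m₀ : S.CMem}
    {ψ₀ : L2 (S.QMem × E)} (hψ₀ : ψ₀ ∈ N) {ι : Type u} {m : ι → S.CMem}
    {ψ : ι → L2 (S.QMem × E)}
    (h : CQSum (fun i => pure (m i) (ψ i)) (denE c E (pure m₀ ψ₀))) (i : ι) (hi : ψ i ≠ 0) :
    (∀ x, Sum.inl x ∈ F → m i x = m₀ x) ∧ ψ i ∈ N := by
  -- `N` is invariant under matrix units on the written variables, and their adjoints are again
  -- matrix units.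
  have hc : Comm c.writtenQ (projOn N) := fun F' hF' u w ψ => by
    have hd : ∀ q ∈ F', Sum.inr q ∉ F := fun q hq hq' => hF _ hq' (hF' hq)
    exact projOn_comm (fun φ ψ => inner_matUnit F' w u φ ψ)
      (fun ψ hψ => hN _ _ (sliceLe_matUnit hd u w ψ) hψ)
      (fun ψ hψ => hN _ _ (sliceLe_matUnit hd w u ψ) hψ) ψ
  -- Filtering by the initial classical values on `F` and projecting onto `N` do nothing to the
  -- input, hence nothing to the output.
  have h1 := denE_theta c (E := E) (b := fun n => ∀ x, Sum.inl x ∈ F → n x = m₀ x) (U := ∅)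
    (a := m₀) (norm_projOn_le (N := N)) (by simp) (fun n n' hn => forall₂_congr fun x hx => by
      rw [hn x (hF _ hx)]) hc (isCQ_pure m₀ ψ₀)
  rw [theta_pure norm_projOn_le, if_pos fun _ _ => rfl, projOn_of_mem hψ₀, ov_empty] at h1
  have h2 := theta_fixed norm_projOn_le h h1.symm i hi
  exact ⟨h2.1, mem_of_norm_projOn h2.2⟩

/-- `R` relates the two sides, but each program acts on one side only. So the sides are treated in
turn, the other vector being kept fixed in the definition of an invariant subspace. -/
theorem XJ.frame {R : QPred S} {F V W : Set S.Var} {c d : Prog S} (hR : R.IsOver F F)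
    (hc : ∀ v ∈ F, v ∉ c.written) (hd : ∀ v ∈ F, v ∉ d.written) (h : XJ ⊤ V W c d) :
    XJ R V W c d := by
  rw [isOver_iff] at hR
  intro E μ hμ m₁ ψ₁ m₂ ψ₂ h1 h2 hG
  obtain ⟨ι, n₁, n₂, φ₁, φ₂, a0, a1, a2⟩ :=
    (h E μ hμ m₁ ψ₁ m₂ ψ₂ h1 h2 hG.top).ne_zero fun _ _ _ _ h => h.norm
  refine ⟨ι, n₁, n₂, φ₁, φ₂, fun i => ?_, a1, a2⟩
  -- The vectors of the first memory that satisfy `R` together with the input `ψ₂` of the second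
  -- program.
  let N₁ : ClosedSubmodule ℂ (L2 (S.QMem × E)) :=
    ⨅ e₁, ⨅ e₂, (R m₁ m₂).comap (tensRight (sliceFst e₂ ψ₂) ∘L sliceFst e₁)
  have hN₁ : ∀ ψ, ψ ∈ N₁ ↔ InPred R m₁ ψ m₂ ψ₂ := fun ψ => by
    simp only [N₁, ClosedSubmodule.mem_iInf, ClosedSubmodule.mem_comap, InPred]
    rfl
  have b1 := denE_invariant hc (fun ψ χ h hψ => (hN₁ χ).2 (((hN₁ ψ).1 hψ).of_sliceLe
    (hR.2 m₁ m₂) h (sliceLe_refl _ _))) ((hN₁ ψ₁).2 hG.pred) a1 i (a0 i).2.1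
  -- Now the output `φ₁ i` of the first program is fixed, and the second program runs.
  let N₂ : ClosedSubmodule ℂ (L2 (S.QMem × E)) :=
    ⨅ e₁, ⨅ e₂, (R m₁ m₂).comap (tensLeft (sliceFst e₁ (φ₁ i)) ∘L sliceFst e₂)
  have hN₂ : ∀ ψ, ψ ∈ N₂ ↔ InPred R m₁ (φ₁ i) m₂ ψ := fun ψ => by
    simp only [N₂, ClosedSubmodule.mem_iInf, ClosedSubmodule.mem_comap, InPred]
    rfl
  have b2 := denE_invariant hd (fun ψ χ h hψ => (hN₂ χ).2 (((hN₂ ψ).1 hψ).of_sliceLe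
    (hR.2 m₁ m₂) (sliceLe_refl _ _) h)) ((hN₂ ψ₂).2 ((hN₁ _).1 b1.2)) a2 i (a0 i).2.2
  refine ⟨(a0 i).1.norm, (a0 i).1.cl, (a0 i).1.rel, ?_⟩
  have h3 : R (n₁ i) (n₂ i) = R m₁ m₂ := hR.1 _ _ _ _ b1.1 b2.1
  unfold InPred
  rw [h3]
  exact (hN₂ _).1 b2.2

/-! ### Local variables -/

theorem PairGood.of_sliceLe {R : QPred S} {F : Set S.Var} (hR : R.IsOver F F) {V W : Set S.Var}
    {μ : E → E → E} {μ' : E' → E' → E'} {m₁ m₂ n₁ n₂ : S.CMem} {ψ₁ ψ₂ : L2 (S.QMem × E)}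
    {χ₁ χ₂ : L2 (S.QMem × E')} (h : PairGood R V μ m₁ ψ₁ m₂ ψ₂) (hn : ‖χ₁‖ = ‖χ₂‖)
    (hcl : ∀ x, Sum.inl x ∈ W → n₁ x = n₂ x) (hrel : Rel (mixX W μ') χ₁ χ₂)
    (h1 : SliceLe F ψ₁ χ₁) (h2 : SliceLe F ψ₂ χ₂) (hn1 : ∀ x, Sum.inl x ∈ F → n₁ x = m₁ x)
    (hn2 : ∀ x, Sum.inl x ∈ F → n₂ x = m₂ x) : PairGood R W μ' n₁ χ₁ n₂ χ₂ := by
  rw [isOver_iff] at hR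
  refine ⟨hn, hcl, hrel, ?_⟩
  have h3 : R n₁ n₂ = R m₁ m₂ := hR.1 _ _ _ _ hn1 hn2
  have h4 := h.pred.of_sliceLe (hR.2 m₁ m₂) h1 h2
  unfold InPred at h4 ⊢
  rwa [h3]

/-- In the scope, `x` has the default value on both sides and counts as equal. Afterwards the saved
values return, and for `x ∈ W` they agree because `x ∈ V`. -/
theorem XJ.loc_inl {R : QPred S} {F V W : Set S.Var} {c d : Prog S} {x : S.CVar}
    (hR : R.IsOver F F) (hx : Sum.inl x ∉ F) (hW : Sum.inl x ∈ W → Sum.inl x ∈ V)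
    (h : XJ R (V ∪ {Sum.inl x}) (W ∪ {Sum.inl x}) c d) :
    XJ R V W (.loc (.inl x) c) (.loc (.inl x) d) := by
  intro E μ hμ m₁ ψ₁ m₂ ψ₂ h1 h2 hG
  have hne : ∀ y, Sum.inl y ∈ F → y ≠ x := by
    rintro y hy rfl
    exact hx hy
  have hmix : ∀ V : Set S.Var, mixX (S := S) (V ∪ {Sum.inl x}) μ = mixX V μ := fun V =>
    mixX_congr (fun q => by simp) μ
  rw [denE_loc_inl_pure, denE_loc_inl_pure]
  have h3 : PairGood R (V ∪ {Sum.inl x}) μ (Function.update m₁ x (S.cinit x)) ψ₁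
      (Function.update m₂ x (S.cinit x)) ψ₂ := by
    refine hG.of_sliceLe hR hG.norm (fun y hy => ?_) (hmix V ▸ hG.rel) (sliceLe_refl _ _)
      (sliceLe_refl _ _) (fun y hy => Function.update_of_ne (hne y hy) _ _)
      (fun y hy => Function.update_of_ne (hne y hy) _ _)
    by_cases hyx : y = x
    · subst hyx; simp
    · rw [Function.update_of_ne hyx, Function.update_of_ne hyx]
      exact hG.cl y (hy.resolve_right fun h => hyx (Sum.inl_injective h))
  refine (h E μ hμ _ _ _ _ h1 h2 h3).bind (cset₁_good x _) (cset₁_good x _)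
    fun n₁ φ₁ n₂ φ₂ h4 => ?_
  rw [cset₁_pure, cset₁_pure]
  refine Cpl.pure (h4.of_sliceLe hR h4.norm (fun y hy => ?_) (hmix W ▸ h4.rel) (sliceLe_refl _ _)
      (sliceLe_refl _ _) (fun y hy => Function.update_of_ne (hne y hy) _ _)
      (fun y hy => Function.update_of_ne (hne y hy) _ _))
  by_cases hyx : y = x
  · subst hyx
    rw [Function.update_self, Function.update_self]
    exact hG.cl y (hW hy)
  · rw [Function.update_of_ne hyx, Function.update_of_ne hyx]
    exact h4.cl y (Or.inl hy)

theorem norm_locIn (q : S.QVar) (ψ : L2 (S.QMem × E)) : ‖locIn E q ψ‖ = ‖ψ‖ := by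
  refine norm_prel_eq _ _ _ _ fun x _ => ?_
  refine ⟨(Function.update x.1 q (S.qinit q), (x.2, x.1 q)), ?_, ?_⟩
  · simp
  · simp

theorem update_ov_not_mem {V : Type u} {τ : V → Type u} {F : Set V} {q : V} (hq : q ∉ F)
    (a p : ∀ v, τ v) (t : τ q) :
    ov F a (Function.update p q t) = Function.update (ov F a p) q t := by
  funext v
  by_cases hv : v = q
  · subst hv; simp [ov, hq]
  · by_cases hF : v ∈ F <;> simp [ov, hF, hv]

theorem sliceLe_locIn {F : Set S.Var} {q : S.QVar} (hq : Sum.inr q ∉ F) (ψ : L2 (S.QMem × E)) :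
    SliceLe F ψ (locIn E q ψ) := by
  rintro p ⟨e, t⟩
  have hq' : q ∉ qs F := hq
  by_cases hp : p q = S.qinit q
  · refine Or.inr ⟨Function.update p q t, e, fun a => ?_⟩
    rw [locIn_apply, ov_of_not_mem hq', if_pos hp, update_ov_not_mem hq']
  · exact Or.inl fun a => by rw [locIn_apply, ov_of_not_mem hq', if_neg hp]

theorem sliceLe_locOut {F : Set S.Var} {q : S.QVar} (hq : Sum.inr q ∉ F) (b : S.qtyp q)
    (ψ : L2 (S.QMem × (E × S.qtyp q))) : SliceLe F ψ (locOut E q b ψ) := by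
  intro p e
  have hq' : q ∉ qs F := hq
  refine Or.inr ⟨Function.update p q b, (e, p q), fun a => ?_⟩
  rw [locOut_apply, ov_of_not_mem hq', update_ov_not_mem hq']

/-- The register that holds the old value of a local variable. -/
def mixR {Q : Type u} (eq : Prop) (μ : E → E → E) (x y : E × Q) : E × Q :=
  (μ x.1 y.1, if eq then y.2 else x.2)

theorem RectBand.mixR {Q : Type u} (eq : Prop) {μ : E → E → E} (hμ : RectBand μ) :
    RectBand (mixR (Q := Q) eq μ) where
  self x := Prod.ext (hμ.self _) (by simp [QRHL.mixR])
  left x y z := Prod.ext (hμ.left _ _ _) (by by_cases h : eq <;> simp [QRHL.mixR, h])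
  right x y z := Prod.ext (hμ.right _ _ _) (by by_cases h : eq <;> simp [QRHL.mixR, h])

/-- The local `q` is equal on both sides in any case, having its default value. The saved value
belongs to the compared part of the register exactly when `q ∈ V`. -/
theorem rel_locIn {V : Set S.Var} {μ : E → E → E} {q : S.QVar} {ψ₁ ψ₂ : L2 (S.QMem × E)}
    (h : Rel (mixX V μ) ψ₁ ψ₂) :
    Rel (mixX (V ∪ {Sum.inr q}) (mixR (Sum.inr q ∈ V) μ)) (locIn E q ψ₁) (locIn E q ψ₂) := by
  rintro ⟨p, e, t⟩ ⟨p', e', t'⟩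
  have e1 : ∀ p p' : S.QMem, ov {r | Sum.inr r ∈ V ∪ {Sum.inr q}} p' p q = p' q := fun p p' =>
    ov_of_mem (F := {r : S.QVar | Sum.inr r ∈ V ∪ {Sum.inr q}}) (Or.inr rfl)
  have e2 : ∀ (p p' : S.QMem) (t t' : S.qtyp q),
      Function.update (ov {r | Sum.inr r ∈ V ∪ {Sum.inr q}} p' p) q
        (if Sum.inr q ∈ V then t' else t) =
      ov {r | Sum.inr r ∈ V} (Function.update p' q t') (Function.update p q t) := by
    intro p p' t t'
    funext r
    by_cases hr : r = q
    · subst hr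
      by_cases hV : Sum.inr r ∈ V <;> simp [ov, hV]
    · by_cases hV : Sum.inr r ∈ V <;> simp [ov, hV, hr]
  simp only [mixX, mixR, locIn_apply, e1, e2]
  by_cases h1 : p q = S.qinit q <;> by_cases h2 : p' q = S.qinit q
  · simp only [h1, h2, if_true]
    exact h (Function.update p q t, e) (Function.update p' q t', e')
  all_goals simp [h1, h2]

theorem rel_locOut {W : Set S.Var} {μ : E → E → E} {q : S.QVar}
    {ψ₁ ψ₂ : L2 (S.QMem × (E × S.qtyp q))}
    (h : Rel (mixX (W ∪ {Sum.inr q}) (mixR (Sum.inr q ∈ W) μ)) ψ₁ ψ₂) (b : S.qtyp q) :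
    Rel (mixX W μ) (locOut E q b ψ₁) (locOut E q b ψ₂) := by
  rintro ⟨p, e⟩ ⟨p', e'⟩
  have e1 : ∀ p p' : S.QMem, Function.update (ov {r | Sum.inr r ∈ W} p' p) q b =
      ov {r | Sum.inr r ∈ W ∪ {Sum.inr q}} (Function.update p' q b) (Function.update p q b) := by
    intro p p'
    funext r
    by_cases hr : r = q
    · subst hr
      by_cases hV : Sum.inr r ∈ W <;> simp [ov]
    · by_cases hV : Sum.inr r ∈ W <;> simp [ov, hV, hr]
  have e2 : ∀ p p' : S.QMem, ov {r | Sum.inr r ∈ W} p' p q =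
      if Sum.inr q ∈ W then p' q else p q := fun p p' => rfl
  simp only [mixX, locOut_apply, e1, e2]
  exact h (Function.update p q b, (e, p q)) (Function.update p' q b, (e', p' q))

/-- The norm of `locOut` is that of the component in which the local `q` has the value `b`. Written
with a matrix unit, this is an operator on the equal variable `q`, to which `Loc.norm` applies. -/
theorem norm_locOut (q : S.QVar) (b : S.qtyp q) (ψ : L2 (S.QMem × (E × S.qtyp q))) :
    ‖locOut E q b ψ‖ = ‖matUnit _ {q} (fun r => if h : r = q then h ▸ b else S.qinit r)
      (fun r => if h : r = q then h ▸ b else S.qinit r) ψ‖ := by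
  have h1 : locOut E q b ψ = locOut E q b (matUnit _ {q}
      (fun r => if h : r = q then h ▸ b else S.qinit r)
      (fun r => if h : r = q then h ▸ b else S.qinit r) ψ) := by
    ext ⟨p, e⟩
    rw [locOut_apply, locOut_apply, matUnit_apply, if_pos]
    · refine congrArg _ (Prod.ext (funext fun r => ?_) rfl)
      by_cases hr : r = q
      · subst hr; simp [ov]
      · simp [ov, hr]
    · rintro _ rfl
      simp
  rw [h1]
  refine norm_prel_eq _ _ _ _ ?_
  rintro ⟨p, e, t⟩ hp
  refine ⟨(Function.update p q t, e), trivial, ?_⟩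
  have : p q = b := by
    by_contra hne
    apply hp
    rw [matUnit_apply, if_neg]
    intro h
    exact hne (by simpa using h q rfl)
  simp [← this]

theorem loc_matUnit_self {V : Set S.Var} {μ : E → E → E} {H : Set S.QVar}
    (hH : ∀ q ∈ H, Sum.inr q ∈ V) (u : S.QMem) : Loc (mixX V μ) (matUnit E H u u) := by
  rintro ψ₁ ψ₂ h ⟨p, e⟩ ⟨p', e'⟩
  have h1 : mixX V μ (p', e') (p, e) = (ov {q | Sum.inr q ∈ V} p p', μ e' e) := rfl
  rw [h1, matUnit_apply, matUnit_apply]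
  have h2 : (∀ q ∈ H, ov {q | Sum.inr q ∈ V} p p' q = u q) ↔ ∀ q ∈ H, p q = u q :=
    forall₂_congr fun q hq => by
      rw [ov_of_mem (show q ∈ {q | Sum.inr q ∈ V} from hH q hq)]
  simp only [h2]
  by_cases hp : ∀ q ∈ H, p q = u q
  · rw [if_pos hp, if_pos hp, ov_eq_of_eqOn hp, ov_eq_of_eqOn (h2.2 hp)]
    exact h (p, e) (p', e')
  · rw [if_neg hp, if_neg hp, zero_mul, mul_zero]

/-- The discarded value `b` of the local `q` is matched with itself on both sides, which is possible
because `q` is equal throughout the scope. The band on the register is the same on entry and exit,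
so `q` must belong to both or neither of `V` and `W`. -/
theorem XJ.loc_inr {R : QPred S} {F V W : Set S.Var} {c d : Prog S} {q : S.QVar}
    (hR : R.IsOver F F) (hq : Sum.inr q ∉ F) (hVW : Sum.inr q ∈ V ↔ Sum.inr q ∈ W)
    (h : XJ R (V ∪ {Sum.inr q}) (W ∪ {Sum.inr q}) c d) :
    XJ R V W (.loc (.inr q) c) (.loc (.inr q) d) := by
  intro E μ hμ m₁ ψ₁ m₂ ψ₂ h1 h2 hG
  rw [denE_loc_inr_pure, denE_loc_inr_pure]
  have hμ' : RectBand (mixR (Q := S.qtyp q) (Sum.inr q ∈ V) μ) := hμ.mixR _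
  have h3 : PairGood R (V ∪ {Sum.inr q}) (mixR (Sum.inr q ∈ V) μ) m₁ (locIn E q ψ₁) m₂
      (locIn E q ψ₂) := by
    refine hG.of_sliceLe hR ?_ (fun y hy => hG.cl y (hy.resolve_right (by simp)))
      (rel_locIn hG.rel) (sliceLe_locIn hq _) (sliceLe_locIn hq _) (fun _ _ => rfl)
      (fun _ _ => rfl)
    rw [norm_locIn, norm_locIn, hG.norm]
  have hne : ∀ ψ : L2 (S.QMem × E), ψ ≠ 0 → locIn E q ψ ≠ 0 := fun ψ hψ => by
    rw [← norm_ne_zero_iff, norm_locIn]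
    exact norm_ne_zero_iff.2 hψ
  have hle := fun (_ : S.CMem) (ψ : L2 (S.QMem × (E × S.qtyp q))) => tsum_locOut_le q ψ
  refine ((h _ _ hμ' _ _ _ _ (hne _ h1) (hne _ h2) h3).ne_zero fun _ _ _ _ h => h.norm).bind
    (kraus_good hle) (kraus_good hle) fun n₁ φ₁ n₂ φ₂ h4 => ?_
  refine kraus_cpl hle hle fun b => ?_
  refine h4.1.of_sliceLe hR ?_ (fun y hy => h4.1.cl y (Or.inl hy)) (rel_locOut ?_ b)
    (sliceLe_locOut hq b _) (sliceLe_locOut hq b _) (fun _ _ => rfl) (fun _ _ => rfl)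
  · rw [norm_locOut, norm_locOut]
    have h5 := (loc_matUnit_self (V := W ∪ {Sum.inr q}) (μ := mixR (Sum.inr q ∈ V) μ) (H := {q})
      (fun r hr => Or.inr (congrArg _ hr)) (fun r => if h : r = q then h ▸ b else S.qinit r)).norm
      (hμ'.mixX _) h4.1.rel
    rw [← h4.1.norm, mul_comm] at h5
    exact mul_left_cancel₀ (norm_ne_zero_iff.2 h4.2.1) h5
  · have h5 := h4.1.rel
    simp only [hVW] at h5
    exact h5

end

section

/-! ### Marginals -/

variable {S : VarSystem.{u}} {E E' : Type u} {k l : ℕ} {M N X Y : Type u}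

theorem tens_hasSum {ι κ : Type*} {f : ι → Op X} {g : κ → Op Y} {A : Op X} {B : Op Y}
    {C : Op (X × Y)} (hf : HasSum f A) (hg : HasSum g B)
    (h : HasSum (fun p : ι × κ => tensor (f p.1) (g p.2)) C) : C = tensor A B := by
  refine ext_ket fun ⟨x, y⟩ => ?_
  ext ⟨x', y'⟩
  have h1 := hasSum_apply (hasSum_op_apply h (ket (x, y))) (x', y')
  have h2 : ∀ (A : Op X) (B : Op Y),
      tensor A B (ket (x, y)) (x', y') = A (ket x) x' * B (ket y) y' := fun A B => by
    rw [ket_prod, tensor_tens, tens_apply]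
  rw [h2]
  refine h1.unique ?_
  have h3 := hasSum_mul_prod (hasSum_apply (hasSum_op_apply hf (ket x)) x')
    (hasSum_apply (hasSum_op_apply hg (ket y)) y')
  convert h3 using 2 with p
  exact h2 _ _

theorem tensor_zero_left (B : Op Y) : tensor (0 : Op X) B = 0 := by
  rw [← proj_zero, tensor_proj_left]
  refine ContinuousLinearMap.ext fun ψ => ?_
  ext p
  simp [conj, tensLeft, tens_zero_left]

theorem tensor_zero_right (A : Op X) : tensor A (0 : Op Y) = 0 := by
  rw [← proj_zero, tensor_proj_right]
  refine ContinuousLinearMap.ext fun ψ => ?_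
  ext p
  simp [conj, tensRight, tens_zero_right]

theorem tensor_pure (m : M) (n : N) (ψ : L2 X) (φ : L2 Y) (m' : M) (n' : N) :
    tensor (pure m ψ m') (pure n φ n') = pure (m, n) (tens ψ φ) (m', n') := by
  by_cases h1 : m = m' <;> by_cases h2 : n = n' <;>
    simp [pure, single, h1, h2, tensor_proj_proj, tensor_zero_left, tensor_zero_right]

theorem cqSum_tensor {ι κ : Type*} {m : ι → M} {n : κ → N} {ψ : ι → L2 X} {φ : κ → L2 Y}
    {σ : M → Op X} {τ : N → Op Y} (hσ : CQSum (fun i => pure (m i) (ψ i)) σ)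
    (hτ : CQSum (fun i => pure (n i) (φ i)) τ) :
    CQSum (fun p : ι × κ => pure (m p.1, n p.2) (tens (ψ p.1) (φ p.2)))
      fun p : M × N => tensor (σ p.1) (τ p.2) := by
  have fin : ∑' p : ι × κ, etrF (pure (m p.1, n p.2) (tens (ψ p.1) (φ p.2))) ≠ ∞ := by
    simp_rw [etrF_pure, enorm_tens]
    rw [ENNReal.tsum_prod (f := fun i j => ‖ψ i‖ₑ ^ 2 * ‖φ j‖ₑ ^ 2)]
    simp_rw [ENNReal.tsum_mul_left, ENNReal.tsum_mul_right]
    refine ENNReal.mul_ne_top ?_ ?_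
    · simpa only [etrF_pure] using hσ.fin
    · simpa only [etrF_pure] using hτ.fin
  have h := CQSum.mk' (fun _ => isCQ_pure _ _) fin
  convert h using 2 with p
  refine (tens_hasSum (hσ.sum p.1) (hτ.sum p.2) ?_).symm
  simp_rw [tensor_pure]
  exact h.sum p

theorem slice_le₁ (_m : M) (ψ : L2 (X × Y)) : ∑' y, ‖sliceFst y ψ‖ₑ ^ 2 ≤ ‖ψ‖ₑ ^ 2 :=
  (tsum_enorm_sliceFst ψ).le

theorem slice_le₂ (_m : M) (ψ : L2 (X × Y)) : ∑' x, ‖sliceSnd x ψ‖ₑ ^ 2 ≤ ‖ψ‖ₑ ^ 2 :=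
  (tsum_enorm_sliceSnd ψ).le

theorem marg₁_eq {ρ : Fam2 S} (hρ : IsCQ ρ) :
    marg₁ ρ = kraus (fun _ m => m.1) (fun y _ => sliceFst y) ρ := by
  funext n
  rw [tsum_kraus_prod slice_le₁ hρ]
  let e : S.CMem → S.CMem × S.CMem := fun m₂ => (n, m₂)
  have he : Function.Injective e := fun _ _ h => (Prod.mk.inj h).2
  rw [← he.tsum_eq]
  · refine tsum_congr fun m₂ => ?_
    rw [ptraceSnd_eq]
    simp [e, single]
  · rintro ⟨m₁, m₂⟩ h
    by_cases hm : m₁ = n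
    · exact ⟨m₂, congrArg (·, m₂) hm.symm⟩
    · simp [single, hm] at h

theorem marg₂_eq {ρ : Fam2 S} (hρ : IsCQ ρ) :
    marg₂ ρ = kraus (fun _ m => m.2) (fun x _ => sliceSnd x) ρ := by
  funext n
  rw [tsum_kraus_prod slice_le₂ hρ]
  let e : S.CMem → S.CMem × S.CMem := fun m₁ => (m₁, n)
  have he : Function.Injective e := fun _ _ h => (Prod.mk.inj h).1
  rw [← he.tsum_eq]
  · refine tsum_congr fun m₂ => ?_
    rw [ptraceFst_eq]
    simp [e, single]
  · rintro ⟨m₁, m₂⟩ h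
    by_cases hm : m₂ = n
    · exact ⟨m₁, congrArg (m₁, ·) hm.symm⟩
    · simp [single, hm] at h

theorem marg₁_good : Good (marg₁ (S := S)) :=
  (kraus_good slice_le₁).congr fun _ hρ => (marg₁_eq hρ).symm

theorem marg₂_good : Good (marg₂ (S := S)) :=
  (kraus_good slice_le₂).congr fun _ hρ => (marg₂_eq hρ).symm

theorem marg₁_pure (m : S.CMem × S.CMem) (ψ φ : L2 S.QMem) :
    marg₁ (pure m (tens ψ φ)) = pure m.1 ((‖φ‖ : ℂ) • ψ) := by
  rw [marg₁_eq (isCQ_pure _ _)]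
  refine (kraus_pure slice_le₁ m _).unique ?_
  have h1 := cqSum_smul (c := fun y => φ y) (r := ‖φ‖) (by
    rw [L2.norm_sq]; exact (L2.summable_sq φ).hasSum) m.1 ψ
  refine h1.congr fun y => ?_
  congr 1
  ext x
  simp [sliceFst_apply, mul_comm]

theorem marg₂_pure (m : S.CMem × S.CMem) (ψ φ : L2 S.QMem) :
    marg₂ (pure m (tens ψ φ)) = pure m.2 ((‖ψ‖ : ℂ) • φ) := by
  rw [marg₂_eq (isCQ_pure _ _)]
  refine (kraus_pure slice_le₂ m _).unique ?_
  have h1 := cqSum_smul (c := fun y => ψ y) (r := ‖ψ‖) (by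
    rw [L2.norm_sq]; exact (L2.summable_sq ψ).hasSum) m.2 φ
  refine h1.congr fun y => ?_
  congr 1

/-! ### Separable states -/

/-- Let `w` be the part of `v i` orthogonal to `N`. The range of `A` lies in `N`, so `0 = ⟨w, A w⟩ =
∑ |⟨v j, w⟩|²`, whence `⟨v i, w⟩ = ‖w‖² = 0`. -/
theorem mem_of_supp {ι : Type*} {v : ι → L2 X} {A : Op X} (h : HasSum (fun i => proj (v i)) A)
    {N : ClosedSubmodule ℂ (L2 X)} (hN : supp A ≤ N) (i : ι) : v i ∈ N := by
  have hA : A.IsPositive := isPositive_of_hasSum h fun i => proj_isPositive _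
  set w := v i - projOn N (v i) with hw
  have hrange : ∀ x, A x ∈ N := fun x =>
    hN (Submodule.closure_le.1 (le_refl (LinearMap.range A.toLinearMap).closure)
      (LinearMap.mem_range_self A.toLinearMap x))
  have h1 : inner ℂ (A w) w = 0 := inner_sub_projOn (v i) (hrange w)
  have h2 : HasSum (fun j => ((‖inner ℂ (v j) w‖ ^ 2 : ℝ) : ℂ)) 0 := by
    have h3 := (hasSum_op_apply h w).mapL (innerSL ℂ w)
    have h4 : innerSL ℂ w (A w) = 0 := by
      rw [innerSL_apply_apply, ← inner_conj_symm, h1, map_zero]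
    rw [h4] at h3
    refine h3.congr_fun fun j => ?_
    rw [innerSL_apply_apply, proj_apply, inner_smul_right, ← inner_conj_symm w (v j),
      Complex.mul_conj']
    push_cast
    rfl
  have h3 : HasSum (fun j => ‖inner ℂ (v j) w‖ ^ 2) 0 := by
    exact_mod_cast Complex.hasSum_ofReal.1 (by simpa using h2)
  have h4 := congrFun ((hasSum_zero_iff_of_nonneg fun j => sq_nonneg _).1 h3) i
  have h5 : inner ℂ (v i) w = 0 := by simpa using h4
  have h6 : inner ℂ w w = 0 := by
    nth_rewrite 1 [hw]
    rw [inner_sub_left, h5, inner_sub_projOn (v i) (projOn_mem (v i)), sub_zero]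
  rw [inner_self_eq_zero] at h6
  rw [sub_eq_zero.1 h6]
  exact projOn_mem _

theorem supp_le_of_hasSum {ι : Type*} {v : ι → L2 X} {A : Op X}
    (h : HasSum (fun i => proj (v i)) A) {N : ClosedSubmodule ℂ (L2 X)} (hv : ∀ i, v i ∈ N) :
    supp A ≤ N := by
  refine Submodule.closure_le.2 ?_
  rintro _ ⟨x, rfl⟩
  refine N.isClosed.mem_of_tendsto (hasSum_op_apply h x)
    (Filter.Eventually.of_forall fun s => N.toSubmodule.sum_mem fun i _ => ?_)
  rw [proj_apply]
  exact N.smul_mem _ (hv i)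

/-- Two pure states with norm `1` up to a common factor that satisfy `A`. -/
def PairIn (A : QPred S) (m₁ : S.CMem) (ψ₁ : L2 S.QMem) (m₂ : S.CMem) (ψ₂ : L2 S.QMem) : Prop :=
  ‖ψ₁‖ = ‖ψ₂‖ ∧ tens ψ₁ ψ₂ ∈ A m₁ m₂

/-- Decompose all factors into pure states; each resulting product vector lies in `A` by
`mem_of_supp`. The marginals of `ψ ⊗ φ` are `‖φ‖ • ψ` and `‖ψ‖ • φ`, which have equal norm. -/
theorem cpl_of_isSeparable {A : QPred S} {ρ : Fam2 S} (hρ : IsCQ ρ) (hs : IsSeparable ρ)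
    (hA : Satisfies ρ A) : Cpl (PairIn A) (marg₁ ρ) (marg₂ ρ) := by
  obtain ⟨σ, τ, hσ, hτ, hsum⟩ := hs
  choose ψ hψ using fun i => (hσ i).exists_pure
  choose φ hφ using fun i => (hτ i).exists_pure
  have h1 := fun i => cqSum_tensor (hψ i) (hφ i)
  have h2 : CQSum (fun (i : ULift.{u} ℕ) (p : S.CMem × S.CMem) =>
      tensor (σ i.down p.1) (τ i.down p.2)) ρ := by
    refine CQSum.comp_equiv (f := fun (i : ℕ) (p : S.CMem × S.CMem) =>
      tensor (σ i p.1) (τ i p.2)) ⟨fun i => (h1 i).isCQ, ?_, fun p => hsum p.1 p.2⟩ Equiv.ulift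
    have h3 : etrF ρ = ∑' i, etrF (fun p : S.CMem × S.CMem => tensor (σ i p.1) (τ i p.2)) := by
      unfold etrF
      rw [ENNReal.tsum_comm]
      exact tsum_congr fun m => etr_hasSum (hsum m.1 m.2) fun i => (h1 i).isCQ.pos m
    rw [← h3]
    exact hρ.ne_top
  have h3 := h2.prod fun i => h1 i.down
  refine ⟨ULift.{u} ℕ × ((S.CMem × S.QMem) × (S.CMem × S.QMem)), fun p => p.2.1.1, fun p => p.2.2.1, fun p => (‖φ p.1.down p.2.2.1 p.2.2.2‖ : ℂ) •
    ψ p.1.down p.2.1.1 p.2.1.2, fun p => (‖ψ p.1.down p.2.1.1 p.2.1.2‖ : ℂ) •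
    φ p.1.down p.2.2.1 p.2.2.2, fun p => ⟨?_, ?_⟩, ?_, ?_⟩
  · simp only [norm_smul, Complex.norm_real, norm_norm]
    ring
  · rw [tens_smul_smul]
    refine (A p.2.1.1 p.2.2.1).smul_mem _ ?_
    have h4 := h3.sum (p.2.1.1, p.2.2.1)
    have h5 : ∀ q : ULift.{u} ℕ × ((S.CMem × S.QMem) × (S.CMem × S.QMem)),
        pure (q.2.1.1, q.2.2.1) (tens (ψ q.1.down q.2.1.1 q.2.1.2) (φ q.1.down q.2.2.1 q.2.2.2))
          (p.2.1.1, p.2.2.1) =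
        proj (if (q.2.1.1, q.2.2.1) = (p.2.1.1, p.2.2.1) then
          tens (ψ q.1.down q.2.1.1 q.2.1.2) (φ q.1.down q.2.2.1 q.2.2.2) else 0) := by
      intro q
      rw [pure, single]
      split_ifs
      · rfl
      · exact proj_zero.symm
    simp_rw [h5] at h4
    have h6 := mem_of_supp h4 (hA _ _) p
    simpa using h6
  · exact (marg₁_good.sum h3).congr fun p => marg₁_pure _ _ _
  · exact (marg₂_good.sum h3).congr fun p => marg₂_pure _ _ _

theorem isSeparable_of_cpl {A : QPred S} {ρ₁ ρ₂ : S.CMem → Op S.QMem}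
    (h : Cpl (PairIn A) ρ₁ ρ₂) : ∃ ρ : Fam2 S, IsCQ ρ ∧ IsSeparable ρ ∧ Satisfies ρ A ∧
      marg₁ ρ = ρ₁ ∧ marg₂ ρ = ρ₂ := by
  obtain ⟨ι, m₁, m₂, ψ₁, ψ₂, h0, h1, h2⟩ := h.ne_zero fun _ _ _ _ h => h.1
  -- After removing zero terms, finiteness of the total trace forces the index set to be countable,
  -- as separability requires.
  have hc : Countable ι := by
    have h3 := h1.fin
    simp_rw [etrF_pure] at h3
    have h4 := Summable.countable_support_ennreal h3
    rw [← Set.countable_univ_iff]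
    refine h4.mono fun i _ => ?_
    simpa using (h0 i).2.1
  -- One factor is normalized, so that the product has norm `‖ψ₁ i‖ = ‖ψ₂ i‖` and the right
  -- marginals.
  let χ : ι → L2 S.QMem := fun i => ((‖ψ₁ i‖⁻¹ : ℝ) : ℂ) • ψ₁ i
  have hχ : ∀ i, ‖χ i‖ = 1 := fun i => by
    simp only [χ, norm_smul, Complex.norm_real, norm_inv, norm_norm]
    exact inv_mul_cancel₀ (norm_ne_zero_iff.2 (h0 i).2.1)
  have fin : ∑' i, etrF (pure (m₁ i, m₂ i) (tens (χ i) (ψ₂ i))) ≠ ∞ := by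
    have h3 := h2.fin
    simp_rw [etrF_pure] at h3 ⊢
    have : ∀ i, ‖χ i‖ₑ = 1 := fun i => by
      rw [← ofReal_norm, hχ, ENNReal.ofReal_one]
    simpa [enorm_tens, this] using h3
  have h3 := CQSum.mk' (fun _ => isCQ_pure _ _) fin
  set ρ : Fam2 S := fun m => ∑' i, pure (m₁ i, m₂ i) (tens (χ i) (ψ₂ i)) m with hρ
  have hinv : ∀ i, ((‖ψ₁ i‖ : ℝ) : ℂ) • χ i = ψ₁ i := fun i => by
    simp only [χ, smul_smul]
    rw [← Complex.ofReal_mul, mul_inv_cancel₀ (norm_ne_zero_iff.2 (h0 i).2.1)]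
    simp
  refine ⟨ρ, h3.isCQ, ?_, fun n₁ n₂ => ?_, ?_, ?_⟩
  · obtain ⟨f, hf⟩ := hc.exists_injective_nat
    refine ⟨Function.extend f (fun i => pure (m₁ i) (χ i)) 0,
      Function.extend f (fun i => pure (m₂ i) (ψ₂ i)) 0, fun j => ?_, fun j => ?_,
      fun n₁ n₂ => ?_⟩
    · by_cases hj : ∃ i, f i = j
      · obtain ⟨i, rfl⟩ := hj
        rw [hf.extend_apply]
        exact isCQ_pure _ _
      · rw [Function.extend_apply' _ _ _ hj]
        exact isCQ_zero
    · by_cases hj : ∃ i, f i = j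
      · obtain ⟨i, rfl⟩ := hj
        rw [hf.extend_apply]
        exact isCQ_pure _ _
      · rw [Function.extend_apply' _ _ _ hj]
        exact isCQ_zero
    · refine (hf.hasSum_iff fun j hj => ?_).1 ?_
      · have hj' : ¬ ∃ i, f i = j := hj
        rw [Function.extend_apply' _ _ _ hj']
        exact tensor_zero_left _
      · refine (h3.sum (n₁, n₂)).congr_fun fun i => ?_
        simp only [Function.comp, hf.extend_apply]
        exact (tensor_pure _ _ _ _ _ _)
  · have h4 := h3.sum (n₁, n₂)
    have h5 : ∀ i, pure (m₁ i, m₂ i) (tens (χ i) (ψ₂ i)) (n₁, n₂) =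
        proj (if (m₁ i, m₂ i) = (n₁, n₂) then tens (χ i) (ψ₂ i) else 0) := by
      intro i
      rw [pure, single]
      split_ifs
      · rfl
      · exact proj_zero.symm
    simp_rw [h5] at h4
    refine supp_le_of_hasSum h4 fun i => ?_
    split_ifs with hi
    · obtain ⟨rfl, rfl⟩ := Prod.mk.inj hi
      simp only [χ, tens_smul_left]
      exact (A _ _).smul_mem _ (h0 i).1.2
    · exact (A n₁ n₂).zero_mem
  · refine (marg₁_good.sum h3).unique (h1.congr fun i => ?_)
    rw [marg₁_pure, ← (h0 i).1.1, hinv]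
  · refine (marg₂_good.sum h3).unique (h2.congr fun i => ?_)
    rw [marg₂_pure, hχ]
    simp

end

section

/-! ### Judgments and pure states with a register -/

variable {S : VarSystem.{u}} {E E' : Type u} {k l : ℕ} {M N X Y : Type u}

/-- Adding a trivial register. -/
def toReg (S : VarSystem.{u}) : L2 S.QMem →L[ℂ] L2 (S.QMem × PUnit.{u + 1}) :=
  pull (Equiv.prodPUnit S.QMem).toEmbedding

/-- Removing a trivial register. -/
def fromReg (S : VarSystem.{u}) : L2 (S.QMem × PUnit.{u + 1}) →L[ℂ] L2 S.QMem :=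
  pull (Equiv.prodPUnit S.QMem).symm.toEmbedding

theorem enorm_toReg (_m : S.CMem) (ψ : L2 S.QMem) : ‖toReg S ψ‖ₑ ^ 2 ≤ ‖ψ‖ₑ ^ 2 :=
  (enorm_pull_equiv _ ψ).le

theorem enorm_fromReg (_m : S.CMem) (ψ : L2 (S.QMem × PUnit.{u + 1})) :
    ‖fromReg S ψ‖ₑ ^ 2 ≤ ‖ψ‖ₑ ^ 2 :=
  (enorm_pull_equiv _ ψ).le

theorem norm_toReg (ψ : L2 S.QMem) : ‖toReg S ψ‖ = ‖ψ‖ :=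
  norm_eq_of_enorm_sq (enorm_pull_equiv _ ψ)

theorem norm_fromReg (ψ : L2 (S.QMem × PUnit.{u + 1})) : ‖fromReg S ψ‖ = ‖ψ‖ :=
  norm_eq_of_enorm_sq (enorm_pull_equiv _ ψ)

theorem toReg_fromReg (ψ : L2 (S.QMem × PUnit.{u + 1})) : toReg S (fromReg S ψ) = ψ := rfl

theorem den_eq (c : Prog S) (ρ : S.CMem → Op S.QMem) :
    den c ρ = kraus₁ (fun m => m) (fun _ => fromReg S)
      (denE c PUnit (kraus₁ (fun m => m) (fun _ => toReg S) ρ)) := by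
  funext m
  rw [kraus₁_id_apply, den, reindex_eq_conj]
  unfold fromReg
  congr 3
  funext m'
  rw [kraus₁_id_apply, reindex_eq_conj]
  rfl

theorem toReg_den (c : Prog S) {ρ : S.CMem → Op S.QMem} (hρ : IsCQ ρ) :
    kraus₁ (fun m => m) (fun _ => toReg S) (den c ρ) =
      denE c PUnit (kraus₁ (fun m => m) (fun _ => toReg S) ρ) := by
  rw [den_eq]
  refine Good.ext (Φ := fun σ => kraus₁ (fun m => m) (fun _ => toReg S)
    (kraus₁ (fun m => m) (fun _ => fromReg S) σ))
    ((kraus₁_good enorm_toReg).comp (kraus₁_good enorm_fromReg)) Good.id (fun m ψ => ?_)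
    ((denE_good c _).cq ((kraus₁_good enorm_toReg).cq hρ))
  rw [kraus₁_pure enorm_fromReg, kraus₁_pure enorm_toReg, toReg_fromReg]

/-- The combination of trivial registers. -/
def mixUnit (_ _ : PUnit.{u + 1}) : PUnit.{u + 1} := ⟨⟩

theorem rectBand_mixUnit : RectBand mixUnit.{u} := ⟨fun _ => rfl, fun _ _ _ => rfl, fun _ _ _ => rfl⟩

theorem pairGood_of_pairIn {R : QPred S} {V : Set S.Var} {m₁ m₂ : S.CMem} {ψ₁ ψ₂ : L2 S.QMem}
    (h : PairIn (R ⊓ eqv V) m₁ ψ₁ m₂ ψ₂) (h1 : ψ₁ ≠ 0) (h2 : ψ₂ ≠ 0) :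
    PairGood R V mixUnit m₁ (toReg S ψ₁) m₂ (toReg S ψ₂) := by
  obtain ⟨hn, hR, hq, hC⟩ := h
  refine ⟨by rw [norm_toReg, norm_toReg, hn], ?_, ?_, fun _ _ => hR⟩
  -- If the classical values differed, the predicate would be the zero space, and the product of
  -- nonzero vectors would vanish.
  · by_contra hc
    rw [CL, if_neg hc] at hC
    have h3 : ‖tens ψ₁ ψ₂‖ = 0 := by
      rw [ClosedSubmodule.mem_bot.1 hC, norm_zero]
    rw [norm_tens, mul_eq_zero, norm_eq_zero, norm_eq_zero] at h3
    exact h3.elim h1 h2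
  · rintro ⟨p, _⟩ ⟨p', _⟩
    have h3 := congrArg (fun φ : L2 (S.QMem × S.QMem) => φ (p, p')) (mem_qEq.1 hq)
    simp only [pull_apply, tens_apply] at h3
    exact h3.symm

theorem pairIn_of_pairGood {R : QPred S} {V : Set S.Var} {m₁ m₂ : S.CMem}
    {ψ₁ ψ₂ : L2 (S.QMem × PUnit.{u + 1})} (h : PairGood R V mixUnit m₁ ψ₁ m₂ ψ₂) :
    PairIn (R ⊓ eqv V) m₁ (fromReg S ψ₁) m₂ (fromReg S ψ₂) := by
  refine ⟨by rw [norm_fromReg, norm_fromReg, h.norm], h.pred ⟨⟩ ⟨⟩, ?_, ?_⟩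
  · refine mem_qEq.2 ?_
    ext ⟨p, p'⟩
    simp only [pull_apply, tens_apply]
    exact (h.rel (p, ⟨⟩) (p', ⟨⟩)).symm
  · rw [CL, if_pos h.cl]
    trivial

theorem judgment_of_xj {R : QPred S} {V W : Set S.Var} {c d : Prog S} (h : XJ R V W c d) :
    Judgment (R ⊓ eqv V) c d (R ⊓ eqv W) := by
  intro ρ hρ hs hA
  have h1 := (cpl_of_isSeparable hρ hs hA).ne_zero fun _ _ _ _ h => h.1
  have h2 : Cpl (PairGood R V mixUnit) (kraus₁ (fun m => m) (fun _ => toReg S) (marg₁ ρ))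
      (kraus₁ (fun m => m) (fun _ => toReg S) (marg₂ ρ)) := by
    refine h1.bind (kraus₁_good enorm_toReg) (kraus₁_good enorm_toReg) fun m₁ ψ₁ m₂ ψ₂ hG => ?_
    rw [kraus₁_pure enorm_toReg, kraus₁_pure enorm_toReg]
    exact Cpl.pure (pairGood_of_pairIn hG.1 hG.2.1 hG.2.2)
  have h3 : Cpl (PairIn (R ⊓ eqv W)) (den c (marg₁ ρ)) (den d (marg₂ ρ)) := by
    rw [den_eq, den_eq]
    refine (h.bind rectBand_mixUnit h2).bind (kraus₁_good enorm_fromReg)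
      (kraus₁_good enorm_fromReg) fun m₁ ψ₁ m₂ ψ₂ hG => ?_
    rw [kraus₁_pure enorm_fromReg, kraus₁_pure enorm_fromReg]
    exact Cpl.pure (pairIn_of_pairGood hG)
  exact isSeparable_of_cpl h3

/-- A judgment gives information about the trivial register only; other registers are reached
through encodings. -/
theorem cpl_of_judgment {R : QPred S} {V W : Set S.Var} {c d : Prog S}
    (h : Judgment (R ⊓ eqv V) c d (R ⊓ eqv W)) {m₁ m₂ : S.CMem}
    {ψ₁ ψ₂ : L2 (S.QMem × PUnit.{u + 1})} (hG : PairGood R V mixUnit m₁ ψ₁ m₂ ψ₂) :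
    Cpl (PairGood R W mixUnit) (denE c PUnit (pure m₁ ψ₁)) (denE d PUnit (pure m₂ ψ₂)) := by
  obtain ⟨ρ, h1, h2, h3, h4, h5⟩ := isSeparable_of_cpl (Cpl.pure (pairIn_of_pairGood hG))
  obtain ⟨ρ', a1, a2, a3, a4, a5⟩ := h ρ h1 h2 h3
  have h6 := (cpl_of_isSeparable a1 a2 a3).ne_zero fun _ _ _ _ h => h.1
  have h7 := h6.bind (H := PairGood R W mixUnit) (kraus₁_good (t := fun m => m) enorm_toReg)
    (kraus₁_good (t := fun m => m) enorm_toReg) fun n₁ φ₁ n₂ φ₂ hG => by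
      rw [kraus₁_pure enorm_toReg, kraus₁_pure enorm_toReg]
      exact Cpl.pure (pairGood_of_pairIn hG.1 hG.2.1 hG.2.2)
  rwa [a4, a5, h4, h5, toReg_den c (isCQ_pure _ _), toReg_den d (isCQ_pure _ _),
    kraus₁_pure enorm_toReg, kraus₁_pure enorm_toReg, toReg_fromReg, toReg_fromReg] at h7

end

section

/-! ### Adjoints of partial relabelings -/

variable {S : VarSystem.{u}} {E E' : Type u} {k l : ℕ} {M N X Y : Type u}

section adjoint

variable {D : Set Y} {g : Y → X} {hg : Set.InjOn g D}

theorem adjoint_prel_apply_mem {y : Y} (hy : y ∈ D) (ψ : L2 Y) :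
    (prel D g hg).adjoint ψ (g y) = ψ y := by
  have h : prel D g hg (ket (g y)) = ket y := by
    ext z
    rw [prel_apply, ket_apply, ket_apply]
    by_cases hz : z ∈ D
    · rw [if_pos hz]
      exact if_congr ⟨fun h => hg hz hy h, fun h => h ▸ rfl⟩ rfl rfl
    · rw [if_neg hz, if_neg]
      rintro rfl
      exact hz hy
  rw [← inner_ket_left, ContinuousLinearMap.adjoint_inner_right, h, inner_ket_left]

theorem adjoint_prel_apply_not_mem {x : X} (hx : ∀ y ∈ D, g y ≠ x) (ψ : L2 Y) :
    (prel D g hg).adjoint ψ x = 0 := by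
  have h : prel D g hg (ket x) = 0 := by
    ext z
    rw [prel_apply, ket_apply]
    by_cases hz : z ∈ D
    · rw [if_pos hz, if_neg (hx z hz)]; rfl
    · rw [if_neg hz]; rfl
  rw [← inner_ket_left, ContinuousLinearMap.adjoint_inner_right, h, inner_zero_left]

theorem prel_adjoint_prel {ψ : L2 Y} (hψ : ∀ y, ψ y ≠ 0 → y ∈ D) :
    prel D g hg ((prel D g hg).adjoint ψ) = ψ := by
  ext y
  rw [prel_apply]
  by_cases hy : y ∈ D
  · rw [if_pos hy, adjoint_prel_apply_mem hy]
  · rw [if_neg hy]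
    by_contra h
    exact hy (hψ y (Ne.symm h))

theorem norm_adjoint_prel_le (D : Set Y) (g : Y → X) (hg : Set.InjOn g D) :
    ‖(prel D g hg).adjoint‖ ≤ 1 := by
  rw [LinearIsometryEquiv.norm_map]
  exact norm_prel_le D g hg

theorem norm_adjoint_prel {ψ : L2 Y} (hψ : ∀ y, ψ y ≠ 0 → y ∈ D) :
    ‖(prel D g hg).adjoint ψ‖ = ‖ψ‖ := by
  refine le_antisymm ?_ ?_
  · simpa using ContinuousLinearMap.le_of_opNorm_le _ (norm_adjoint_prel_le D g hg) ψ
  · have := ContinuousLinearMap.le_of_opNorm_le _ (norm_prel_le D g hg)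
      ((prel D g hg).adjoint ψ)
    rwa [prel_adjoint_prel hψ, one_mul] at this

end adjoint

theorem Comm.adjoint {F : Set S.QVar} {G : L2 (S.QMem × E) →L[ℂ] L2 (S.QMem × E')}
    (h : Comm F G) : Comm F G.adjoint := by
  intro H hH u w ψ
  refine ext_inner_left ℂ fun φ => ?_
  rw [ContinuousLinearMap.adjoint_inner_right, ← inner_matUnit, ← inner_matUnit,
    ContinuousLinearMap.adjoint_inner_right, h H hH]

theorem Comm.comp {F : Set S.QVar} {E'' : Type u}
    {G : L2 (S.QMem × E) →L[ℂ] L2 (S.QMem × E')} {G' : L2 (S.QMem × E') →L[ℂ] L2 (S.QMem × E'')}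
    (h' : Comm F G') (h : Comm F G) : Comm F (G' ∘L G) := by
  intro H hH u w ψ
  rw [ContinuousLinearMap.comp_apply, ContinuousLinearMap.comp_apply, h H hH, h' H hH]

/-! ### Encoding a register into quantum variables -/

/-- An encoding of the register and of the quantum variables in `Z` into the quantum variables in
`Z`, such that equality of the quantum variables in `Vmid` after the encoding means equality of
the quantum variables in `Vin` and of the register before the encoding. -/
structure Encoding (Vin Vmid : Set S.Var) (μ : E → E → E) (Z : Set S.QVar) where
  dom : Set (S.QMem × E)
  enc : S.QMem × E → S.QMem
  inj : Set.InjOn enc dom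
  dom_ov : ∀ H : Set S.QVar, (∀ q ∈ H, q ∉ Z) → ∀ w p e,
    (ov H w p, e) ∈ dom ↔ (p, e) ∈ dom
  enc_ov : ∀ H : Set S.QVar, (∀ q ∈ H, q ∉ Z) → ∀ w p e, enc (ov H w p, e) = ov H w (enc (p, e))
  enc_off : ∀ q ∉ Z, ∀ p e, enc (p, e) q = p q
  mix_mem : ∀ x ∈ dom, ∀ y ∈ dom, mixX Vin μ x y ∈ dom
  enc_mix : ∀ x y, enc (mixX Vin μ x y) = ov (qs Vmid) (enc y) (enc x)

namespace Encoding

variable {Vin Vmid : Set S.Var} {μ : E → E → E} {Z : Set S.QVar} (ε : Encoding Vin Vmid μ Z)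

theorem inj' : Set.InjOn (fun x => (ε.enc x, PUnit.unit.{u + 1})) ε.dom :=
  fun _ hx _ hy h => ε.inj hx hy (Prod.mk.inj h).1

/-- The decoding. -/
def decode : L2 (S.QMem × PUnit.{u + 1}) →L[ℂ] L2 (S.QMem × E) :=
  prel ε.dom (fun x => (ε.enc x, ⟨⟩)) ε.inj'

/-- The encoding. -/
def encode : L2 (S.QMem × E) →L[ℂ] L2 (S.QMem × PUnit.{u + 1}) := ε.decode.adjoint

theorem decode_apply (φ : L2 (S.QMem × PUnit.{u + 1})) (x : S.QMem × E) :
    ε.decode φ x = if x ∈ ε.dom then φ (ε.enc x, ⟨⟩) else 0 := rfl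

theorem encode_apply_mem {x : S.QMem × E} (hx : x ∈ ε.dom) (ψ : L2 (S.QMem × E)) :
    ε.encode ψ (ε.enc x, ⟨⟩) = ψ x :=
  adjoint_prel_apply_mem (g := fun x => (ε.enc x, PUnit.unit.{u + 1})) hx ψ

theorem encode_apply_not_mem {p : S.QMem} (hx : ∀ x ∈ ε.dom, ε.enc x ≠ p)
    (ψ : L2 (S.QMem × E)) : ε.encode ψ (p, ⟨⟩) = 0 :=
  adjoint_prel_apply_not_mem (fun x h h' => hx x h (Prod.mk.inj h').1) ψ

theorem norm_decode : ‖ε.decode‖ ≤ 1 := norm_prel_le _ _ _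

theorem comm_decode {F : Set S.QVar} (hF : ∀ q ∈ F, q ∉ Z) : Comm F ε.decode := by
  intro H hH u w φ
  have hH' : ∀ q ∈ H, q ∉ Z := fun q hq => hF q (hH hq)
  ext ⟨p, e⟩
  rw [matUnit_apply, decode_apply, decode_apply, matUnit_apply]
  have h1 : (∀ q ∈ H, ε.enc (p, e) q = u q) ↔ ∀ q ∈ H, p q = u q :=
    forall₂_congr fun q hq => by rw [ε.enc_off q (hH' q hq)]
  simp only [h1, ε.dom_ov H hH', ε.enc_ov H hH']
  by_cases h2 : (p, e) ∈ ε.dom <;> by_cases h3 : ∀ q ∈ H, p q = u q <;> simp [h2, h3]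

theorem mixX_invol (hμ : RectBand μ) (x y : S.QMem × E) :
    mixX Vin μ (mixX Vin μ x y) (mixX Vin μ y x) = x := by
  rw [(hμ.mixX Vin).left, (hμ.mixX Vin).right, (hμ.mixX Vin).self]

theorem rel_decode (hμ : RectBand μ) {φ₁ φ₂ : L2 (S.QMem × PUnit.{u + 1})}
    (h : Rel (mixX Vmid mixUnit) φ₁ φ₂) : Rel (mixX Vin μ) (ε.decode φ₁) (ε.decode φ₂) := by
  intro x y
  simp only [decode_apply, ε.enc_mix]
  by_cases hxy : x ∈ ε.dom ∧ y ∈ ε.dom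
  · rw [if_pos hxy.1, if_pos hxy.2, if_pos (ε.mix_mem _ hxy.1 _ hxy.2),
      if_pos (ε.mix_mem _ hxy.2 _ hxy.1)]
    exact h (ε.enc x, ⟨⟩) (ε.enc y, ⟨⟩)
  · have h1 : ¬ (mixX Vin μ x y ∈ ε.dom ∧ mixX Vin μ y x ∈ ε.dom) := by
      rintro ⟨h1, h2⟩
      refine hxy ⟨?_, ?_⟩
      · rw [← mixX_invol (Vin := Vin) hμ x y]; exact ε.mix_mem _ h1 _ h2
      · rw [← mixX_invol (Vin := Vin) hμ y x]; exact ε.mix_mem _ h2 _ h1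
    rcases not_and_or.1 hxy with h2 | h2 <;> rcases not_and_or.1 h1 with h3 | h3 <;>
      simp [h2, h3]

/-- The set of encoded memories is closed under exchanging the values on `Vmid`. So the two sides of
the equation either both involve encoded memories only, or both vanish. -/
theorem rel_encode {ψ₁ ψ₂ : L2 (S.QMem × E)}
    (h : Rel (mixX Vin μ) ψ₁ ψ₂) : Rel (mixX Vmid mixUnit) (ε.encode ψ₁) (ε.encode ψ₂) := by
  rintro ⟨p, _⟩ ⟨p', _⟩
  have key : ∀ p p', (∃ x ∈ ε.dom, ε.enc x = p) → (∃ y ∈ ε.dom, ε.enc y = p') →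
      ∃ z ∈ ε.dom, ε.enc z = ov (qs Vmid) p' p := by
    rintro _ _ ⟨x, hx, rfl⟩ ⟨y, hy, rfl⟩
    exact ⟨_, ε.mix_mem x hx y hy, ε.enc_mix x y⟩
  have hinv : ∀ p p' : S.QMem, ov (qs Vmid) (ov (qs Vmid) p p') (ov (qs Vmid) p' p) = p := by
    intro p p'
    funext q
    by_cases hq : q ∈ qs Vmid <;> simp [ov, hq]
  have h0 : ∀ p (ψ : L2 (S.QMem × E)), (¬ ∃ x ∈ ε.dom, ε.enc x = p) → ε.encode ψ (p, ⟨⟩) = 0 :=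
    fun p ψ hp => ε.encode_apply_not_mem (fun x hx h => hp ⟨x, hx, h⟩) ψ
  change ε.encode ψ₁ (p, ⟨⟩) * ε.encode ψ₂ (p', ⟨⟩) =
    ε.encode ψ₁ (ov (qs Vmid) p' p, ⟨⟩) * ε.encode ψ₂ (ov (qs Vmid) p p', ⟨⟩)
  by_cases hp : (∃ x ∈ ε.dom, ε.enc x = p) ∧ ∃ y ∈ ε.dom, ε.enc y = p'
  · obtain ⟨⟨x, hx, rfl⟩, y, hy, rfl⟩ := hp
    rw [← ε.enc_mix, ← ε.enc_mix, ε.encode_apply_mem hx, ε.encode_apply_mem hy,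
      ε.encode_apply_mem (ε.mix_mem x hx y hy), ε.encode_apply_mem (ε.mix_mem y hy x hx)]
    exact h x y
  · have h1 : ¬ ((∃ x ∈ ε.dom, ε.enc x = ov (qs Vmid) p' p) ∧
        ∃ y ∈ ε.dom, ε.enc y = ov (qs Vmid) p p') := by
      rintro ⟨h1, h2⟩
      refine hp ⟨?_, ?_⟩
      · have := key _ _ h1 h2
        rwa [hinv] at this
      · have := key _ _ h2 h1
        rwa [hinv] at this
    have e1 : ε.encode ψ₁ (p, ⟨⟩) * ε.encode ψ₂ (p', ⟨⟩) = 0 := by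
      rcases not_and_or.1 hp with h2 | h2
      · rw [h0 _ _ h2, zero_mul]
      · rw [h0 _ _ h2, mul_zero]
    have e2 : ε.encode ψ₁ (ov (qs Vmid) p' p, ⟨⟩) * ε.encode ψ₂ (ov (qs Vmid) p p', ⟨⟩) = 0 := by
      rcases not_and_or.1 h1 with h2 | h2
      · rw [h0 _ _ h2, zero_mul]
      · rw [h0 _ _ h2, mul_zero]
    rw [e1, e2]

theorem sliceLe_decode {F : Set S.Var} (hF : ∀ q, Sum.inr q ∈ F → q ∉ Z)
    (φ : L2 (S.QMem × PUnit.{u + 1})) : SliceLe F φ (ε.decode φ) := by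
  intro p e
  by_cases hp : (p, e) ∈ ε.dom
  · refine Or.inr ⟨ε.enc (p, e), ⟨⟩, fun a => ?_⟩
    rw [decode_apply, if_pos ((ε.dom_ov (qs F) hF _ _ _).2 hp), ε.enc_ov (qs F) hF]
  · exact Or.inl fun a => by
      rw [decode_apply, if_neg fun h => hp ((ε.dom_ov (qs F) hF _ _ _).1 h)]

theorem sliceLe_encode {F : Set S.Var} (hF : ∀ q, Sum.inr q ∈ F → q ∉ Z)
    (ψ : L2 (S.QMem × E)) : SliceLe F ψ (ε.encode ψ) := by
  rintro p ⟨⟩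
  by_cases hp : ∃ a, ∃ x ∈ ε.dom, ε.enc x = ov (qs F) a p
  · obtain ⟨a₀, ⟨r, e⟩, hx, h⟩ := hp
    refine Or.inr ⟨r, e, fun a => ?_⟩
    have h1 : ov (qs F) a p = ε.enc (ov (qs F) a r, e) := by
      rw [ε.enc_ov (qs F) hF, h]
      funext q
      by_cases hq : q ∈ qs F <;> simp [ov, hq]
    rw [h1, ε.encode_apply_mem ((ε.dom_ov (qs F) hF _ _ _).2 hx)]
  · exact Or.inl fun a => ε.encode_apply_not_mem (fun x hx h => hp ⟨a, x, hx, h⟩) ψ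

end Encoding

theorem exists_injOn_of_countable {α β : Type*} [Infinite β] {s : Set α} (hs : s.Countable) :
    ∃ f : α → β, Set.InjOn f s := by
  obtain ⟨f, hf⟩ := Set.countable_iff_exists_injOn.1 hs
  exact ⟨fun x => Infinite.natEmbedding β (f x), fun x hx y hy h =>
    hf hx hy ((Infinite.natEmbedding β).injective h)⟩

/-- States with countable support can be encoded if `a` and `r` have infinite types. -/
theorem exists_encoding {Vin Vmid : Set S.Var} {μ : E → E → E} (hμ : RectBand μ)
    (hVin : qs Vin ⊆ qs Vmid) {a r : S.QVar} (ha : a ∈ qs Vmid) (hr : r ∉ qs Vmid)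
    [Infinite (S.qtyp a)] [Infinite (S.qtyp r)] {D₀ : Set (S.QMem × E)} (hD₀ : D₀.Countable)
    (hne : D₀.Nonempty) :
    ∃ ε : Encoding Vin Vmid μ ({a, r} ∪ (qs Vmid \ qs Vin)), D₀ ⊆ ε.dom := by
  -- The reference value `e₀` isolates the two parts of a register value `e`: `μ e₀ e` determines
  -- the compared part and `μ e e₀` the other one.
  obtain ⟨⟨_, e₀⟩, -⟩ := hne
  have har : a ≠ r := by
    rintro rfl
    exact hr ha
  set Q₀ : Set S.QVar := qs Vmid \ qs Vin with hQ₀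
  -- What must be equal and is stored in `a`: the compared part of the register, and the previous
  -- value of `a` if `a` itself was equal.
  let key₁ : S.QMem × E → S.qtyp a × E := fun x =>
    (if a ∈ qs Vin then x.1 a else S.qinit a, μ e₀ x.2)
  -- What is not compared and is stored in `r`: the variables in `Q₀` (among them `a`, if it was not
  -- equal), the old value of `r`, and the other part of the register.
  let key₂ : S.QMem × E → S.QMem × E := fun x => (ov (Q₀ ∪ {r}) x.1 S.qinit, μ x.2 e₀)
  obtain ⟨f₁, hf₁⟩ := exists_injOn_of_countable (β := S.qtyp a) (hD₀.image key₁)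
  obtain ⟨f₂, hf₂⟩ := exists_injOn_of_countable (β := S.qtyp r) (hD₀.image key₂)
  let enc : S.QMem × E → S.QMem := fun x =>
    Function.update (Function.update (ov Q₀ S.qinit x.1) r (f₂ (key₂ x))) a (f₁ (key₁ x))
  have enc_a : ∀ x, enc x a = f₁ (key₁ x) := fun x => Function.update_self _ _ _
  have enc_r : ∀ x, enc x r = f₂ (key₂ x) := fun x => by
    simp only [enc]
    rw [Function.update_of_ne har.symm, Function.update_self]
  have enc_q : ∀ x q, q ≠ a → q ≠ r → enc x q = ov Q₀ S.qinit x.1 q :=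
    fun x q h1 h2 => by
      simp only [enc]
      rw [Function.update_of_ne h1, Function.update_of_ne h2]
  have enc_ext : ∀ {x : S.QMem × E} {p : S.QMem}, enc x a = p a → enc x r = p r →
      (∀ q, q ≠ a → q ≠ r → enc x q = p q) → enc x = p := by
    intro x p h1 h2 h3
    funext q
    by_cases hqa : q = a
    · subst hqa; exact h1
    by_cases hqr : q = r
    · subst hqr; exact h2
    exact h3 q hqa hqr
  have hH1 : ∀ H : Set S.QVar, (∀ q ∈ H, q ∉ ({a, r} ∪ Q₀ : Set S.QVar)) →
      a ∉ H ∧ r ∉ H ∧ ∀ q ∈ Q₀, q ∉ H := fun H hH =>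
    ⟨fun h => hH a h (Or.inl (Or.inl rfl)), fun h => hH r h (Or.inl (Or.inr rfl)),
      fun q hq h => hH q h (Or.inr hq)⟩
  have key₁_ov : ∀ H : Set S.QVar, a ∉ H → ∀ w p e, key₁ (ov H w p, e) = key₁ (p, e) := by
    intro H h w p e
    simp only [key₁, ov_of_not_mem h]
  have key₂_ov : ∀ H : Set S.QVar, r ∉ H → (∀ q ∈ Q₀, q ∉ H) → ∀ w p e,
      key₂ (ov H w p, e) = key₂ (p, e) := by
    intro H h h' w p e
    refine Prod.ext (funext fun q => ?_) rfl
    by_cases hq : q ∈ Q₀ ∪ {r}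
    · have : q ∉ H := by
        rcases hq with hq | rfl
        · exact h' q hq
        · exact h
      simp only [key₂, ov, hq, this, if_true, if_false]
    · simp only [key₂, ov, hq, if_false]
  have key₁_mix : ∀ x y, key₁ (mixX Vin μ x y) = key₁ y := by
    intro x y
    refine Prod.ext ?_ (hμ.right _ _ _)
    by_cases h : a ∈ qs Vin
    · simp only [key₁, h, if_true]
      exact ov_of_mem h
    · simp only [key₁, h, if_false]
  have key₂_mix : ∀ x y, key₂ (mixX Vin μ x y) = key₂ x := by
    intro x y
    refine Prod.ext (funext fun q => ?_) (hμ.left _ _ _)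
    by_cases hq : q ∈ Q₀ ∪ {r}
    · simp only [key₂]
      rw [ov_of_mem hq, ov_of_mem hq]
      refine ov_of_not_mem fun h => ?_
      rcases hq with hq | rfl
      · exact hq.2 h
      · exact hr (hVin h)
    · simp only [key₂]
      rw [ov_of_not_mem hq, ov_of_not_mem hq]
  -- Both conditions are imposed independently, since `D₀` itself need not be closed under mixing: a
  -- mixed point takes `key₁` from one argument and `key₂` from the other.
  refine ⟨⟨{x | key₁ x ∈ key₁ '' D₀ ∧ key₂ x ∈ key₂ '' D₀}, enc, ?_, ?_, ?_, ?_, ?_, ?_⟩,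
    fun x hx => ⟨⟨x, hx, rfl⟩, ⟨x, hx, rfl⟩⟩⟩
  · intro x hx y hy h
    have h1 : key₁ x = key₁ y := hf₁ hx.1 hy.1 (by rw [← enc_a, ← enc_a, h])
    have h2 : key₂ x = key₂ y := hf₂ hx.2 hy.2 (by rw [← enc_r, ← enc_r, h])
    refine Prod.ext (funext fun q => ?_) ?_
    · by_cases hq : q ∈ Q₀ ∪ {r}
      · have := congrFun (congrArg Prod.fst h2) q
        simp only [key₂] at this
        rwa [ov_of_mem hq, ov_of_mem hq] at this
      · by_cases hqa : q = a
        · subst hqa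
          have hV : q ∈ qs Vin := by
            by_contra hV
            exact hq (Or.inl ⟨ha, hV⟩)
          have := congrArg Prod.fst h1
          simpa only [key₁, hV, if_true] using this
        · have hqr : q ≠ r := fun h => hq (Or.inr h)
          have hq0 : q ∉ Q₀ := fun h => hq (Or.inl h)
          have := congrFun h q
          rwa [enc_q x q hqa hqr, enc_q y q hqa hqr, ov_of_not_mem hq0, ov_of_not_mem hq0] at this
    · have h3 : μ e₀ x.2 = μ e₀ y.2 := congrArg Prod.snd h1
      have h4 : μ x.2 e₀ = μ y.2 e₀ := congrArg Prod.snd h2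
      have h5 : ∀ e, e = μ (μ e e₀) (μ e₀ e) := fun e => by
        rw [hμ.left, hμ.right, hμ.self]
      rw [h5 x.2, h5 y.2, h3, h4]
  · intro H hH w p e
    obtain ⟨h1, h2, h3⟩ := hH1 H hH
    simp only [Set.mem_ofPred_eq, key₁_ov H h1, key₂_ov H h2 h3]
  · intro H hH w p e
    obtain ⟨h1, h2, h3⟩ := hH1 H hH
    refine enc_ext ?_ ?_ fun q hqa hqr => ?_
    · rw [ov_of_not_mem h1, enc_a, enc_a, key₁_ov H h1]
    · rw [ov_of_not_mem h2, enc_r, enc_r, key₂_ov H h2 h3]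
    · rw [enc_q _ q hqa hqr]
      by_cases hq : q ∈ H
      · have : q ∉ Q₀ := fun h => h3 q h hq
        rw [ov_of_not_mem this, ov_of_mem hq]
        exact ov_of_mem hq
      · rw [ov_of_not_mem hq, enc_q _ q hqa hqr]
        by_cases h : q ∈ Q₀
        · rw [ov_of_mem h, ov_of_mem h]
        · rw [ov_of_not_mem h, ov_of_not_mem h]
          exact ov_of_not_mem hq
  · intro q hq p e
    simp only [Set.mem_union, Set.mem_insert_iff, Set.mem_singleton_iff, not_or] at hq
    rw [enc_q _ q hq.1.1 hq.1.2, ov_of_not_mem hq.2]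
  · intro x hx y hy
    exact ⟨by rw [key₁_mix]; exact hy.1, by rw [key₂_mix]; exact hx.2⟩
  · intro x y
    refine enc_ext ?_ ?_ fun q hqa hqr => ?_
    · rw [ov_of_mem ha, enc_a, enc_a, key₁_mix]
    · rw [ov_of_not_mem hr, enc_r, enc_r, key₂_mix]
    · rw [enc_q _ q hqa hqr]
      by_cases hm : q ∈ qs Vmid
      · rw [ov_of_mem hm, enc_q _ q hqa hqr]
        by_cases hi : q ∈ qs Vin
        · have : q ∉ Q₀ := fun h => h.2 hi
          rw [ov_of_not_mem this, ov_of_not_mem this]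
          exact ov_of_mem hi
        · have : q ∈ Q₀ := ⟨hm, hi⟩
          rw [ov_of_mem this, ov_of_mem this]
      · have h1 : q ∉ Q₀ := fun h => hm h.1
        rw [ov_of_not_mem hm, enc_q _ q hqa hqr, ov_of_not_mem h1, ov_of_not_mem h1]
        exact ov_of_not_mem fun h => hm (hVin h)

end

section

/-! ### Programs that fill a hole -/

variable {S : VarSystem.{u}} {E E' : Type u} {k l : ℕ} {M N X Y : Type u}

theorem Expr.fv_finite {α : Type u} (e : Expr S α) : e.fv.Finite :=
  e.vars.finite_toSet.image _

theorem Ctx.fv_finite {n : ℕ} : ∀ c : Ctx S n, c.fv.Finite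
  | .hole _ => Set.finite_empty
  | .skip => Set.finite_empty
  | .assign _ e => (Set.finite_range _).union e.fv_finite
  | .sample _ e => (Set.finite_range _).union e.fv_finite
  | .ite e c d => (e.fv_finite.union c.fv_finite).union d.fv_finite
  | .whileLoop e c => e.fv_finite.union c.fv_finite
  | .seq c d => c.fv_finite.union d.fv_finite
  | .qinit _ e => (Set.finite_range _).union e.fv_finite
  | .qapply _ e => (Set.finite_range _).union e.fv_finite
  | .measure _ _ e => ((Set.finite_range _).union (Set.finite_range _)).union e.fv_finite
  | .loc _ c => c.fv_finite.subset Set.sdiff_subset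

theorem Ctx.written_subset_fv {n : ℕ} : ∀ c : Ctx S n, c.written ⊆ c.fv
  | .hole _ => subset_rfl
  | .skip => subset_rfl
  | .assign _ _ => Set.subset_union_left
  | .sample _ _ => Set.subset_union_left
  | .ite _ c d => Set.union_subset_union
      (c.written_subset_fv.trans Set.subset_union_right) d.written_subset_fv
  | .whileLoop _ c => c.written_subset_fv.trans Set.subset_union_right
  | .seq c d => Set.union_subset_union c.written_subset_fv d.written_subset_fv
  | .qinit _ _ => Set.subset_union_left
  | .qapply _ _ => Set.subset_union_left
  | .measure _ _ _ => by
      rw [Ctx.written, Ctx.fv, Set.union_comm (Ctx.cset _)]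
      exact Set.subset_union_left
  | .loc _ c => Set.sdiff_subset_sdiff_left c.written_subset_fv

namespace Encoding

variable {Vin Vmid : Set S.Var} {μ : E → E → E} {Z : Set S.QVar} (ε : Encoding Vin Vmid μ Z)
  {c : Prog S} {ψ : L2 (S.QMem × E)}

theorem decode_encode (hψ : ∀ x, ψ x ≠ 0 → x ∈ ε.dom) : ε.decode (ε.encode ψ) = ψ :=
  prel_adjoint_prel hψ

theorem norm_encode (hψ : ∀ x, ψ x ≠ 0 → x ∈ ε.dom) : ‖ε.encode ψ‖ = ‖ψ‖ :=
  norm_adjoint_prel hψ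

/-- Running a program on an encoded state. The classical variables in `U` may be changed if they
are overwritten or not used. -/
theorem denE_encode (hc : ∀ q, Sum.inr q ∈ c.fv → q ∉ Z) {U : Set S.CVar}
    (hU : ∀ x ∈ U, Sum.inl x ∈ c.fv → Sum.inl x ∈ c.overwr)
    (hψ : ∀ x, ψ x ≠ 0 → x ∈ ε.dom) (a m : S.CMem) :
    theta (fun _ => True) (ov {x ∈ U | Sum.inl x ∉ c.fv} m) ε.decode
      (denE c PUnit (pure (ov U a m) (ε.encode ψ))) = denE c E (pure m ψ) := by
  have hcomm : Comm c.writtenQ ε.decode :=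
    ε.comm_decode fun q hq => hc q (c.written_subset_fv hq)
  -- The decoding moves in front of the program, where it cancels the encoding. Variables of `U`
  -- that `c` does not use are restored by the outer map; those that it uses are overwritten.
  rw [← denE_theta c ε.norm_decode (fun x hx => hx.2) (fun _ _ _ => Iff.rfl) hcomm
    (isCQ_pure _ _), theta_pure ε.norm_decode, if_pos trivial, ε.decode_encode hψ,
    ← denE_overwr c (U := {x ∈ U | Sum.inl x ∈ c.fv}) a (fun x hx => hU x hx.1 hx.2) m ψ]
  congr 2
  funext x
  by_cases h1 : x ∈ U <;> by_cases h2 : Sum.inl x ∈ c.fv <;> simp [ov, h1, h2]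

/-- The operator `encode ∘ decode` projects onto the encoded states. It commutes with the program
and fixes its input, so by `theta_fixed` it preserves the norm of every output term; since encoding
is a contraction, decoding cannot lose norm. -/
theorem norm_decode_of_cqSum (hc : ∀ q, Sum.inr q ∈ c.fv → q ∉ Z)
    (hψ : ∀ x, ψ x ≠ 0 → x ∈ ε.dom) {m : S.CMem} {ι : Type u} {n : ι → S.CMem}
    {φ : ι → L2 (S.QMem × PUnit.{u + 1})}
    (h : CQSum (fun i => pure (n i) (φ i)) (denE c PUnit (pure m (ε.encode ψ)))) (i : ι)
    (hi : φ i ≠ 0) : ‖ε.decode (φ i)‖ = ‖φ i‖ := by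
  have hd : ∀ χ, ‖ε.decode χ‖ ≤ ‖χ‖ := fun χ => by
    simpa using ContinuousLinearMap.le_of_opNorm_le _ ε.norm_decode χ
  have he : ∀ χ, ‖ε.encode χ‖ ≤ ‖χ‖ := fun χ => by
    have := ContinuousLinearMap.le_of_opNorm_le _ (norm_adjoint_prel_le ε.dom _ ε.inj') χ
    rwa [one_mul] at this
  have hP : ‖ε.encode ∘L ε.decode‖ ≤ 1 :=
    ContinuousLinearMap.opNorm_le_bound _ zero_le_one fun χ => by
      rw [one_mul]
      exact (he _).trans (hd _)
  have h1 : Comm c.writtenQ ε.decode :=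
    ε.comm_decode fun q hq => hc q (c.written_subset_fv hq)
  have h2 := denE_theta c hP (U := ∅) (a := m) (b := fun _ => True) (by simp)
    (fun _ _ _ => Iff.rfl) (h1.adjoint.comp h1) (isCQ_pure m (ε.encode ψ))
  rw [theta_pure hP, if_pos trivial, ov_empty, ContinuousLinearMap.comp_apply,
    ε.decode_encode hψ] at h2
  refine le_antisymm (hd _) ?_
  rw [← (theta_fixed hP h h2.symm i hi).2]
  exact he _

end Encoding

theorem VarSystem.exists_fresh (S : VarSystem.{u}) {F : Set S.Var} (hF : F.Finite) :
    ∃ r, Sum.inr r ∉ F ∧ Infinite (S.qtyp r) := by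
  obtain ⟨q, hq⟩ := S.exists_aleph0_qvar
  have : Infinite (S.qtyp q) := Cardinal.infinite_iff.2 hq.ge
  obtain ⟨r, hr, hrF⟩ := (S.infinite_compatible_qvar q).exists_notMem_finite
    (hF.preimage (f := Sum.inr) Sum.inr_injective.injOn)
  refine ⟨r, hrF, ?_⟩
  rw [show S.qtyp r = S.qtyp q from hr]
  exact this

/-- The state is encoded so that `Vmid` becomes equal, the judgment is applied with the trivial
register, and the outputs are decoded. The encoding disturbs only `a`, a fresh variable, and the
quantum variables in `Vmid` outside `Vin`; none of them occurs in `c`, `d` or the predicate. -/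
theorem xj_of_judgment {R : QPred S} {F Vin Vmid Vout : Set S.Var} {c d : Prog S} {a : S.QVar}
    (hR : R.IsOver F F) (hF : F.Finite) (hVmid : Vmid.Finite) (ha_inf : Infinite (S.qtyp a))
    (ha : Sum.inr a ∈ Vmid) (haF : Sum.inr a ∉ F) (hac : Sum.inr a ∉ c.fv)
    (had : Sum.inr a ∉ d.fv) (h_out_mid : Vout ⊆ Vmid) (h_out_in : Vout ⊆ Vin)
    (h_in_out : ∀ q, Sum.inr q ∈ Vin → Sum.inr q ∈ Vout) (h_mid_F : ∀ v ∈ Vmid, v ∈ F → v ∈ Vin)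
    (h_mid_cl : ∀ x, Sum.inl x ∈ Vmid → Sum.inl x ∉ Vin → Sum.inl x ∈ c.fv →
      Sum.inl x ∈ c.overwr)
    (h_mid_qu : ∀ q, Sum.inr q ∈ Vmid → Sum.inr q ∉ Vin → Sum.inr q ∉ c.fv ∧ Sum.inr q ∉ d.fv)
    (h : Judgment (R ⊓ eqv Vmid) c d (R ⊓ eqv Vmid)) : XJ R Vin Vout c d := by
  intro E μ hμ m₁ ψ₁ m₂ ψ₂ h1 h2 hG
  obtain ⟨r, hr, hr_inf⟩ := S.exists_fresh
    (((hVmid.union hF).union c.fv_finite).union d.fv_finite)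
  simp only [Set.mem_union, not_or] at hr
  have hcount : ∀ ψ : L2 (S.QMem × E), {x | ψ x ≠ 0}.Countable := fun ψ =>
    (L2.summable_sq ψ).countable_support.mono fun x hx => by simpa using hx
  have hne : {x | ψ₁ x ≠ 0}.Nonempty := by
    by_contra hne
    refine h1 (lp.ext (funext fun x => ?_))
    by_contra hx
    exact hne ⟨x, hx⟩
  obtain ⟨ε, hε⟩ := exists_encoding hμ (fun q hq => h_out_mid (h_in_out q hq)) ha hr.1.1.1
    ((hcount ψ₁).union (hcount ψ₂)) (hne.mono Set.subset_union_left)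
  have hZ : ∀ G : Set S.Var, Sum.inr a ∉ G → Sum.inr r ∉ G →
      (∀ q, Sum.inr q ∈ Vmid → Sum.inr q ∉ Vin → Sum.inr q ∉ G) →
      ∀ q, Sum.inr q ∈ G → q ∉ ({a, r} ∪ (qs Vmid \ qs Vin) : Set S.QVar) := by
    rintro G k1 k2 k3 q hq ((rfl | rfl) | ⟨k4, k5⟩)
    · exact k1 hq
    · exact k2 hq
    · exact k3 q k4 k5 hq
  have hZF := hZ F haF hr.1.1.2 fun q k1 k2 k3 => k2 (h_mid_F _ k1 k3)
  have hZc := hZ c.fv hac hr.1.2 fun q k1 k2 => (h_mid_qu q k1 k2).1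
  have hZd := hZ d.fv had hr.2 fun q k1 k2 => (h_mid_qu q k1 k2).2
  have hs₁ : ∀ x, ψ₁ x ≠ 0 → x ∈ ε.dom := fun x hx => hε (Or.inl hx)
  have hs₂ : ∀ x, ψ₂ x ≠ 0 → x ∈ ε.dom := fun x hx => hε (Or.inr hx)
  -- These classical variables may differ. They are made equal by copying their values from the
  -- second memory into the first, so only `c` has to tolerate a change.
  set U : Set S.CVar := {x | Sum.inl x ∈ Vmid ∧ Sum.inl x ∉ Vin} with hUdef
  have hU : ∀ x ∈ U, Sum.inl x ∈ c.fv → Sum.inl x ∈ c.overwr := fun x hx =>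
    h_mid_cl x hx.1 hx.2
  have hG' : PairGood R Vmid mixUnit (ov U m₂ m₁) (ε.encode ψ₁) m₂ (ε.encode ψ₂) := by
    refine hG.of_sliceLe hR ?_ (fun x hx => ?_) (ε.rel_encode hG.rel) (ε.sliceLe_encode hZF _)
      (ε.sliceLe_encode hZF _) (fun x hx => ov_of_not_mem fun k => k.2 (h_mid_F _ k.1 hx))
      fun _ _ => rfl
    · rw [ε.norm_encode hs₁, ε.norm_encode hs₂, hG.norm]
    · by_cases hxU : x ∈ U
      · exact ov_of_mem hxU
      · rw [ov_of_not_mem hxU]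
        by_contra hne
        exact hxU ⟨hx, fun k => hne (hG.cl x k)⟩
  obtain ⟨ι, n₁, n₂, φ₁, φ₂, a0, a1, a2⟩ :=
    (cpl_of_judgment h hG').ne_zero fun _ _ _ _ h => h.norm
  -- Besides decoding, the map on the first side gives the variables of `U` that `c` does not use
  -- their original values. On the second side nothing was changed, hence the empty set.
  have b1 := (theta_good (b := fun _ => True) (h := ov {x ∈ U | Sum.inl x ∉ c.fv} m₁)
    ε.norm_decode).sum a1
  have b2 := (theta_good (b := fun _ => True) (h := ov {x ∈ (∅ : Set S.CVar) | Sum.inl x ∉ d.fv} m₂)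
    ε.norm_decode).sum a2
  rw [ε.denE_encode hZc hU hs₁] at b1
  have e2 := ε.denE_encode hZd (U := ∅) (by simp) hs₂ m₂ m₂
  rw [ov_empty] at e2
  rw [e2] at b2
  simp only [theta_pure ε.norm_decode, if_true] at b1 b2
  refine ⟨ι, _, _, _, _, fun i => ?_, b1, b2⟩
  refine (a0 i).1.of_sliceLe hR ?_ (fun x hx => ?_) ?_ (ε.sliceLe_decode hZF _)
    (ε.sliceLe_decode hZF _) (fun x hx => ov_of_not_mem fun k => k.1.2 (h_mid_F _ k.1.1 hx))
    fun x hx => ov_of_not_mem fun k => k.1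
  · rw [ε.norm_decode_of_cqSum hZc hs₁ a1 i (a0 i).2.1,
      ε.norm_decode_of_cqSum hZd hs₂ a2 i (a0 i).2.2, (a0 i).1.norm]
  · rw [ov_of_not_mem fun k => k.1.2 (h_out_in hx), ov_of_not_mem fun k => k.1]
    exact (a0 i).1.cl x (h_out_mid hx)
  · rw [mixX_congr (V := Vout) (W := Vin) (fun q => ⟨fun k => h_out_in k, h_in_out q⟩) μ]
    exact ε.rel_decode hμ (a0 i).1.rel

end

section

/-! ### The adversary rule for pure states with a register -/

variable {S : VarSystem.{u}} {E E' : Type u} {k l : ℕ} {M N X Y : Type u}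

/-! ### Variable sets of contexts and of their instances -/

namespace Ctx

variable {n : ℕ}

theorem overwr_subset_fv : ∀ C : Ctx S n, C.overwr ⊆ C.fv
  | hole _ => subset_rfl
  | skip => subset_rfl
  | assign _ _ => Set.sdiff_subset.trans Set.subset_union_left
  | sample _ _ => Set.sdiff_subset.trans Set.subset_union_left
  | ite _ C _ => Set.sdiff_subset.trans (Set.inter_subset_left.trans
      (C.overwr_subset_fv.trans (Set.subset_union_right.trans Set.subset_union_left)))
  | whileLoop _ _ => Set.empty_subset _
  | seq C D => Set.union_subset_union C.overwr_subset_fv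
      (Set.inter_subset_left.trans (Set.sdiff_subset.trans D.overwr_subset_fv))
  | qinit _ _ => Set.subset_union_left
  | qapply _ _ => Set.empty_subset _
  | measure _ _ _ => Set.sdiff_subset.trans
      (Set.subset_union_right.trans Set.subset_union_left)
  | loc _ C => Set.sdiff_subset_sdiff_left C.overwr_subset_fv

theorem written_fill (s : Fin n → Prog S) : ∀ C : Ctx S n, C.IsProgram →
    (C.fill s).written = C.written
  | hole _, h => h.elim
  | skip, _ => rfl
  | assign _ _, _ => rfl
  | sample _ _, _ => rfl
  | qinit _ _, _ => rfl
  | qapply _ _, _ => rfl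
  | measure _ _ _, _ => rfl
  | ite _ C D, h => congrArg₂ _ (written_fill s C h.1) (written_fill s D h.2)
  | whileLoop _ C, h => written_fill s C h
  | seq C D, h => congrArg₂ _ (written_fill s C h.1) (written_fill s D h.2)
  | loc _ C, h => congrArg (· \ _) (written_fill s C h)

end Ctx

/-- The side conditions of the adversary rule. The programs in hole `i` have the free variables
`A i`, and they all overwrite the variables in `B i`. -/
structure Side {n : ℕ} (C : Ctx S n) (A B : Fin n → Set S.Var) (F Vin Vmid Vout : Set S.Var) :
    Prop where
  inner_mid : ∀ v ∈ C.inner, v ∈ Vmid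
  out_mid : ∀ v ∈ Vout, v ∈ Vmid
  out_in : ∀ v ∈ Vout, v ∈ Vin ∨ v ∈ C.overwr
  out_F : ∀ v ∈ Vout, v ∈ F → v ∈ Vin
  in_out : ∀ q, Sum.inr q ∈ Vin → Sum.inr q ∈ Vout ∨ Sum.inr q ∈ C.overwr
  in_F : ∀ q, Sum.inr q ∈ Vin → Sum.inr q ∈ F → Sum.inr q ∈ Vout
  mid_F : ∀ v ∈ Vmid, v ∈ F → v ∈ Vin ∨ v ∈ C.covered
  mid_F_out : ∀ q, Sum.inr q ∈ Vmid → Sum.inr q ∈ F → Sum.inr q ∈ Vout ∨ Sum.inr q ∈ C.covered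
  mid_cl : ∀ i x, Sum.inl x ∈ Vmid → Sum.inl x ∈ A i →
    Sum.inl x ∈ Vin ∨ Sum.inl x ∈ C.covered ∨ Sum.inl x ∈ B i
  mid_qu : ∀ i q, Sum.inr q ∈ Vmid → Sum.inr q ∈ A i → Sum.inr q ∈ Vin ∨ Sum.inr q ∈ C.covered
  mid_out : ∀ i q, Sum.inr q ∈ Vmid → Sum.inr q ∈ A i → Sum.inr q ∈ Vout ∨ Sum.inr q ∈ C.covered
  fv_mid : ∀ v ∈ C.fv, v ∈ Vmid
  fv_in : ∀ v ∈ C.fv, v ∈ Vin ∨ v ∈ C.overwr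
  fv_F : ∀ v ∈ C.fv, v ∈ F → v ∈ Vin
  fv_out : ∀ q, Sum.inr q ∈ C.fv → Sum.inr q ∈ Vout
  F_inner : ∀ v ∈ F, v ∉ C.inner
  F_written : ∀ v ∈ F, v ∉ C.written

/-! ### Passing the side conditions on to subcontexts -/

namespace Side

variable {n : ℕ} {C D : Ctx S n} {A B : Fin n → Set S.Var} {F Vin Vmid Vout : Set S.Var}

/-- Between `C` and `D` equality is claimed for the variables that were equal before and those that
`C` overwrites. The intersection with `Vmid` ensures that the intermediate set is an admissible
postcondition. -/
theorem seq_left (h : Side (.seq C D) A B F Vin Vmid Vout) :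
    Side C A B F Vin Vmid ((Vin ∩ Vmid) ∪ C.overwr) := by
  obtain ⟨h1, h2, h3, h4, h5, h6, h7, h8, h9, h10, h11, h12, h13, h14, h15, h16, h17⟩ := h
  have ho := C.overwr_subset_fv
  have ho' := D.overwr_subset_fv
  simp only [Ctx.inner, Ctx.overwr, Ctx.covered, Ctx.fv, Ctx.written, Set.mem_union,
    Set.mem_inter_iff, Set.mem_sdiff] at *
  constructor <;> (try simp only [Set.mem_union, Set.mem_inter_iff]) <;> grind

theorem seq_right (h : Side (.seq C D) A B F Vin Vmid Vout) :
    Side D A B F ((Vin ∩ Vmid) ∪ C.overwr) Vmid Vout := by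
  obtain ⟨h1, h2, h3, h4, h5, h6, h7, h8, h9, h10, h11, h12, h13, h14, h15, h16, h17⟩ := h
  have ho := C.overwr_subset_fv
  simp only [Ctx.inner, Ctx.overwr, Ctx.covered, Ctx.fv, Ctx.written, Set.mem_union,
    Set.mem_inter_iff, Set.mem_sdiff] at *
  constructor <;> (try simp only [Set.mem_union, Set.mem_inter_iff]) <;> grind

theorem ite_left {e : Expr S (ULift.{u} Bool)} (h : Side (.ite e C D) A B F Vin Vmid Vout) :
    Side C A B F Vin Vmid Vout := by
  obtain ⟨h1, h2, h3, h4, h5, h6, h7, h8, h9, h10, h11, h12, h13, h14, h15, h16, h17⟩ := h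
  simp only [Ctx.inner, Ctx.overwr, Ctx.covered, Ctx.fv, Ctx.written, Set.mem_union,
    Set.mem_inter_iff, Set.mem_sdiff] at *
  constructor <;> grind

theorem ite_right {e : Expr S (ULift.{u} Bool)} (h : Side (.ite e C D) A B F Vin Vmid Vout) :
    Side D A B F Vin Vmid Vout := by
  obtain ⟨h1, h2, h3, h4, h5, h6, h7, h8, h9, h10, h11, h12, h13, h14, h15, h16, h17⟩ := h
  simp only [Ctx.inner, Ctx.overwr, Ctx.covered, Ctx.fv, Ctx.written, Set.mem_union,
    Set.mem_inter_iff, Set.mem_sdiff] at *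
  constructor <;> grind

/-- A loop overwrites nothing, so the invariant is what is equal at the start, cut down to `Vmid`.
-/
theorem whileLoop {e : Expr S (ULift.{u} Bool)}
    (h : Side (.whileLoop e C) A B F Vin Vmid Vout) :
    Side C A B F (Vin ∩ Vmid) Vmid (Vin ∩ Vmid) := by
  obtain ⟨h1, h2, h3, h4, h5, h6, h7, h8, h9, h10, h11, h12, h13, h14, h15, h16, h17⟩ := h
  simp only [Ctx.inner, Ctx.overwr, Ctx.covered, Ctx.fv, Ctx.written, Set.mem_union,
    Set.mem_empty_iff_false, or_false] at *
  constructor <;> (try simp only [Set.mem_inter_iff]) <;> grind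

theorem loc {v : S.Var} (hC : ¬ C.IsProgram) (h : Side (.loc v C) A B F Vin Vmid Vout) :
    Side C A B F (Vin ∪ {v}) Vmid (Vout ∪ {v}) := by
  obtain ⟨h1, h2, h3, h4, h5, h6, h7, h8, h9, h10, h11, h12, h13, h14, h15, h16, h17⟩ := h
  simp only [Ctx.inner, Ctx.overwr, Ctx.covered, Ctx.fv, Ctx.written, if_neg hC, Set.mem_union,
    Set.mem_sdiff, Set.mem_singleton_iff] at *
  constructor <;> (try simp only [Set.mem_union, Set.mem_singleton_iff]) <;> grind

/-- Without holes, `v` need not be inner, so it may lie outside `Vmid` or inside `F`. Hence `v` is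
added to `Vmid` and the predicate is made trivial; the conditions on holes are void because
everything is covered. -/
theorem loc_of_isProgram {v : S.Var} (hC : C.IsProgram)
    (h : Side (.loc v C) A B F Vin Vmid Vout) :
    Side C A B ∅ (Vin ∪ {v}) (Vmid ∪ {v}) (Vout ∪ {v}) := by
  obtain ⟨h1, h2, h3, h4, h5, h6, h7, h8, h9, h10, h11, h12, h13, h14, h15, h16, h17⟩ := h
  have hi := C.inner_of_isProgram hC
  have hc := C.covered_of_isProgram hC
  simp only [Ctx.overwr, Ctx.fv, Set.mem_sdiff, Set.mem_singleton_iff] at *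
  constructor <;>
    simp only [hi, hc, Set.mem_union, Set.mem_singleton_iff, Set.mem_empty_iff_false,
      Set.mem_univ] <;> grind

end Side

/-- The rule for the programs `c` and `d` in a hole. -/
def HoleRule (R : QPred S) (A B F Vmid : Set S.Var) (c d : Prog S) : Prop :=
  ∀ Vin Vout : Set S.Var, Vout ⊆ Vmid → Vout ⊆ Vin →
    (∀ q, Sum.inr q ∈ Vin → Sum.inr q ∈ Vout) → (∀ v ∈ Vmid, v ∈ F → v ∈ Vin) →
    (∀ x, Sum.inl x ∈ Vmid → Sum.inl x ∉ Vin → Sum.inl x ∈ A → Sum.inl x ∈ B) →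
    (∀ q, Sum.inr q ∈ Vmid → Sum.inr q ∉ Vin → Sum.inr q ∉ A) → XJ R Vin Vout c d

theorem top_isOver (F F' : Set S.Var) : (⊤ : QPred S).IsOver F F' :=
  ⟨fun _ _ _ _ _ _ => rfl, fun _ _ => ⟨⊤, fun _ => ⟨fun _ _ _ => trivial, fun _ => trivial⟩⟩⟩

theorem xj_loc {R : QPred S} {F Vin Vout : Set S.Var} {c d : Prog S} {v : S.Var}
    (hR : R.IsOver F F) (hv : v ∉ F) (h1 : v ∈ Vout → v ∈ Vin)
    (h2 : ∀ q, v = Sum.inr q → v ∈ Vin → v ∈ Vout) (h : XJ R (Vin ∪ {v}) (Vout ∪ {v}) c d) :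
    XJ R Vin Vout (.loc v c) (.loc v d) := by
  rcases v with x | q
  · exact XJ.loc_inl hR hv h1 h
  · exact XJ.loc_inr hR hv ⟨h2 q rfl, h1⟩ h

/-- Induction over `C`, generalizing `R` and all variable sets. The rule for the holes is assumed
only if there are holes, because the hole-free case under `local` continues with a different
predicate and a different `Vmid`, for which no such rule is known. -/
theorem xj_fill {n : ℕ} {A B : Fin n → Set S.Var} {s s' : Fin n → Prog S} :
    ∀ (C : Ctx S n) {R : QPred S} {F Vin Vmid Vout : Set S.Var}, R.IsOver F F →
    (C.IsProgram ∨ ∀ i, HoleRule R (A i) (B i) F Vmid (s i) (s' i)) →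
    Side C A B F Vin Vmid Vout → XJ R Vin Vout (C.fill s) (C.fill s')
  | .hole i, R, F, Vin, Vmid, Vout, hR, hh, h => by
      have hh := hh.resolve_left id i
      obtain ⟨h1, h2, h3, h4, h5, h6, h7, h8, h9, h10, h11, h12, h13, h14, h15, h16, h17⟩ := h
      simp only [Ctx.overwr, Ctx.covered, Set.mem_empty_iff_false, or_false, false_or] at *
      exact hh Vin Vout h2 h3 h5 h7 (fun x k1 k2 k3 => (h9 i x k1 k3).resolve_left k2)
        fun q k1 k2 k3 => k2 (h10 i q k1 k3)
  | .skip, R, F, Vin, Vmid, Vout, hR, hh, h =>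
      (xj_skip R Vin).weaken subset_rfl (fun _ => id) (fun v hv => (h.out_in v hv).resolve_right id)
        fun q hq => (h.in_out q hq).resolve_right id
  | .assign X e, R, F, Vin, Vmid, Vout, hR, hh, h => by
      refine XJ.frame hR h.F_written h.F_written (xj_assign X e ?_ ?_ ?_)
      · exact fun v hv => (h.fv_in v (Or.inr hv)).resolve_right fun k => k.2 hv
      · exact fun v hv => (h.out_in v hv).imp_right fun k => k.1
      · exact fun q => ⟨fun k => (h.in_out q k).resolve_right (by rintro ⟨⟨_, k⟩, -⟩; cases k),
          fun k => (h.out_in _ k).resolve_right (by rintro ⟨⟨_, k⟩, -⟩; cases k)⟩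
  | .sample X e, R, F, Vin, Vmid, Vout, hR, hh, h => by
      refine XJ.frame hR h.F_written h.F_written (xj_sample X e ?_ ?_ ?_)
      · exact fun v hv => (h.fv_in v (Or.inr hv)).resolve_right fun k => k.2 hv
      · exact fun v hv => (h.out_in v hv).imp_right fun k => k.1
      · exact fun q => ⟨fun k => (h.in_out q k).resolve_right (by rintro ⟨⟨_, k⟩, -⟩; cases k),
          fun k => (h.out_in _ k).resolve_right (by rintro ⟨⟨_, k⟩, -⟩; cases k)⟩
  | .measure X Q e, R, F, Vin, Vmid, Vout, hR, hh, h => by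
      refine XJ.frame hR h.F_written h.F_written (xj_measure X Q e ?_ ?_ ?_ ?_)
      · exact fun v hv => (h.fv_in v (Or.inr hv)).resolve_right fun k => k.2 hv
      · exact fun v hv => (h.fv_in v (Or.inl (Or.inl hv))).resolve_right (by
          rintro ⟨⟨_, rfl⟩, -⟩
          obtain ⟨_, k⟩ := hv
          cases k)
      · exact fun v hv => (h.out_in v hv).imp_right fun k => k.1
      · exact fun q => ⟨fun k => (h.in_out q k).resolve_right (by rintro ⟨⟨_, k⟩, -⟩; cases k),
          fun k => (h.out_in _ k).resolve_right (by rintro ⟨⟨_, k⟩, -⟩; cases k)⟩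
  | .qapply Q e, R, F, Vin, Vmid, Vout, hR, hh, h => by
      refine XJ.frame hR h.F_written h.F_written ((xj_qapply Q e (V := Vin) ?_ ?_).weaken subset_rfl
        (fun _ => id) (fun v hv => (h.out_in v hv).resolve_right id)
        fun q hq => (h.in_out q hq).resolve_right id)
      · exact fun v hv => (h.fv_in v (Or.inr hv)).resolve_right id
      · exact fun v hv => (h.fv_in v (Or.inl hv)).resolve_right id
  | .qinit Q e, R, F, Vin, Vmid, Vout, hR, hh, h => by
      refine XJ.frame hR h.F_written h.F_written (xj_qinit Q e ?_ ?_ ?_)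
      · rintro v ⟨x, hx, rfl⟩
        exact (h.fv_in _ (Or.inr ⟨x, hx, rfl⟩)).resolve_right (by rintro ⟨_, k⟩; cases k)
      · exact fun x hx => (h.out_in _ hx).resolve_right (by rintro ⟨_, k⟩; cases k)
      · have hf : ∀ q, (Sum.inr q : S.Var) ∈ Ctx.qset Q → Sum.inr q ∈ Vout :=
          fun q hq => h.fv_out q (Or.inl hq)
        refine fun q => ⟨fun k => (h.out_in _ k).imp_right mem_qset.1, ?_⟩
        rintro (k | k)
        · exact (h.in_out q k).elim id (hf q)
        · exact hf q (mem_qset.2 k)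
  | .ite e C D, R, F, Vin, Vmid, Vout, hR, hh, h =>
      XJ.ite (fun v hv => (h.fv_in v (Or.inl (Or.inl hv))).resolve_right fun k => k.2 hv)
        (xj_fill C hR (hh.imp_left And.left) h.ite_left)
        (xj_fill D hR (hh.imp_left And.right) h.ite_right)
  | .whileLoop e C, R, F, Vin, Vmid, Vout, hR, hh, h =>
      (XJ.whileLoop (V := Vin ∩ Vmid)
        (fun v hv => ⟨(h.fv_in v (Or.inl hv)).resolve_right id, h.fv_mid v (Or.inl hv)⟩)
        (xj_fill C hR hh h.whileLoop)).weaken Set.inter_subset_left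
        (fun q hq => ⟨hq, h.out_mid _ ((h.in_out q hq).resolve_right id)⟩)
        (fun v hv => ⟨(h.out_in v hv).resolve_right id, h.out_mid v hv⟩)
        fun q hq => (h.in_out q hq.1).resolve_right id
  | .seq C D, R, F, Vin, Vmid, Vout, hR, hh, h =>
      XJ.seq (xj_fill C hR (hh.imp_left And.left) h.seq_left)
        (xj_fill D hR (hh.imp_left And.right) h.seq_right)
  | .loc v C, R, F, Vin, Vmid, Vout, hR, hh, h => by
      have h1 : v ∈ Vout → v ∈ Vin := fun k => (h.out_in v k).resolve_right fun k => k.2 rfl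
      have h2 : ∀ q, v = Sum.inr q → v ∈ Vin → v ∈ Vout := by
        rintro q rfl k
        exact (h.in_out q k).resolve_right fun k => k.2 rfl
      by_cases hC : C.IsProgram
      -- The body is treated with the trivial predicate, and `R` is framed around the whole `local`
      -- statement, which does not write outside its scope any variable of `F`.
      · have h3 := h.F_written
        refine XJ.frame hR ?_ ?_ (xj_loc (top_isOver ∅ ∅) (fun k => k) h1 h2
          (xj_fill C (top_isOver ∅ ∅) (Or.inl hC) (h.loc_of_isProgram hC)))
        · rwa [Ctx.written_fill s (.loc v C) hC]
        · rwa [Ctx.written_fill s' (.loc v C) hC]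
      · refine xj_loc hR (fun k => h.F_inner v k ?_) h1 h2 (xj_fill C hR hh (h.loc hC))
        rw [Ctx.inner, if_neg hC]
        exact Or.inr rfl

end

end

end QRHL

theorem mainTheorem1 (S : VarSystem.{u}) (n : ℕ) (C : Ctx S n) (s s' : Fin n → Prog S)
    (R : QPred S) (hR : R.FinitelySupported)
    (Vin Vmid Vout VR : Set S.Var) (aux : S.QVar)
    (hVin : Vin.Finite) (hVmid : Vmid.Finite) (hVout : Vout.Finite)
    (hVR : VR = R.fv₁ ∪ R.fv₂)
    (haux_inf : Infinite (S.qtyp aux))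
    (haux_R : Sum.inr aux ∉ VR)
    (haux_s : ∀ i, Sum.inr aux ∉ (s i).fv)
    (haux_s' : ∀ i, Sum.inr aux ∉ (s' i).fv)
    (haux_mid : Sum.inr aux ∈ Vmid)
    (h_inner_mid : C.inner ⊆ Vmid)
    (h_out_mid : Vout ⊆ Vmid)
    (h_out_in : Vout \ C.overwr ⊆ Vin)
    (h_out_in_R : (Vout \ Vin) ∩ VR = ∅)
    (h_in_out : quPart Vin ⊆ Vout ∪ C.overwr)
    (h_in_out_R : quPart (Vin \ Vout) ∩ VR = ∅)
    (h_mid_R : Vmid ∩ VR ⊆ Vin ∪ C.covered)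
    (h_mid_R_qu : quPart (Vmid ∩ VR) ⊆ Vout ∪ C.covered)
    (h_mid_s : ∀ i, Vmid ∩ ((s i).fv ∪ (s' i).fv) ⊆
      Vin ∪ C.covered ∪ clPart ((s i).overwr ∩ (s' i).overwr))
    (h_mid_s_qu : ∀ i, quPart Vmid ∩ ((s i).fv ∪ (s' i).fv) ⊆ Vout ∪ C.covered)
    (h_fv_mid : C.fv ⊆ Vmid)
    (h_fv_in : C.fv ⊆ Vin ∪ C.overwr)
    (h_fv_R : C.fv ∩ VR ⊆ Vin)
    (h_fv_out : quPart C.fv ⊆ Vout)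
    (h_R_inner : VR ∩ C.inner = ∅)
    (h_R_written : VR ∩ C.written = ∅)
    (h_s : ∀ i, Judgment (R ⊓ eqv Vmid) (s i) (s' i) (R ⊓ eqv Vmid)) :
    Judgment (R ⊓ eqv Vin) (C.fill s) (C.fill s') (R ⊓ eqv Vout) := by
  have hF : VR.Finite := by
    obtain ⟨F₁, F₂, h1, h2, h3⟩ := hR
    rw [hVR]
    exact (h1.subset fun v (hv : v ∈ R.fv₁) => hv F₁ F₂ h3).union
      (h2.subset fun v (hv : v ∈ R.fv₂) => hv F₁ F₂ h3)
  -- By finite support there is a smallest pair of variable sets for `R`; enlarging both to `VR`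
  -- allows one set to serve for both memories.
  have hover : R.IsOver VR VR := by
    rw [hVR]
    exact hR.isOver_fv.mono Set.subset_union_left Set.subset_union_right
  have hq : ∀ q : S.QVar, (Sum.inr q : S.Var) ∈ Set.range (Sum.inr : S.QVar → S.Var) :=
    fun q => ⟨q, rfl⟩
  refine judgment_of_xj (xj_fill C (A := fun i => (s i).fv ∪ (s' i).fv)
    (B := fun i => (s i).overwr ∩ (s' i).overwr) (F := VR) (Vmid := Vmid) hover
    (Or.inr fun i Vin Vout h1 h2 h3 h4 h5 h6 => ?_) ?_)
  · exact xj_of_judgment hover hF hVmid haux_inf haux_mid haux_R (haux_s i) (haux_s' i) h1 h2 h3 h4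
      (fun x k1 k2 k3 => (h5 x k1 k2 (Or.inl k3)).1)
      (fun q k1 k2 => not_or.1 (h6 q k1 k2)) (h_s i)
  · have disj : ∀ {A B : Set S.Var}, A ∩ B = ∅ → ∀ v ∈ A, v ∉ B := fun h v h1 h2 =>
      Set.eq_empty_iff_forall_notMem.1 h v ⟨h1, h2⟩
    exact
    { inner_mid := fun v hv => h_inner_mid hv
      out_mid := fun v hv => h_out_mid hv
      out_in := fun v hv => or_iff_not_imp_right.2 fun h => h_out_in ⟨hv, h⟩
      out_F := fun v hv h => by_contra fun h' => disj h_out_in_R v ⟨hv, h'⟩ h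
      in_out := fun q h => h_in_out ⟨h, hq q⟩
      in_F := fun q h h' => by_contra fun k => disj h_in_out_R _ ⟨⟨h, k⟩, hq q⟩ h'
      mid_F := fun v h h' => h_mid_R ⟨h, h'⟩
      mid_F_out := fun q h h' => h_mid_R_qu ⟨⟨h, h'⟩, hq q⟩
      mid_cl := fun i x h h' => (h_mid_s i ⟨h, h'⟩).elim (fun k => k.imp_right Or.inl)
        fun k => Or.inr (Or.inr k.1)
      mid_qu := fun i q h h' => (h_mid_s i ⟨h, h'⟩).resolve_right (by rintro ⟨-, _, k⟩; cases k)
      mid_out := fun i q h h' => h_mid_s_qu i ⟨⟨h, hq q⟩, h'⟩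
      fv_mid := fun v h => h_fv_mid h
      fv_in := fun v h => h_fv_in h
      fv_F := fun v h h' => h_fv_R ⟨h, h'⟩
      fv_out := fun q h => h_fv_out ⟨h, hq q⟩
      F_inner := disj h_R_inner
      F_written := disj h_R_written }
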